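/- Let $n\ge 1$ and let $(q_1,\dots,q_n,p_1,\dots,p_n)\in\mathbb C^{2n}$ carry the canonical bracket $\{q_i,q_j\}_0=\{p_i,p_j\}_0=0$, $\{q_i,p_j\}_0=\delta_{ij}$. For $a_0,a_1,a_2\in\mathbb C$ put $$L_i(\lambda)=\begin{pmatrix}\lambda-p_i&-e^{q_i}\\ e^{-q_i}&0\end{pmatrix},\qquad K_-(\lambda)=\begin{pmatrix}2a_2\lambda^2-\mathrm i a_1\lambda+a_0&(4a_2e^{q_n}+1)\lambda\\0&2a_2\lambda^2+\mathrm i a_1\lambda+a_0\end{pmatrix},$$ $$T(\lambda)=L_1(\lambda)\cdots L_n(\lambda)\,K_-(\lambda)\,\bigl(L_1(-\lambda)\cdots L_n(-\lambda)\bigr)^{-1}=\begin{pmatrix}A(\lambda)&B(\lambda)\\C(\lambda)&D(\lambda)\end{pmatrix}.$$ For $k\in\{0,1\}$ let $\rho_k(\lambda)$ be the polynomial quotient of $\lambda^{2k-1}A(\lambda)$ by $B(\lambda)$ (so $\rho_0=0$ here). A skew-symmetric bracket satisfies the relations $(R_k)$ if for all $\lambda,\mu\in\mathbb C$ with $\lambda\ne\pm\mu$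 (with $\eta=1$): $$\{B(\lambda),B(\mu)\}=0,\qquad \{A(\lambda),A(\mu)\}=\tfrac{\eta}{\lambda+\mu}\bigl(\mu^{2k}B(\lambda)C(\mu)-\lambda^{2k}B(\mu)C(\lambda)\bigr),$$ $$\{C(\lambda),C(\mu)\}=2\eta\bigl(\rho_k(-\mu)A(\mu)-\rho_k(\mu)A(-\mu)\bigr)C(\lambda)-2\eta\bigl(\rho_k(-\lambda)A(\lambda)-\rho_k(\lambda)A(-\lambda)\bigr)C(\mu),$$ $$\{A(\lambda),B(\mu)\}=\tfrac{\eta}{\lambda-\mu}\bigl(\lambda^{2k}A(\lambda)B(\mu)-\mu^{2k}A(\mu)B(\lambda)\bigr)+\tfrac{\eta}{\lambda+\mu}\bigl(\lambda^{2k}A(\lambda)B(\mu)+\mu^{2k}A(-\mu)B(\lambda)\bigr)-2\eta\rho_k(\lambda)B(\lambda)B(\mu),$$ $$\{A(\lambda),C(\mu)\}=-\tfrac{\eta}{\lambda-\mu}\bigl(\mu^{2k}A(\lambda)C(\mu)-\lambda^{2k}A(\mu)C(\lambda)\bigr)-2\eta k\lambda A(\lambda)C(\mu)-\tfrac{\eta}{\lambda+\mu}\bigl(\mu^{2k}A(\lambda)C(\mu)+\lambda^{2k}A(-\mu)C(\lambda)\bigr)+2\eta\rho_k(\lambda)B(\lambda)C(\mu),$$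 $$\{B(\lambda),C(\mu)\}=\tfrac{\eta\lambda^{2k}}{\lambda-\mu}\bigl(A(-\lambda)A(\mu)-A(\lambda)A(-\mu)\bigr)+\tfrac{\eta\lambda^{2k}}{\lambda+\mu}\bigl(A(\lambda)A(\mu)-A(-\lambda)A(-\mu)\bigr)+2\eta\bigl(\rho_k(\mu)A(-\mu)-\rho_k(-\mu)A(\mu)\bigr)B(\lambda);$$ the relations for $\{B,B\}$ and $\{C,C\}$ are imposed for all $\lambda,\mu$. Write $E_i=e^{q_i-q_{i+1}}$, $X=e^{q_n}$ and, for $n\ge2$, $Z=a_2^2e^{q_{n-1}+q_n}$. Define two skew-symmetric brackets $\{\cdot,\cdot\}_1$ whose values on coordinates are as follows, all those not listed being zero. **$(BC)$**, $n\ge1$: * $\{q_i,q_j\}_1=-2p_j$ for $i<j$; $\{p_i,p_{i+1}\}_1=-(p_i+p_{i+1})E_i$, $\{q_{i+1},p_i\}_1=E_i$, $\{q_i,p_i\}_1=p_i^2+2E_i$ for $1\le i\le n-1$; * $\{q_i,p_{i+1}\}_1=2E_{i+1}-E_i$ and $\{p_n,q_i\}_1=2E_{n-1}-2a_0X-2a_1^2X^2$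 for $1\le i\le n-2$; $\{p_i,q_j\}_1=2E_{i-1}-2E_i$ for $3\le i\le n-1$, $1\le j\le i-2$; * $\{q_n,p_n\}_1=p_n^2+2a_0X+a_1^2X^2$; $\{q_{n-1},p_n\}_1=2a_0X+2a_1^2X^2-E_{n-1}$ (if $n\ge2$). **$(D)$**, $n\ge2$: * $\{q_i,q_j\}_1=-2p_j$ for $i<j$; $\{p_i,p_{i+1}\}_1=-(p_i+p_{i+1})E_i$, $\{q_{i+1},p_i\}_1=E_i$, $\{q_i,p_i\}_1=p_i^2+2E_i$, $\{p_n,q_i\}_1=2E_{n-1}-2Z$ for $1\le i\le n-2$; * $\{q_i,p_{i+1}\}_1=2E_{i+1}-E_i$ and $\{p_{n-1},q_i\}_1=2E_{n-2}-2E_{n-1}-2Z$ for $1\le i\le n-3$; $\{p_i,q_j\}_1=2E_{i-1}-2E_i$ for $3\le i\le n-2$, $1\le j\le i-2$; * $\{q_n,p_n\}_1=p_n^2$; $\{q_{n-1},p_{n-1}\}_1=p_{n-1}^2+2E_{n-1}+2Z$; $\{q_n,p_{n-1}\}_1=\{p_n,q_{n-1}\}_1=E_{n-1}-Z$; $\{q_{n-2},p_{n-1}\}_1=-E_{n-2}+2E_{n-1}+2Z$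 (if $n\ge3$); $\{p_{n-1},p_n\}_1=-(p_{n-1}+p_n)E_{n-1}+(p_{n-1}-p_n)Z$. **Theorem.** (1) *($BC_n$, $n\ge1$.)* Let $a_2=0$, $a_0,a_1\in\mathbb C$, and substitute $p_n\to p_n-\mathrm i a_1e^{q_n}$ in $T(\lambda)$. This change is canonical. After it $D(\lambda)=A(-\lambda)$, and at every point of $\mathbb C^{2n}$ the canonical bracket is the unique skew-symmetric bracket (bivector) satisfying $(R_0)$, and the bracket $(BC)$ is the unique one satisfying $(R_1)$. Every linear combination of the canonical bracket and $(BC)$ is a Poisson bracket. Moreover, with $K_+=\begin{pmatrix}0&0\\1&0\end{pmatrix}$, $$\operatorname{tr}K_+T(\lambda)=(-1)^n\Bigl(\lambda^{2n+1}+\sum_{i=1}^nH_i\lambda^{2(n-i)+1}\Bigr),\qquad -H_1=\sum_{i=1}^np_i^2+2\sum_{i=1}^{n-1}E_i+2a_0e^{q_n}+a_1^2e^{2q_n},$$ and $\{H_i,H_j\}_0=\{H_i,H_j\}_1=0$ for all $1\le i,j\le n$. (2) *($D_n$, $n\ge2$.)* Let $a_0=a_1=0$, $a_2\in\mathbb C\setminus\{0\}$,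 $u=q_n+\ln(-a_2)$ (principal logarithms throughout), and substitute $$p_n\to-p_n\,\frac{\cosh u+1}{\sinh u},\qquad q_n\to-\ln\bigl(-2a_2(\cosh u+1)\bigr)$$ in $T(\lambda)$. On the set $\sinh u\neq0$ the following holds. The change is canonical wherever $-2a_2(\cosh u+1)\notin(-\infty,0]$. After it $D(\lambda)=A(-\lambda)$, and at every point the canonical bracket is the unique skew-symmetric bracket satisfying $(R_0)$, and the bracket $(D)$ is the unique one satisfying $(R_1)$. The expansion of $\operatorname{tr}K_+T(\lambda)$ in (1) holds with $-H_1=\sum_{i=1}^n p_i^2+2\sum_{i=1}^{n-1}E_i+2a_2^2e^{q_{n-1}+q_n}$, and $\{H_i,H_j\}_0=\{H_i,H_j\}_1=0$ for all $1\le i,j\le n$. On all of $\mathbb C^{2n}$, every linear combination of the canonical bracket and $(D)$ is a Poisson bracket, and the $H_i$ extend to entire functions that are in involution for both brackets everywhere. -/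

import Mathlib

open Polynomial

noncomputable section

namespace TodaReflection

/-! ### Phase space and brackets -/

/-- The complex phase space with coordinates `q₁,…,qₙ` (left summand) and `p₁,…,pₙ` (right summand).
The site with number `i` in the usual numbering `1,…,n` has index `i - 1` in `Fin n`. -/
abbrev Phase (n : ℕ) : Type := Fin n ⊕ Fin n → ℂ

/-- The coordinate `qᵢ`, for `1 ≤ i ≤ n`. -/
def qc {n : ℕ} (z : Phase n) (i : ℕ) : ℂ := if h : i - 1 < n then z (Sum.inl ⟨i - 1, h⟩) else 0

/-- The coordinate `pᵢ`, for `1 ≤ i ≤ n`. -/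
def pc {n : ℕ} (z : Phase n) (i : ℕ) : ℂ := if h : i - 1 < n then z (Sum.inr ⟨i - 1, h⟩) else 0

/-- The matrix of a bivector at a point. -/
abbrev BivMatrix (n : ℕ) : Type := Matrix (Fin n ⊕ Fin n) (Fin n ⊕ Fin n) ℂ

/-- Partial derivative in the coordinate `a`. -/
def pd {n : ℕ} (f : Phase n → ℂ) (a : Fin n ⊕ Fin n) (z : Phase n) : ℂ :=
  fderiv ℂ f z (Pi.single a 1)

/-- `{f, g} = ∑ Mᵃᵇ ∂f/∂zₐ ∂g/∂z_b` at the point `z`, for a bivector with value `M` at `z`. -/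
def bracketAt {n : ℕ} (M : BivMatrix n) (f g : Phase n → ℂ) (z : Phase n) : ℂ :=
  ∑ a, ∑ b, M a b * pd f a z * pd g b z

/-- The bracket of functions given by the bivector field `P`. -/
def bracket {n : ℕ} (P : Phase n → BivMatrix n) (f g : Phase n → ℂ) : Phase n → ℂ :=
  fun z => bracketAt (P z) f g z

/-- `P` defines a holomorphic Poisson bracket (the Leibniz rule is automatic for `bracket P`). -/
structure IsPoisson {n : ℕ} (P : Phase n → BivMatrix n) : Prop where
  holomorphic : ∀ a b, Differentiable ℂ (fun z => P z a b)
  skew : ∀ f g : Phase n → ℂ, Differentiable ℂ f → Differentiable ℂ g →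
    bracket P f g = - bracket P g f
  jacobi : ∀ f g h : Phase n → ℂ, Differentiable ℂ f → Differentiable ℂ g → Differentiable ℂ h →
    bracket P f (bracket P g h) + bracket P g (bracket P h f) + bracket P h (bracket P f g) = 0

/-- Every linear combination of the two brackets is a Poisson bracket. -/
def Compatible {n : ℕ} (P₀ P₁ : Phase n → BivMatrix n) : Prop :=
  ∀ c₀ c₁ : ℂ, IsPoisson (fun z => c₀ • P₀ z + c₁ • P₁ z)

/-- The canonical bracket: `{qᵢ, qⱼ} = {pᵢ, pⱼ} = 0`, `{qᵢ, pⱼ} = δᵢⱼ`. -/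
def canonical {n : ℕ} (_z : Phase n) : BivMatrix n := Matrix.fromBlocks 0 1 (-1) 0

/-- The change of variables `Φ` is differentiable at `z` and its components have the canonical
brackets there. -/
def IsCanonicalAt {n : ℕ} (Φ : Phase n → Phase n) (z : Phase n) : Prop :=
  DifferentiableAt ℂ Φ z ∧
    ∀ a b, bracket canonical (fun w => Φ w a) (fun w => Φ w b) z = canonical z a b

/-! ### The family of quadratic brackets on `2 × 2` polynomial matrices -/

/-- The polynomial `ρ_k = [λ^(2k-1) A(λ) / B(λ)]`, the quotient in the division with remainder in
`ℂ[λ]`; numerator and denominator are multiplied by `λ`, so that `k = 0` needs no negative power. -/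
def rho (k : ℕ) (A B : ℂ[X]) : ℂ[X] := (X ^ (2 * k) * A) / (X * B)

/-- The function `A(λ)` on phase space, for `T = (A, B; C, A(-λ))`. -/
def fA {n : ℕ} (T : Phase n → Matrix (Fin 2) (Fin 2) ℂ[X]) (l : ℂ) (w : Phase n) : ℂ :=
  (T w 0 0).eval l

/-- The function `B(λ)` on phase space. -/
def fB {n : ℕ} (T : Phase n → Matrix (Fin 2) (Fin 2) ℂ[X]) (l : ℂ) (w : Phase n) : ℂ :=
  (T w 0 1).eval l

/-- The function `C(λ)` on phase space. -/
def fC {n : ℕ} (T : Phase n → Matrix (Fin 2) (Fin 2) ℂ[X]) (l : ℂ) (w : Phase n) : ℂ :=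
  (T w 1 0).eval l

/-- The function `ρ_k(λ)` on phase space. -/
def fρ {n : ℕ} (k : ℕ) (T : Phase n → Matrix (Fin 2) (Fin 2) ℂ[X]) (l : ℂ) (w : Phase n) : ℂ :=
  (rho k (T w 0 0) (T w 0 1)).eval l

/-- The functions `A(λ)`, `B(λ)`, `C(λ)` read off from `T(λ)` satisfy at the point `z` the relations
of the `k`-th bracket (`k = 0, 1`) with constant `η`, for the bivector with value `M` at `z`. -/
structure SatisfiesBracket {n : ℕ} (η : ℂ) (k : ℕ) (T : Phase n → Matrix (Fin 2) (Fin 2) ℂ[X])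
    (M : BivMatrix n) (z : Phase n) : Prop where
  BB : ∀ l m : ℂ, bracketAt M (fB T l) (fB T m) z = 0
  AA : ∀ l m : ℂ, l ≠ m → l ≠ -m → bracketAt M (fA T l) (fA T m) z =
    η / (l + m) * (m ^ (2 * k) * fB T l z * fC T m z - l ^ (2 * k) * fB T m z * fC T l z)
  CC : ∀ l m : ℂ, bracketAt M (fC T l) (fC T m) z =
    2 * η * (fρ k T (-m) z * fA T m z - fρ k T m z * fA T (-m) z) * fC T l z
      - 2 * η * (fρ k T (-l) z * fA T l z - fρ k T l z * fA T (-l) z) * fC T m z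
  AB : ∀ l m : ℂ, l ≠ m → l ≠ -m → bracketAt M (fA T l) (fB T m) z =
    η / (l - m) * (l ^ (2 * k) * fA T l z * fB T m z - m ^ (2 * k) * fA T m z * fB T l z)
      + η / (l + m) * (l ^ (2 * k) * fA T l z * fB T m z + m ^ (2 * k) * fA T (-m) z * fB T l z)
      - 2 * η * fρ k T l z * fB T l z * fB T m z
  AC : ∀ l m : ℂ, l ≠ m → l ≠ -m → bracketAt M (fA T l) (fC T m) z =
    -(η / (l - m)) * (m ^ (2 * k) * fA T l z * fC T m z - l ^ (2 * k) * fA T m z * fC T l z)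
      - 2 * η * k * l * fA T l z * fC T m z
      - η / (l + m) * (m ^ (2 * k) * fA T l z * fC T m z + l ^ (2 * k) * fA T (-m) z * fC T l z)
      + 2 * η * fρ k T l z * fB T l z * fC T m z
  BC : ∀ l m : ℂ, l ≠ m → l ≠ -m → bracketAt M (fB T l) (fC T m) z =
    η * l ^ (2 * k) / (l - m) * (fA T (-l) z * fA T m z - fA T l z * fA T (-m) z)
      + η * l ^ (2 * k) / (l + m) * (fA T l z * fA T m z - fA T (-l) z * fA T (-m) z)
      + 2 * η * (fρ k T m z * fA T (-m) z - fρ k T (-m) z * fA T m z) * fB T l z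

/-- All entries of `T(λ)` are differentiable at `z`, and the lower right entry is `A(-λ)`. -/
def IsReflectionFormAt {n : ℕ} (T : Phase n → Matrix (Fin 2) (Fin 2) ℂ[X]) (z : Phase n) : Prop :=
  (∀ (l : ℂ) (r s : Fin 2), DifferentiableAt ℂ (fun w => (T w r s).eval l) z) ∧
    T z 1 1 = (T z 0 0).comp (-X)

/-! ### The Toda reflection representation -/

/-- The Lax matrix of one site. -/
def siteL (q p : ℂ) : Matrix (Fin 2) (Fin 2) ℂ[X] :=
  !![X - C p, -C (Complex.exp q); C (Complex.exp (-q)), 0]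

/-- The dynamical boundary matrix `K₋(λ)`. -/
def boundaryK (a₀ a₁ a₂ q : ℂ) : Matrix (Fin 2) (Fin 2) ℂ[X] :=
  !![C (2 * a₂) * X ^ 2 - C (Complex.I * a₁) * X + C a₀, C (4 * a₂ * Complex.exp q + 1) * X;
    0, C (2 * a₂) * X ^ 2 + C (Complex.I * a₁) * X + C a₀]

/-- `T(λ) = (∏ L_k(λ)) K₋(λ) (∏ L_k(-λ))⁻¹`, with products ordered as `L₁ L₂ ⋯ Lₙ`. -/
def todaT {n : ℕ} (a₀ a₁ a₂ : ℂ) (z : Phase n) : Matrix (Fin 2) (Fin 2) ℂ[X] :=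
  (List.ofFn fun i : Fin n => siteL (z (Sum.inl i)) (z (Sum.inr i))).prod
    * boundaryK a₀ a₁ a₂ (qc z n)
    * ((List.ofFn fun i : Fin n =>
        (siteL (z (Sum.inl i)) (z (Sum.inr i))).map (fun f => f.comp (-X))).prod)⁻¹

/-- The boundary matrix `K₊` of the open lattice. -/
def Kplus : Matrix (Fin 2) (Fin 2) ℂ[X] := !![0, 0; 1, 0]

/-- The integral `Hᵢ` (`1 ≤ i ≤ n`): the coefficient of `λ^(2(n-i)+1)` in `(-1)ⁿ tr K₊ T(λ)`. -/
def integralOf {n : ℕ} (T : Phase n → Matrix (Fin 2) (Fin 2) ℂ[X]) (i : ℕ) (z : Phase n) : ℂ :=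
  (-1) ^ n * (Matrix.trace (Kplus * T z)).coeff (2 * (n - i) + 1)

/-- `tr K₊ T(λ) = (-1)ⁿ (λ^(2n+1) + ∑ Hᵢ λ^(2(n-i)+1))` at `z`. -/
def GeneratesIntegralsAt {n : ℕ} (T : Phase n → Matrix (Fin 2) (Fin 2) ℂ[X]) (z : Phase n) : Prop :=
  Matrix.trace (Kplus * T z) = (-1) ^ n *
    (X ^ (2 * n + 1) + ∑ i ∈ Finset.Icc 1 n, C (integralOf T i z) * X ^ (2 * (n - i) + 1))

/-- `∑ pᵢ² + 2 ∑ e^(qᵢ - qᵢ₊₁) + V(q)`. -/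
def hamiltonian {n : ℕ} (V : Phase n → ℂ) (z : Phase n) : ℂ :=
  ∑ i ∈ Finset.Icc 1 n, pc z i ^ 2
    + 2 * ∑ i ∈ Finset.Icc 1 (n - 1), Complex.exp (qc z i - qc z (i + 1)) + V z

/-- `2 a₀ e^(qₙ) + a₁² e^(2qₙ)`. -/
def potentialBC {n : ℕ} (a₀ a₁ : ℂ) (z : Phase n) : ℂ :=
  2 * a₀ * Complex.exp (qc z n) + a₁ ^ 2 * Complex.exp (2 * qc z n)

/-- `2 a₂² e^(qₙ₋₁ + qₙ)`. -/
def potentialD {n : ℕ} (a₂ : ℂ) (z : Phase n) : ℂ :=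
  2 * a₂ ^ 2 * Complex.exp (qc z (n - 1) + qc z n)

/-! ### The canonical changes of variables -/

/-- The change `pₙ ↦ pₙ - i a₁ e^(qₙ)`. -/
def changeBC {n : ℕ} (a₁ : ℂ) (z : Phase n) : Phase n
  | Sum.inl i => z (Sum.inl i)
  | Sum.inr i =>
    if (i : ℕ) + 1 = n then z (Sum.inr i) - Complex.I * a₁ * Complex.exp (z (Sum.inl i))
    else z (Sum.inr i)

/-- The shifted coordinate `u = qₙ + ln(-a₂)`, for the principal logarithm. -/
def shifted {n : ℕ} (a₂ : ℂ) (z : Phase n) : ℂ := qc z n + Complex.log (-a₂)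

/-- The change `pₙ ↦ -pₙ (cosh u + 1) / sinh u`, `qₙ ↦ -ln(-2 a₂ (cosh u + 1))` with
`u = qₙ + ln(-a₂)`. -/
def changeD {n : ℕ} (a₂ : ℂ) (z : Phase n) : Phase n
  | Sum.inl i =>
    if (i : ℕ) + 1 = n then -Complex.log (-2 * a₂ * (Complex.cosh (shifted a₂ z) + 1))
    else z (Sum.inl i)
  | Sum.inr i =>
    if (i : ℕ) + 1 = n then
      -z (Sum.inr i) * ((Complex.cosh (shifted a₂ z) + 1) / Complex.sinh (shifted a₂ z))
    else z (Sum.inr i)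

/-- The matrix `T(λ)` of the `BCₙ` lattice in the new variables. -/
def laxBC {n : ℕ} (a₀ a₁ : ℂ) (z : Phase n) : Matrix (Fin 2) (Fin 2) ℂ[X] :=
  todaT a₀ a₁ 0 (changeBC a₁ z)

/-- The matrix `T(λ)` of the `Dₙ` lattice in the new variables. -/
def laxD {n : ℕ} (a₂ : ℂ) (z : Phase n) : Matrix (Fin 2) (Fin 2) ℂ[X] :=
  todaT 0 0 a₂ (changeD a₂ z)

/-! ### The explicit second brackets

All indices below are the usual numbers `1, …, n` of the sites. -/

/-- `e^(qᵢ - qᵢ₊₁)`. -/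
def E {n : ℕ} (z : Phase n) (i : ℕ) : ℂ := Complex.exp (qc z i - qc z (i + 1))

/-- `{qᵢ, qⱼ}₁` for `i < j`, and `0` otherwise. -/
def qqUpper {n : ℕ} (z : Phase n) (i j : ℕ) : ℂ := if i < j then -2 * pc z j else 0

/-- `{qᵢ, pⱼ}₁` for `BCₙ`. -/
def qpBC {n : ℕ} (a₀ a₁ : ℂ) (z : Phase n) (i j : ℕ) : ℂ :=
  if i = j then
    if j = n then
      pc z n ^ 2 + 2 * a₀ * Complex.exp (qc z n) + a₁ ^ 2 * Complex.exp (2 * qc z n)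
    else pc z i ^ 2 + 2 * E z i
  else if i = j + 1 then E z j
  else if j = i + 1 then
    if j = n then
      2 * a₀ * Complex.exp (qc z n) + 2 * a₁ ^ 2 * Complex.exp (2 * qc z n) - E z (n - 1)
    else 2 * E z (i + 1) - E z i
  else if i + 2 ≤ j then
    if j = n then
      -(2 * E z (n - 1) - 2 * a₀ * Complex.exp (qc z n) - 2 * a₁ ^ 2 * Complex.exp (2 * qc z n))
    else -(2 * E z (j - 1) - 2 * E z j)
  else 0

/-- `{pᵢ, pⱼ}₁` for `BCₙ` and `i < j`, and `0` otherwise. -/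
def ppUpperBC {n : ℕ} (z : Phase n) (i j : ℕ) : ℂ :=
  if j = i + 1 then -(pc z i + pc z (i + 1)) * E z i else 0

/-- `a₂² e^(qₙ₋₁ + qₙ)`. -/
def Z {n : ℕ} (a₂ : ℂ) (z : Phase n) : ℂ := a₂ ^ 2 * Complex.exp (qc z (n - 1) + qc z n)

/-- `{qᵢ, pⱼ}₁` for `Dₙ`. -/
def qpD {n : ℕ} (a₂ : ℂ) (z : Phase n) (i j : ℕ) : ℂ :=
  if i = j then
    if j = n then pc z n ^ 2
    else if j = n - 1 then pc z (n - 1) ^ 2 + 2 * E z (n - 1) + 2 * Z a₂ z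
    else pc z i ^ 2 + 2 * E z i
  else if i = j + 1 then
    if i = n then E z (n - 1) - Z a₂ z else E z j
  else if j = i + 1 then
    if j = n then -(E z (n - 1) - Z a₂ z)
    else if j = n - 1 then -E z (n - 2) + 2 * E z (n - 1) + 2 * Z a₂ z
    else 2 * E z (i + 1) - E z i
  else if i + 2 ≤ j then
    if j = n then -(2 * E z (n - 1) - 2 * Z a₂ z)
    else if j = n - 1 then -(2 * E z (n - 2) - 2 * E z (n - 1) - 2 * Z a₂ z)
    else -(2 * E z (j - 1) - 2 * E z j)
  else 0

/-- `{pᵢ, pⱼ}₁` for `Dₙ` and `i < j`, and `0` otherwise. -/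
def ppUpperD {n : ℕ} (a₂ : ℂ) (z : Phase n) (i j : ℕ) : ℂ :=
  if j = i + 1 then
    if j = n then
      -(pc z (n - 1) + pc z n) * E z (n - 1) + (pc z (n - 1) - pc z n) * Z a₂ z
    else -(pc z i + pc z (i + 1)) * E z i
  else 0

/-- The skew-symmetric matrix with the blocks `{q,q}`, `{q,p}`, `{p,q}`, `{p,p}`, from the values
`{qᵢ, qⱼ}`, `{pᵢ, pⱼ}` for `i < j` and `{qᵢ, pⱼ}` for all `i, j`. -/
def assemble {n : ℕ} (qq qp pp : ℕ → ℕ → ℂ) : BivMatrix n :=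
  Matrix.fromBlocks
    (Matrix.of fun i j : Fin n => qq (i + 1) (j + 1) - qq (j + 1) (i + 1))
    (Matrix.of fun i j : Fin n => qp (i + 1) (j + 1))
    (Matrix.of fun i j : Fin n => -qp (j + 1) (i + 1))
    (Matrix.of fun i j : Fin n => pp (i + 1) (j + 1) - pp (j + 1) (i + 1))

/-- The second bracket of the `BCₙ` Toda lattice. -/
def secondBC {n : ℕ} (a₀ a₁ : ℂ) (z : Phase n) : BivMatrix n :=
  assemble (qqUpper z) (qpBC a₀ a₁ z) (ppUpperBC z)

/-- The second bracket of the `Dₙ` Toda lattice. -/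
def secondD {n : ℕ} (a₂ : ℂ) (z : Phase n) : BivMatrix n :=
  assemble (qqUpper z) (qpD a₂ z) (ppUpperD a₂ z)

end TodaReflection

end

open Polynomial

noncomputable section

namespace TodaReflection

/-! ### The quadratic algebra, in terms of covectors -/

section Algebra

variable {V : Type*} [AddCommGroup V] [Module ℂ V]

/-! Everything is an induction on the number of sites, adding a site on the left: T = L₁(λ) T'(λ)
L₁(-λ)⁻¹, where T' belongs to the remaining chain, the tail. Only the last site sees the boundary.
The changes of variables bring its one-site matrix to a common normal form, with functions ρ, s, V
of q as in `Boundary`, so both types are treated by the same chain (`laxBC_eq`, `laxD_eq`).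

The relations (R_0) and (R_1) are members of one family, for the pencil c₀{·,·}₀ + c₁{·,·}₁: replace
λ^(2k) by c₀ + c₁λ² and ρ_k by c₁ρ₁. They involve a bivector only through its values on the
covectors dA(λ), dB(λ), dC(λ). That they survive the addition of a site is a finite bilinear
computation (`ReflectionAlgebra.dress`), once the brackets of q₁, p₁ with the entries of T' are
known. These are known because the second bracket is itself recursive: on the tail, q₁ acts by the
canonical Hamiltonian field of H + e^(q₁)ρ₁, with H = -H₁ and ρ₁ those of the tail, and p₁ acts by a
similar field. The canonical brackets of H and ρ₁ with A, B, C close up (`siteRelations`). The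
explicit tables have this recursive structure by `isSecondFamily_BC` and `isSecondFamily_D`.

Uniqueness: where s(qₙ) ≠ 0, the covectors dA(λ), dB(λ) span the cotangent space
(`eq_zero_of_dA_dB`). Indeed det T is constant, so a vector annihilated by them is annihilated by
dC(λ) as well; and C is, up to an exponential, the B of the tail, so the first site can be peeled
off by comparing leading coefficients. Hence {A,A}, {A,B}, {B,B} determine the bivector
(`bivector_ext`).

Jacobi identity: the second derivatives cancel, so it says that a tensor, the `jacobiator`,
vanishes. This can be tested on the spanning covectors dA, dB, where the nested brackets follow from
the quadratic relations. The points with s(qₙ) = 0 follow by density.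

Involution: tr K₊T = B, and {B(λ), B(μ)} = 0 means that the coefficients of B commute. The chain is
defined on all of phase space, which gives the entire extension of the integrals in the D case. -/

/-- Skew-symmetry of a bilinear form. -/
def IsSkew (ω : V →ₗ[ℂ] V →ₗ[ℂ] ℂ) : Prop := ∀ u v, ω u v = -ω v u

theorem IsSkew.self {ω : V →ₗ[ℂ] V →ₗ[ℂ] ℂ} (h : IsSkew ω) (v : V) : ω v v = 0 :=
  self_eq_neg.mp (h v v)

theorem IsSkew.swap {ω : V →ₗ[ℂ] V →ₗ[ℂ] ℂ} (h : IsSkew ω) {u v : V} {x : ℂ} (e : ω u v = x) :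
    ω v u = -x := by
  rw [h v u, e]

/-- The relations of the pencil `c₀ {·,·}₀ + c₁ {·,·}₁` with `η = 1`, cleared of denominators, for
functions `A(λ)`, `B(λ)`, `C(λ)` with the differentials `dA(λ)`, `dB(λ)`, `dC(λ)`. Here `r` stands
for the constant polynomial `ρ₁`. -/
structure ReflectionAlgebra (ω : V →ₗ[ℂ] V →ₗ[ℂ] ℂ) (c₀ c₁ r : ℂ) (A B C : ℂ → ℂ)
    (dA dB dC : ℂ → V) : Prop where
  B_neg : ∀ l, B (-l) = -B l
  C_neg : ∀ l, C (-l) = -C l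
  dB_neg : ∀ l, dB (-l) = -dB l
  dC_neg : ∀ l, dC (-l) = -dC l
  BB : ∀ l m, ω (dB l) (dB m) = 0
  -- (R_0) is the case (c₀, c₁) = (1, 0), with ρ₀ = 0, and (R_1) is (0, 1). In the cleared form the
  -- identities also hold for λ = ±μ, so they can be used without case distinctions.
  AA : ∀ l m, (l + m) * ω (dA l) (dA m) =
    (c₀ + c₁ * m ^ 2) * B l * C m - (c₀ + c₁ * l ^ 2) * B m * C l
  CC : ∀ l m, ω (dC l) (dC m) =
    2 * c₁ * r * (A m - A (-m)) * C l - 2 * c₁ * r * (A l - A (-l)) * C m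
  AB : ∀ l m, (l - m) * (l + m) * ω (dA l) (dB m) =
    (l + m) * ((c₀ + c₁ * l ^ 2) * A l * B m - (c₀ + c₁ * m ^ 2) * A m * B l)
      + (l - m) * ((c₀ + c₁ * l ^ 2) * A l * B m + (c₀ + c₁ * m ^ 2) * A (-m) * B l)
      - (l - m) * (l + m) * (2 * c₁ * r * B l * B m)
  AC : ∀ l m, (l - m) * (l + m) * ω (dA l) (dC m) =
    -(l + m) * ((c₀ + c₁ * m ^ 2) * A l * C m - (c₀ + c₁ * l ^ 2) * A m * C l)
      - (l - m) * (l + m) * (2 * c₁ * l * A l * C m)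
      - (l - m) * ((c₀ + c₁ * m ^ 2) * A l * C m + (c₀ + c₁ * l ^ 2) * A (-m) * C l)
      + (l - m) * (l + m) * (2 * c₁ * r * B l * C m)
  BC : ∀ l m, (l - m) * (l + m) * ω (dB l) (dC m) =
    (l + m) * (c₀ + c₁ * l ^ 2) * (A (-l) * A m - A l * A (-m))
      + (l - m) * (c₀ + c₁ * l ^ 2) * (A l * A m - A (-l) * A (-m))
      + (l - m) * (l + m) * (2 * c₁ * r * (A (-m) - A m) * B l)

namespace ReflectionAlgebra

variable {ω : V →ₗ[ℂ] V →ₗ[ℂ] ℂ} {c₀ c₁ r : ℂ} {A B C b c : ℂ → ℂ} {dA dB dC db dc : ℂ → V}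

theorem BA (H : ReflectionAlgebra ω c₀ c₁ r A B C dA dB dC) (hs : IsSkew ω) (l m : ℂ) :
    (l - m) * (l + m) * ω (dB l) (dA m) =
      (l + m) * ((c₀ + c₁ * m ^ 2) * A m * B l - (c₀ + c₁ * l ^ 2) * A l * B m)
        - (l - m) * ((c₀ + c₁ * m ^ 2) * A m * B l + (c₀ + c₁ * l ^ 2) * A (-l) * B m)
        + (l - m) * (l + m) * (2 * c₁ * r * B l * B m) := by
  rw [hs]
  linear_combination H.AB m l

theorem CA (H : ReflectionAlgebra ω c₀ c₁ r A B C dA dB dC) (hs : IsSkew ω) (l m : ℂ) :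
    (l - m) * (l + m) * ω (dC l) (dA m) =
      -(l + m) * ((c₀ + c₁ * l ^ 2) * A m * C l - (c₀ + c₁ * m ^ 2) * A l * C m)
        + (l - m) * (l + m) * (2 * c₁ * m * A m * C l)
        + (l - m) * ((c₀ + c₁ * l ^ 2) * A m * C l + (c₀ + c₁ * m ^ 2) * A (-l) * C m)
        - (l - m) * (l + m) * (2 * c₁ * r * B m * C l) := by
  rw [hs]
  linear_combination H.AC m l

theorem CB (H : ReflectionAlgebra ω c₀ c₁ r A B C dA dB dC) (hs : IsSkew ω) (l m : ℂ) :
    (l - m) * (l + m) * ω (dC l) (dB m) =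
      (l + m) * (c₀ + c₁ * m ^ 2) * (A (-m) * A l - A m * A (-l))
        - (l - m) * (c₀ + c₁ * m ^ 2) * (A m * A l - A (-m) * A (-l))
        - (l - m) * (l + m) * (2 * c₁ * r * (A (-l) - A l) * B m) := by
  rw [hs]
  linear_combination H.BC m l

/-- Conjugation of `T(λ)` by a constant diagonal matrix. -/
theorem rescale (H : ReflectionAlgebra ω c₀ c₁ r A B C dA dB dC) {x y : ℂ} (hxy : x * y = 1) :
    -- Scaling B by x divides the quotient of A by B by x, that is, multiplies it by y.
    ReflectionAlgebra ω c₀ c₁ (y * r) A (fun l => x * B l) (fun l => y * C l)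
      dA (fun l => x • dB l) (fun l => y • dC l) where
  B_neg l := by simp only [H.B_neg]; ring
  C_neg l := by simp only [H.C_neg]; ring
  dB_neg l := by simp only [H.dB_neg, smul_neg]
  dC_neg l := by simp only [H.dC_neg, smul_neg]
  BB l m := by simp [H.BB]
  AA l m := by
    linear_combination H.AA l m +
      ((c₀ + c₁ * m ^ 2) * B l * C m - (c₀ + c₁ * l ^ 2) * B m * C l) * -hxy
  CC l m := by
    simp only [map_smul, LinearMap.smul_apply, smul_eq_mul]
    linear_combination y ^ 2 * H.CC l m
  AB l m := by
    simp only [map_smul, smul_eq_mul]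
    linear_combination x * H.AB l m +
      (l - m) * (l + m) * (2 * c₁ * r * B l * B m) * x * hxy
  AC l m := by
    simp only [map_smul, smul_eq_mul]
    linear_combination y * H.AC l m -
      (l - m) * (l + m) * (2 * c₁ * r * B l * C m) * y * hxy
  BC l m := by
    simp only [map_smul, LinearMap.smul_apply, smul_eq_mul]
    linear_combination (x * y) * H.BC l m +
      ((l + m) * (c₀ + c₁ * l ^ 2) * (A (-l) * A m - A l * A (-m))
      + (l - m) * (c₀ + c₁ * l ^ 2) * (A l * A m - A (-l) * A (-m))) * hxy

/-- Adding a site with covectors `eq = dq`, `ep = dp` of its coordinates: the entries of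
`L(λ) T(λ) L(-λ)⁻¹`, normalized by `e^q`. -/
theorem dress (H : ReflectionAlgebra ω c₀ c₁ r A b c dA db dc) (hs : IsSkew ω) {p : ℂ}
    {eq ep : V} (hqp : ω eq ep = c₀ + c₁ * (p ^ 2 + 2 * r))
    -- In the application b, c, r are e^(-q)B, e^q C, e^q ρ₁ of the tail. The six right-hand sides
    -- are then what `SiteRelations` gives for the fields by which q and p act on the tail.
    (hqA : ∀ l, ω eq (dA l) = c₁ * (-2 * l * A l + 2 * r * b l + c l))
    (hqB : ∀ l, ω eq (db l) = c₁ * (A (-l) - A l))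
    (hqC : ∀ l, ω eq (dc l) = c₁ * (2 * r * (A (-l) - A l)))
    (hpA : ∀ l, ω ep (dA l) = c₁ * ((p + l) * c l))
    (hpB : ∀ l, ω ep (db l) = c₁ * (p * (A (-l) - A l) - 2 * r * b l + l * (A l + A (-l))))
    (hpC : ∀ l, ω ep (dc l) = c₁ * (2 * r * c l)) :
    ReflectionAlgebra ω c₀ c₁ 1 (fun l => A (-l) - (l - p) * b l)
      (fun l => (l - p) * A l + (l + p) * A (-l) - c l - (l ^ 2 - p ^ 2) * b l)
      (fun l => -b l)
      (fun l => dA (-l) - (l - p) • db l + b l • ep + ((l - p) * b l) • eq)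
      (fun l => (l - p) • dA l + (l + p) • dA (-l) - dc l - (l ^ 2 - p ^ 2) • db l
        + (-A l + A (-l) + 2 * p * b l) • ep
        + ((l - p) * A l + (l + p) * A (-l) - 2 * c l) • eq)
      (fun l => -db l + (2 * b l) • eq) := by
  have hB : ∀ l, (fun l => (l - p) * A l + (l + p) * A (-l) - c l - (l ^ 2 - p ^ 2) * b l) (-l) =
      -((l - p) * A l + (l + p) * A (-l) - c l - (l ^ 2 - p ^ 2) * b l) := fun l => by
    simp only [H.B_neg, H.C_neg, neg_neg]; ring
  have hdB : ∀ l, (fun l => (l - p) • dA l + (l + p) • dA (-l) - dc l - (l ^ 2 - p ^ 2) • db l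
        + (-A l + A (-l) + 2 * p * b l) • ep
        + ((l - p) * A l + (l + p) * A (-l) - 2 * c l) • eq) (-l) =
      -((l - p) • dA l + (l + p) • dA (-l) - dc l - (l ^ 2 - p ^ 2) • db l
        + (-A l + A (-l) + 2 * p * b l) • ep
        + ((l - p) * A l + (l + p) * A (-l) - 2 * c l) • eq) := fun l => by
    simp only [H.B_neg, H.C_neg, H.dB_neg, H.dC_neg, neg_neg]; module
  refine ⟨hB, fun l => ?_, hdB, fun l => ?_, fun l m => ?_, fun l m => ?_, fun l m => ?_,
    fun l m => ?_, fun l m => ?_, fun l m => ?_⟩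
  · simp only [H.B_neg]
  · simp only [H.B_neg, H.dB_neg]; module
  -- The expansion below computes the pairing only up to the factor (l - m)(l + m). Where that
  -- factor vanishes, oddness of B and skew-symmetry suffice.
  · by_cases h1 : l = m
    · subst h1; exact hs.self _
    by_cases h2 : l = -m
    · subst h2
      have h := hdB m
      beta_reduce at h
      rw [h, map_neg, LinearMap.neg_apply, hs.self, neg_zero]
    refine (mul_eq_zero.mp ?_).resolve_left
      (mul_ne_zero (sub_ne_zero.mpr h1) (fun h => h2 (eq_neg_of_add_eq_zero_left h)))
    simp only [map_add, map_sub, map_smul, LinearMap.add_apply, LinearMap.sub_apply,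
        LinearMap.smul_apply, smul_eq_mul]
    -- One line for each pair of terms of the two new differentials: the product of their
    -- coefficients times the relation for that pair. Afterwards the values of b and c at -l, -m are
    -- removed by oddness.
    linear_combination (norm := skip)
        (l-p)*(m-p)*(l-m) * (H.AA l m)
        + (l-p)*(m+p)*(l+m) * (H.AA l (-m))
        + (l-p)*(-1) * (H.AC l m)
        + (l-p)*(-(m^2-p^2)) * (H.AB l m)
        + (l-p)*(-A m+A (-m)+2*p*b m)*((l-m)*(l+m)) * (hs.swap (hpA l))
        + (l-p)*((m-p)*A m+(m+p)*A (-m)-2*c m)*((l-m)*(l+m)) * (hs.swap (hqA l))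
        + (l+p)*(m-p)*(-(l+m)) * (H.AA (-l) m)
        + (l+p)*(m+p)*(-(l-m)) * (H.AA (-l) (-m))
        + (l+p)*(-1) * (H.AC (-l) m)
        + (l+p)*(-(m^2-p^2)) * (H.AB (-l) m)
        + (l+p)*(-A m+A (-m)+2*p*b m)*((l-m)*(l+m)) * (hs.swap (hpA (-l)))
        + (l+p)*((m-p)*A m+(m+p)*A (-m)-2*c m)*((l-m)*(l+m)) * (hs.swap (hqA (-l)))
        + (-1)*(m-p) * (H.CA hs l m)
        + (-1)*(m+p) * (H.CA hs l (-m))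
        + (-1)*(-1)*((l-m)*(l+m)) * (H.CC l m)
        + (-1)*(-(m^2-p^2)) * (H.CB hs l m)
        + (-1)*(-A m+A (-m)+2*p*b m)*((l-m)*(l+m)) * (hs.swap (hpC l))
        + (-1)*((m-p)*A m+(m+p)*A (-m)-2*c m)*((l-m)*(l+m)) * (hs.swap (hqC l))
        + (-(l^2-p^2))*(m-p) * (H.BA hs l m)
        + (-(l^2-p^2))*(m+p) * (H.BA hs l (-m))
        + (-(l^2-p^2))*(-1) * (H.BC l m)
        + (-(l^2-p^2))*(-(m^2-p^2))*((l-m)*(l+m)) * (H.BB l m)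
        + (-(l^2-p^2))*(-A m+A (-m)+2*p*b m)*((l-m)*(l+m)) * (hs.swap (hpB l))
        + (-(l^2-p^2))*((m-p)*A m+(m+p)*A (-m)-2*c m)*((l-m)*(l+m)) * (hs.swap (hqB l))
        + (-A l+A (-l)+2*p*b l)*(m-p)*((l-m)*(l+m)) * (hpA m)
        + (-A l+A (-l)+2*p*b l)*(m+p)*((l-m)*(l+m)) * (hpA (-m))
        + (-A l+A (-l)+2*p*b l)*(-1)*((l-m)*(l+m)) * (hpC m)
        + (-A l+A (-l)+2*p*b l)*(-(m^2-p^2))*((l-m)*(l+m)) * (hpB m)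
        + (-A l+A (-l)+2*p*b l)*(-A m+A (-m)+2*p*b m)*((l-m)*(l+m)) * (hs.self ep)
        + (-A l+A (-l)+2*p*b l)*((m-p)*A m+(m+p)*A (-m)-2*c m)*((l-m)*(l+m)) * (hs.swap hqp)
        + ((l-p)*A l+(l+p)*A (-l)-2*c l)*(m-p)*((l-m)*(l+m)) * (hqA m)
        + ((l-p)*A l+(l+p)*A (-l)-2*c l)*(m+p)*((l-m)*(l+m)) * (hqA (-m))
        + ((l-p)*A l+(l+p)*A (-l)-2*c l)*(-1)*((l-m)*(l+m)) * (hqC m)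
        + ((l-p)*A l+(l+p)*A (-l)-2*c l)*(-(m^2-p^2))*((l-m)*(l+m)) * (hqB m)
        + ((l-p)*A l+(l+p)*A (-l)-2*c l)*(-A m+A (-m)+2*p*b m)*((l-m)*(l+m)) * (hqp)
        + ((l-p)*A l+(l+p)*A (-l)-2*c l)*((m-p)*A m+(m+p)*A (-m)-2*c m)*((l-m)*(l+m)) * (hs.self eq)
    simp only [H.B_neg, H.C_neg]; ring
  -- The claim already carries the factor l + m, so only l = m is degenerate.
  · by_cases h1 : l = m
    · subst h1; rw [hs.self]; ring
    refine mul_left_cancel₀ (sub_ne_zero.mpr h1) ?_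
    simp only [map_add, map_sub, map_smul, LinearMap.add_apply, LinearMap.sub_apply,
        LinearMap.smul_apply, smul_eq_mul]
    linear_combination (norm := skip)
        (-(l-m)) * (H.AA (-l) (-m))
        + (-(m-p)) * (H.AB (-l) m)
        + b m*((l-m)*(l+m)) * (hs.swap (hpA (-l)))
        + ((m-p)*b m)*((l-m)*(l+m)) * (hs.swap (hqA (-l)))
        + (-(l-p)) * (H.BA hs l (-m))
        + (-(l-p))*(-(m-p))*((l-m)*(l+m)) * (H.BB l m)
        + (-(l-p))*b m*((l-m)*(l+m)) * (hs.swap (hpB l))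
        + (-(l-p))*((m-p)*b m)*((l-m)*(l+m)) * (hs.swap (hqB l))
        + b l*((l-m)*(l+m)) * (hpA (-m))
        + b l*(-(m-p))*((l-m)*(l+m)) * (hpB m)
        + b l*b m*((l-m)*(l+m)) * (hs.self ep)
        + b l*((m-p)*b m)*((l-m)*(l+m)) * (hs.swap hqp)
        + ((l-p)*b l)*((l-m)*(l+m)) * (hqA (-m))
        + ((l-p)*b l)*(-(m-p))*((l-m)*(l+m)) * (hqB m)
        + ((l-p)*b l)*b m*((l-m)*(l+m)) * (hqp)
        + ((l-p)*b l)*((m-p)*b m)*((l-m)*(l+m)) * (hs.self eq)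
    simp only [H.B_neg, H.C_neg]; ring
  -- The new C contains only b and q, so {b, b} = 0 and {q, b} decide the matter and no denominators
  -- occur.
  · simp only [map_add, map_neg, map_smul, LinearMap.add_apply,
        LinearMap.neg_apply, LinearMap.smul_apply, smul_eq_mul]
    linear_combination (norm := skip)
        (-1)*(-1) * (H.BB l m)
        + (-1)*(2*b m) * (hs.swap (hqB l))
        + (2*b l)*(-1) * (hqB m)
        + (2*b l)*(2*b m) * (hs.self eq)
    simp only [H.B_neg, neg_neg]; ring
  · simp only [map_add, map_sub, map_smul, LinearMap.add_apply, LinearMap.sub_apply,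
        LinearMap.smul_apply, smul_eq_mul]
    linear_combination (norm := skip)
        (m-p)*(-(l+m)) * (H.AA (-l) m)
        + (m+p)*(-(l-m)) * (H.AA (-l) (-m))
        + (-1) * (H.AC (-l) m)
        + (-(m^2-p^2)) * (H.AB (-l) m)
        + (-A m+A (-m)+2*p*b m)*((l-m)*(l+m)) * (hs.swap (hpA (-l)))
        + ((m-p)*A m+(m+p)*A (-m)-2*c m)*((l-m)*(l+m)) * (hs.swap (hqA (-l)))
        + (-(l-p))*(m-p) * (H.BA hs l m)
        + (-(l-p))*(m+p) * (H.BA hs l (-m))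
        + (-(l-p))*(-1) * (H.BC l m)
        + (-(l-p))*(-(m^2-p^2))*((l-m)*(l+m)) * (H.BB l m)
        + (-(l-p))*(-A m+A (-m)+2*p*b m)*((l-m)*(l+m)) * (hs.swap (hpB l))
        + (-(l-p))*((m-p)*A m+(m+p)*A (-m)-2*c m)*((l-m)*(l+m)) * (hs.swap (hqB l))
        + b l*(m-p)*((l-m)*(l+m)) * (hpA m)
        + b l*(m+p)*((l-m)*(l+m)) * (hpA (-m))
        + b l*(-1)*((l-m)*(l+m)) * (hpC m)
        + b l*(-(m^2-p^2))*((l-m)*(l+m)) * (hpB m)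
        + b l*(-A m+A (-m)+2*p*b m)*((l-m)*(l+m)) * (hs.self ep)
        + b l*((m-p)*A m+(m+p)*A (-m)-2*c m)*((l-m)*(l+m)) * (hs.swap hqp)
        + ((l-p)*b l)*(m-p)*((l-m)*(l+m)) * (hqA m)
        + ((l-p)*b l)*(m+p)*((l-m)*(l+m)) * (hqA (-m))
        + ((l-p)*b l)*(-1)*((l-m)*(l+m)) * (hqC m)
        + ((l-p)*b l)*(-(m^2-p^2))*((l-m)*(l+m)) * (hqB m)
        + ((l-p)*b l)*(-A m+A (-m)+2*p*b m)*((l-m)*(l+m)) * (hqp)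
        + ((l-p)*b l)*((m-p)*A m+(m+p)*A (-m)-2*c m)*((l-m)*(l+m)) * (hs.self eq)
    simp only [H.B_neg, H.C_neg, neg_neg]; ring
  · simp only [map_add, map_sub, map_neg, map_smul, LinearMap.add_apply, LinearMap.sub_apply,
        LinearMap.smul_apply, smul_eq_mul]
    linear_combination (norm := skip)
        (-1) * (H.AB (-l) m)
        + (2*b m)*((l-m)*(l+m)) * (hs.swap (hqA (-l)))
        + (-(l-p))*(-1)*((l-m)*(l+m)) * (H.BB l m)
        + (-(l-p))*(2*b m)*((l-m)*(l+m)) * (hs.swap (hqB l))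
        + b l*(-1)*((l-m)*(l+m)) * (hpB m)
        + b l*(2*b m)*((l-m)*(l+m)) * (hs.swap hqp)
        + ((l-p)*b l)*(-1)*((l-m)*(l+m)) * (hqB m)
        + ((l-p)*b l)*(2*b m)*((l-m)*(l+m)) * (hs.self eq)
    simp only [H.B_neg, H.C_neg, neg_neg]; ring
  · simp only [map_add, map_sub, map_neg, map_smul, LinearMap.add_apply, LinearMap.sub_apply,
        LinearMap.smul_apply, smul_eq_mul]
    linear_combination (norm := skip)
        (l-p)*(-1) * (H.AB l m)
        + (l-p)*(2*b m)*((l-m)*(l+m)) * (hs.swap (hqA l))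
        + (l+p)*(-1) * (H.AB (-l) m)
        + (l+p)*(2*b m)*((l-m)*(l+m)) * (hs.swap (hqA (-l)))
        + (-1)*(-1) * (H.CB hs l m)
        + (-1)*(2*b m)*((l-m)*(l+m)) * (hs.swap (hqC l))
        + (-(l^2-p^2))*(-1)*((l-m)*(l+m)) * (H.BB l m)
        + (-(l^2-p^2))*(2*b m)*((l-m)*(l+m)) * (hs.swap (hqB l))
        + (-A l+A (-l)+2*p*b l)*(-1)*((l-m)*(l+m)) * (hpB m)
        + (-A l+A (-l)+2*p*b l)*(2*b m)*((l-m)*(l+m)) * (hs.swap hqp)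
        + ((l-p)*A l+(l+p)*A (-l)-2*c l)*(-1)*((l-m)*(l+m)) * (hqB m)
        + ((l-p)*A l+(l+p)*A (-l)-2*c l)*(2*b m)*((l-m)*(l+m)) * (hs.self eq)
    simp only [H.B_neg, H.C_neg, neg_neg]; ring

/-! ### Jacobi identities that follow from the quadratic relations. -/

/-- The differential of `(λ + μ) {A(λ), A(μ)}`. -/
def diffAA (c₀ c₁ : ℂ) (B C : ℂ → ℂ) (dB dC : ℂ → V) (l m : ℂ) : V :=
  (c₀ + c₁ * m ^ 2) • (B l • dC m + C m • dB l) - (c₀ + c₁ * l ^ 2) • (B m • dC l + C l • dB m)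

/-- The differential of `(λ² - μ²) {A(λ), B(μ)}`. -/
def diffAB (c₀ c₁ r : ℂ) (A B : ℂ → ℂ) (dA dB : ℂ → V) (dr : V) (l m : ℂ) : V :=
  (l + m) • ((c₀ + c₁ * l ^ 2) • (A l • dB m + B m • dA l)
      - (c₀ + c₁ * m ^ 2) • (A m • dB l + B l • dA m))
    + (l - m) • ((c₀ + c₁ * l ^ 2) • (A l • dB m + B m • dA l)
      + (c₀ + c₁ * m ^ 2) • (A (-m) • dB l + B l • dA (-m)))
    - ((l - m) * (l + m)) • ((2 * c₁ * r) • (B l • dB m + B m • dB l)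
      + (2 * c₁ * B l * B m) • dr)

/-- The Jacobi identity for `A(λ)`, `A(μ)`, `A(ν)`. -/
theorem jacobi_AAA (H : ReflectionAlgebra ω c₀ c₁ r A B C dA dB dC) {l m n : ℂ}
    {X Y Z : V} (hlm : (l - m) * (l + m) ≠ 0) (hmn : (m - n) * (m + n) ≠ 0)
    (hln : (l - n) * (l + n) ≠ 0)
    (hX : (m + n) • X = diffAA c₀ c₁ B C dB dC m n)
    (hY : (n + l) • Y = diffAA c₀ c₁ B C dB dC n l)
    (hZ : (l + m) • Z = diffAA c₀ c₁ B C dB dC l m) :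
    ω (dA l) X + ω (dA m) Y + ω (dA n) Z = 0 := by
  have hX := congrArg (ω (dA l)) hX
  have hY := congrArg (ω (dA m)) hY
  have hZ := congrArg (ω (dA n)) hZ
  simp only [diffAA, map_add, map_sub, map_smul, smul_eq_mul] at hX hY hZ
  have hD : (l - m) * (l + m) * (m - n) * (m + n) * (l - n) * (l + n) ≠ 0 := by
    rw [mul_assoc, mul_assoc, mul_assoc]
    simpa only [mul_assoc] using mul_ne_zero (mul_ne_zero hlm hmn) hln
  refine (mul_eq_zero.mp ?_).resolve_left hD
  -- `hX`, `hY`, `hZ` replace the inner brackets by the differentials of their right-hand sides. The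
  -- other terms evaluate the outer brackets, each weighted by the factors of `hD` that its own
  -- relation lacks.
  linear_combination
    ((l - m) * (l + m) * (m - n) * (l - n) * (l + n)) * hX
      + ((l - m) * (l + m) * (m - n)) * ((c₀ + c₁ * n ^ 2) * B m) * (H.AC l n)
      + ((m - n) * (l - n) * (l + n)) * ((c₀ + c₁ * n ^ 2) * C n) * (H.AB l m)
      + ((m - n) * (l - n) * (l + n)) * ((-(c₀ + c₁ * m ^ 2)) * B n) * (H.AC l m)
      + ((l - m) * (l + m) * (m - n)) * ((-(c₀ + c₁ * m ^ 2)) * C m) * (H.AB l n)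
      + ((l - m) * (l + m) * (m - n) * (m + n) * (l - n)) * hY
      + (-((m - n) * (m + n) * (l - n))) * ((c₀ + c₁ * l ^ 2) * B n) * (H.AC m l)
      + ((l - m) * (l + m) * (l - n)) * ((c₀ + c₁ * l ^ 2) * C l) * (H.AB m n)
      + ((l - m) * (l + m) * (l - n)) * ((-(c₀ + c₁ * n ^ 2)) * B l) * (H.AC m n)
      + (-((m - n) * (m + n) * (l - n))) * ((-(c₀ + c₁ * n ^ 2)) * C n) * (H.AB m l)
      + ((l - m) * (m - n) * (m + n) * (l - n) * (l + n)) * hZ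
      + (-((l - m) * (l - n) * (l + n))) * ((c₀ + c₁ * m ^ 2) * B l) * (H.AC n m)
      + (-((l - m) * (m - n) * (m + n))) * ((c₀ + c₁ * m ^ 2) * C m) * (H.AB n l)
      + (-((l - m) * (m - n) * (m + n))) * ((-(c₀ + c₁ * l ^ 2)) * B m) * (H.AC n l)
      + (-((l - m) * (l - n) * (l + n))) * ((-(c₀ + c₁ * l ^ 2)) * C l) * (H.AB n m)

/-- The Jacobi identity for `A(λ)`, `A(μ)`, `B(ν)`. -/
theorem jacobi_AAB (H : ReflectionAlgebra ω c₀ c₁ r A B C dA dB dC)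
    {dr : V} {τ : ℂ}
    -- ρ₁ occurs in {A, B}, so its bracket with A enters. The value of τ is immaterial: it appears
    -- with the product of three values of B, which cancels between the two nested brackets.
    (hrA : ∀ l, ω (dA l) dr = -(c₀ * C l + c₁ * (l ^ 2 * C l - τ * B l)))
    {l m n : ℂ} {X Y Z : V} (hlm : (l - m) * (l + m) ≠ 0) (hmn : (m - n) * (m + n) ≠ 0)
    (hln : (l - n) * (l + n) ≠ 0)
    (hX : ((m - n) * (m + n)) • X = diffAB c₀ c₁ r A B dA dB dr m n)
    (hY : ((l - n) * (l + n)) • Y = diffAB c₀ c₁ r A B dA dB dr l n)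
    (hZ : (l + m) • Z = diffAA c₀ c₁ B C dB dC l m) :
    ω (dA l) X - ω (dA m) Y + ω (dB n) Z = 0 := by
  have hX := congrArg (ω (dA l)) hX
  have hY := congrArg (ω (dA m)) hY
  have hZ := congrArg (ω (dB n)) hZ
  simp only [diffAA, diffAB, map_add, map_sub, map_smul, smul_eq_mul] at hX hY hZ
  have hD : (l - m) * (l + m) * (m - n) * (m + n) * (l - n) * (l + n) ≠ 0 := by
    rw [mul_assoc, mul_assoc, mul_assoc]
    simpa only [mul_assoc] using mul_ne_zero (mul_ne_zero hlm hmn) hln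
  refine (mul_eq_zero.mp ?_).resolve_left hD
  linear_combination (norm := skip)
    ((l - m) * (l + m) * (l - n) * (l + n)) * hX
      + ((l - m) * (l + m)) * (((m + n) + (m - n)) * (c₀ + c₁ * m ^ 2) * A m) * (H.AB l n)
      + ((l - m) * (l - n) * (l + n)) * (((m + n) + (m - n)) * (c₀ + c₁ * m ^ 2) * B n) * (H.AA l m)
      + ((l - n) * (l + n)) * ((-(m + n)) * (c₀ + c₁ * n ^ 2) * A n) * (H.AB l m)
      + ((l - m) * (l + m) * (l - n)) * ((-(m + n)) * (c₀ + c₁ * n ^ 2) * B m) * (H.AA l n)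
      + ((l - n) * (l + n)) * ((m - n) * (c₀ + c₁ * n ^ 2) * A (-n)) * (H.AB l m)
      + ((l - m) * (l + m) * (l + n)) * ((m - n) * (c₀ + c₁ * n ^ 2) * B m) * (H.AA l (-n))
      + ((l - m) * (l + m)) * ((-(m - n)) * (m + n) * (2 * c₁ * r * B m)) * (H.AB l n)
      + ((l - n) * (l + n)) * ((-(m - n)) * (m + n) * (2 * c₁ * r * B n)) * (H.AB l m)
      + ((l - m) * (l + m) * (l - n) * (l + n)) * ((-(m - n)) * (m + n) * (2 * c₁ * B m * B n)) * (hrA l)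
      + -((l - m) * (l + m) * (m - n) * (m + n)) * hY
      + -((l - m) * (l + m)) * (((l + n) + (l - n)) * (c₀ + c₁ * l ^ 2) * A l) * (H.AB m n)
      + -((l - m) * (m - n) * (m + n)) * (((l + n) + (l - n)) * (c₀ + c₁ * l ^ 2) * B n) * (H.AA m l)
      + -(-((m - n) * (m + n))) * ((-(l + n)) * (c₀ + c₁ * n ^ 2) * A n) * (H.AB m l)
      + -((l - m) * (l + m) * (m - n)) * ((-(l + n)) * (c₀ + c₁ * n ^ 2) * B l) * (H.AA m n)
      + -(-((m - n) * (m + n))) * ((l - n) * (c₀ + c₁ * n ^ 2) * A (-n)) * (H.AB m l)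
      + -((l - m) * (l + m) * (m + n)) * ((l - n) * (c₀ + c₁ * n ^ 2) * B l) * (H.AA m (-n))
      + -((l - m) * (l + m)) * ((-(l - n)) * (l + n) * (2 * c₁ * r * B l)) * (H.AB m n)
      + -(-((m - n) * (m + n))) * ((-(l - n)) * (l + n) * (2 * c₁ * r * B n)) * (H.AB m l)
      + -((l - m) * (l + m) * (m - n) * (m + n)) * ((-(l - n)) * (l + n) * (2 * c₁ * B l * B n)) * (hrA m)
      + ((l - m) * (m - n) * (m + n) * (l - n) * (l + n)) * hZ
      + (-((l - m) * (l - n) * (l + n))) * ((c₀ + c₁ * m ^ 2) * B l) * (H.BC n m)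
      + ((l - m) * (m - n) * (m + n) * (l - n) * (l + n)) * ((c₀ + c₁ * m ^ 2) * C m) * (H.BB n l)
      + (-((l - m) * (m - n) * (m + n))) * ((-(c₀ + c₁ * l ^ 2)) * B m) * (H.BC n l)
      + ((l - m) * (m - n) * (m + n) * (l - n) * (l + n)) * ((-(c₀ + c₁ * l ^ 2)) * C l) * (H.BB n m)
  simp only [H.B_neg, H.C_neg, neg_neg]
  ring

/-- The Jacobi identity for `A(λ)`, `B(μ)`, `B(ν)`. -/
theorem jacobi_ABB (H : ReflectionAlgebra ω c₀ c₁ r A B C dA dB dC) (hs : IsSkew ω)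
    {dr : V} {σ : ℂ}
    -- As with τ above, σ only multiplies a product of three values of B, symmetric in the
    -- parameters, and cancels.
    (hrB : ∀ l, ω (dB l) dr =
      -(c₀ * (A (-l) - A l) + c₁ * (-2 * σ * B l - l ^ 2 * (A l - A (-l)))))
    {l m n : ℂ} {Y Z : V} (hlm : (l - m) * (l + m) ≠ 0) (hmn : (m - n) * (m + n) ≠ 0)
    (hln : (l - n) * (l + n) ≠ 0)
    (hY : ((l - n) * (l + n)) • Y = diffAB c₀ c₁ r A B dA dB dr l n)
    (hZ : ((l - m) * (l + m)) • Z = diffAB c₀ c₁ r A B dA dB dr l m) :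
    -ω (dB m) Y + ω (dB n) Z = 0 := by
  have hY := congrArg (ω (dB m)) hY
  have hZ := congrArg (ω (dB n)) hZ
  simp only [diffAB, map_add, map_sub, map_smul, smul_eq_mul] at hY hZ
  have hD : (l - m) * (l + m) * (m - n) * (m + n) * (l - n) * (l + n) ≠ 0 := by
    rw [mul_assoc, mul_assoc, mul_assoc]
    simpa only [mul_assoc] using mul_ne_zero (mul_ne_zero hlm hmn) hln
  refine (mul_eq_zero.mp ?_).resolve_left hD
  linear_combination (norm := skip)
    -((l - m) * (l + m) * (m - n) * (m + n)) * hY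
      + -((l - m) * (l + m) * (m - n) * (m + n)) * (((l + n) + (l - n)) * (c₀ + c₁ * l ^ 2) * A l) * (H.BB m n)
      + -(-((m - n) * (m + n))) * (((l + n) + (l - n)) * (c₀ + c₁ * l ^ 2) * B n) * (H.BA hs m l)
      + -((l - m) * (l + m) * (m - n) * (m + n)) * ((-(l + n)) * (c₀ + c₁ * n ^ 2) * A n) * (H.BB m l)
      + -((l - m) * (l + m)) * ((-(l + n)) * (c₀ + c₁ * n ^ 2) * B l) * (H.BA hs m n)
      + -((l - m) * (l + m) * (m - n) * (m + n)) * ((l - n) * (c₀ + c₁ * n ^ 2) * A (-n)) * (H.BB m l)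
      + -((l - m) * (l + m)) * ((l - n) * (c₀ + c₁ * n ^ 2) * B l) * (H.BA hs m (-n))
      + -((l - m) * (l + m) * (m - n) * (m + n)) * ((-(l - n)) * (l + n) * (2 * c₁ * r * B l)) * (H.BB m n)
      + -((l - m) * (l + m) * (m - n) * (m + n)) * ((-(l - n)) * (l + n) * (2 * c₁ * r * B n)) * (H.BB m l)
      + -((l - m) * (l + m) * (m - n) * (m + n)) * ((-(l - n)) * (l + n) * (2 * c₁ * B l * B n)) * (hrB m)
      + ((m - n) * (m + n) * (l - n) * (l + n)) * hZ
      + ((m - n) * (m + n) * (l - n) * (l + n)) * (((l + m) + (l - m)) * (c₀ + c₁ * l ^ 2) * A l) * (H.BB n m)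
      + (-((m - n) * (m + n))) * (((l + m) + (l - m)) * (c₀ + c₁ * l ^ 2) * B m) * (H.BA hs n l)
      + ((m - n) * (m + n) * (l - n) * (l + n)) * ((-(l + m)) * (c₀ + c₁ * m ^ 2) * A m) * (H.BB n l)
      + (-((l - n) * (l + n))) * ((-(l + m)) * (c₀ + c₁ * m ^ 2) * B l) * (H.BA hs n m)
      + ((m - n) * (m + n) * (l - n) * (l + n)) * ((l - m) * (c₀ + c₁ * m ^ 2) * A (-m)) * (H.BB n l)
      + (-((l - n) * (l + n))) * ((l - m) * (c₀ + c₁ * m ^ 2) * B l) * (H.BA hs n (-m))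
      + ((m - n) * (m + n) * (l - n) * (l + n)) * ((-(l - m)) * (l + m) * (2 * c₁ * r * B l)) * (H.BB n m)
      + ((m - n) * (m + n) * (l - n) * (l + n)) * ((-(l - m)) * (l + m) * (2 * c₁ * r * B m)) * (H.BB n l)
      + ((m - n) * (m + n) * (l - n) * (l + n)) * ((-(l - m)) * (l + m) * (2 * c₁ * B l * B m)) * (hrB n)
  simp only [H.B_neg, neg_neg]
  ring

end ReflectionAlgebra

end Algebra

end TodaReflection

end

open Polynomial

noncomputable section

namespace TodaReflection

/-! ### Second derivatives of holomorphic functions of several variables -/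

section Holomorphic

variable {F : Type*} [NormedAddCommGroup F] [NormedSpace ℂ F]

theorem hasDerivAt_line {f : F → ℂ} (hf : Differentiable ℂ f) (z v : F) (t : ℂ) :
    HasDerivAt (fun t : ℂ => f (z + t • v)) (fderiv ℂ f (z + t • v) v) t := by
  have h : HasDerivAt (fun t : ℂ => z + t • v) v t := by
    simpa using ((hasDerivAt_id t).smul_const v).const_add z
  exact (hf (z + t • v)).hasFDerivAt.comp_hasDerivAt t h

/-- Cauchy's estimate on the complex line through w in the direction v, with f bounded on a slightly
larger compact ball. -/
theorem exists_norm_fderiv_le [ProperSpace F] {f : F → ℂ} (hf : Differentiable ℂ f) (z : F)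
    (R : ℝ) : ∃ K, ∀ w ∈ Metric.closedBall z R, ‖fderiv ℂ f w‖ ≤ K := by
  obtain ⟨K, hK⟩ := (isCompact_closedBall z (R + 1)).exists_bound_of_continuousOn
    hf.continuous.continuousOn
  refine ⟨max K 0, fun w hw => ContinuousLinearMap.opNorm_le_bound _ (le_max_right _ _) fun v => ?_⟩
  rcases eq_or_ne v 0 with rfl | hv
  · simp
  have hv' : 0 < ‖v‖ := norm_pos_iff.mpr hv
  have hd : Differentiable ℂ (fun t : ℂ => f (w + t • v)) := fun t =>
    (hasDerivAt_line hf w v t).differentiableAt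
  -- The radius 1/‖v‖ makes the displacement t v of norm 1, so the circle stays in the ball of
  -- radius R + 1.
  have := Complex.norm_deriv_le_of_forall_mem_sphere_norm_le (c := 0) (C := max K 0)
    (inv_pos.mpr hv') hd.diffContOnCl (fun t ht => ?_)
  · rw [(hasDerivAt_line hf w v 0).deriv] at this
    simpa [div_inv_eq_mul] using this
  · refine (hK _ ?_).trans (le_max_left _ _)
    have ht' : ‖t‖ = ‖v‖⁻¹ := by simpa using ht
    rw [Metric.mem_closedBall, dist_eq_norm] at hw ⊢
    calc ‖w + t • v - z‖ = ‖(w - z) + t • v‖ := by congr 1; abel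
      _ ≤ ‖w - z‖ + ‖t • v‖ := norm_add_le _ _
      _ ≤ R + 1 := by
        rw [norm_smul, ht', inv_mul_cancel₀ hv'.ne']
        linarith

/-- Cauchy's formula for the derivative of t ↦ f(z + t v) at t = 0 over the unit circle. It
expresses the derivative of f by values of f, which can be differentiated in z. -/
theorem fderiv_apply_eq_circleIntegral {f : F → ℂ} (hf : Differentiable ℂ f) (z v : F) :
    fderiv ℂ f z v = (2 * Real.pi * Complex.I)⁻¹ *
      ∫ θ in (0 : ℝ)..2 * Real.pi,
        (circleMap 0 1 θ * Complex.I * (1 / circleMap 0 1 θ ^ 2)) *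
          f (z + circleMap 0 1 θ • v) := by
  have hd : Differentiable ℂ (fun t : ℂ => f (z + t • v)) := fun t =>
    (hasDerivAt_line hf z v t).differentiableAt
  have h := DifferentiableOn.deriv_eq_smul_circleIntegral (c := 0) (R := 1) one_pos
    hd.differentiableOn
  rw [(hasDerivAt_line hf z v 0).deriv] at h
  simp only [circleIntegral, smul_eq_mul, zero_smul, add_zero, sub_zero, deriv_circleMap] at h
  rw [eq_inv_mul_iff_mul_eq₀ (by simp [Real.pi_ne_zero])]
  rw [← h]
  refine intervalIntegral.integral_congr fun θ _ => ?_
  ring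

/-- Differentiation under the integral sign in Cauchy's formula, dominated by the local bound on the
derivative of f. -/
theorem differentiable_fderiv_apply [FiniteDimensional ℂ F] {f : F → ℂ} (hf : Differentiable ℂ f)
    (v : F) : Differentiable ℂ (fun z => fderiv ℂ f z v) := by
  have : ProperSpace F := FiniteDimensional.proper ℂ F
  let _ : MeasurableSpace F := borel F
  have : BorelSpace F := ⟨rfl⟩
  intro z
  simp only [fderiv_apply_eq_circleIntegral hf _ v]
  refine DifferentiableAt.const_mul ?_ _
  -- This radius covers w + t v for w in the unit ball around z and |t| = 1.
  obtain ⟨K, hK⟩ := exists_norm_fderiv_le hf z (1 + ‖v‖)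
  have hc : Continuous fun θ : ℝ => circleMap 0 1 θ * Complex.I * (1 / circleMap 0 1 θ ^ 2) := by
    have : ∀ θ : ℝ, circleMap 0 1 θ ^ 2 ≠ 0 := fun θ =>
      pow_ne_zero 2 (circleMap_ne_center one_ne_zero)
    fun_prop (disch := exact this _)
  have hp : ∀ w : F, Continuous fun θ : ℝ => w + circleMap 0 1 θ • v := fun w => by fun_prop
  have hn : ∀ θ : ℝ, ‖circleMap 0 1 θ * Complex.I * (1 / circleMap 0 1 θ ^ 2)‖ = 1 := fun θ => by
    simp
  have key := intervalIntegral.hasFDerivAt_integral_of_dominated_of_fderiv_le (𝕜 := ℂ)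
    (μ := MeasureTheory.volume) (a := 0) (b := 2 * Real.pi)
    (F := fun w θ => (circleMap 0 1 θ * Complex.I * (1 / circleMap 0 1 θ ^ 2)) *
          f (w + circleMap 0 1 θ • v))
    (F' := fun w θ => (circleMap 0 1 θ * Complex.I * (1 / circleMap 0 1 θ ^ 2)) •
          fderiv ℂ f (w + circleMap 0 1 θ • v))
    (x₀ := z) (bound := fun _ => K) (Metric.ball_mem_nhds z one_pos)
    (Filter.Eventually.of_forall fun w =>
      (hc.mul (hf.continuous.comp (hp w))).aestronglyMeasurable)
    ((hc.mul (hf.continuous.comp (hp z))).intervalIntegrable _ _)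
    ((hc.measurable.smul
      ((measurable_fderiv ℂ f).comp (hp z).measurable)).aestronglyMeasurable)
    (Filter.Eventually.of_forall fun θ _ w hw => ?_)
    intervalIntegrable_const
    (Filter.Eventually.of_forall fun θ _ w _ => ?_)
  · exact key.differentiableAt
  · rw [norm_smul, hn, one_mul]
    refine hK _ ?_
    rw [Metric.mem_ball, dist_eq_norm] at hw
    rw [Metric.mem_closedBall, dist_eq_norm]
    calc ‖w + circleMap 0 1 θ • v - z‖ = ‖(w - z) + circleMap 0 1 θ • v‖ := by congr 1; abel
      _ ≤ ‖w - z‖ + ‖circleMap 0 1 θ • v‖ := norm_add_le _ _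
      _ ≤ 1 + ‖v‖ := by
        rw [norm_smul, norm_circleMap_zero, abs_one, one_mul]
        linarith
  · exact ((hf _).hasFDerivAt.comp w ((hasFDerivAt_id w).add_const _)).const_mul _

end Holomorphic

/-! ### The form of a bivector on covectors, and its jacobiator -/

/-- Covectors at a point of the phase space. -/
abbrev Covector (n : ℕ) : Type := Phase n →L[ℂ] ℂ

/-- The bilinear form on covectors defined by a bivector. -/
def form {n : ℕ} (M : BivMatrix n) : Covector n →ₗ[ℂ] Covector n →ₗ[ℂ] ℂ :=
  LinearMap.mk₂ ℂ (fun φ ψ => ∑ a, ∑ b, M a b * φ (Pi.single a 1) * ψ (Pi.single b 1))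
    (fun φ φ' ψ => by
      simp only [add_apply, mul_add, add_mul, Finset.sum_add_distrib])
    (fun c φ ψ => by
      simp only [smul_apply, smul_eq_mul, Finset.mul_sum]
      exact Finset.sum_congr rfl fun a _ => Finset.sum_congr rfl fun b _ => by ring)
    (fun φ ψ ψ' => by
      simp only [add_apply, mul_add, Finset.sum_add_distrib])
    (fun c φ ψ => by
      simp only [smul_apply, smul_eq_mul, Finset.mul_sum]
      exact Finset.sum_congr rfl fun a _ => Finset.sum_congr rfl fun b _ => by ring)

theorem form_apply {n : ℕ} (M : BivMatrix n) (φ ψ : Covector n) :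
    form M φ ψ = ∑ a, ∑ b, M a b * φ (Pi.single a 1) * ψ (Pi.single b 1) := rfl

theorem bracketAt_eq_form {n : ℕ} (M : BivMatrix n) (f g : Phase n → ℂ) (z : Phase n) :
    bracketAt M f g z = form M (fderiv ℂ f z) (fderiv ℂ g z) := rfl

theorem bracketAt_of_hasFDerivAt {n : ℕ} (M : BivMatrix n) {f g : Phase n → ℂ} {z : Phase n}
    {φ ψ : Covector n} (hf : HasFDerivAt f φ z) (hg : HasFDerivAt g ψ z) :
    bracketAt M f g z = form M φ ψ := by
  rw [bracketAt_eq_form, hf.fderiv, hg.fderiv]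

theorem form_isSkew {n : ℕ} {M : BivMatrix n} (hM : M.transpose = -M) : IsSkew (form M) := by
  intro φ ψ
  have h : ∀ a b, M b a = -M a b := fun a b => congrFun (congrFun hM a) b
  rw [form_apply, form_apply, Finset.sum_comm, ← Finset.sum_neg_distrib]
  refine Finset.sum_congr rfl fun b _ => ?_
  rw [← Finset.sum_neg_distrib]
  refine Finset.sum_congr rfl fun a _ => ?_
  rw [h b a]
  ring

/-- The coordinate covector. -/
abbrev dcoord {n : ℕ} (a : Fin n ⊕ Fin n) : Covector n := ContinuousLinearMap.proj a

theorem form_dcoord {n : ℕ} (M : BivMatrix n) (a b : Fin n ⊕ Fin n) :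
    form M (dcoord a) (dcoord b) = M a b := by
  simp [form_apply, Pi.single_apply]

theorem covector_eq_sum {n : ℕ} (φ : Covector n) :
    φ = ∑ a, φ (Pi.single a 1) • dcoord a := by
  ext z
  conv_lhs => rw [← Finset.univ_sum_single z, map_sum]
  simp only [sum_apply, smul_apply,
    ContinuousLinearMap.proj_apply, smul_eq_mul]
  refine Finset.sum_congr rfl fun a _ => ?_
  have : (Pi.single a (z a) : Phase n) = z a • Pi.single a 1 := by
    rw [← Pi.single_smul, smul_eq_mul, mul_one]
  rw [this, map_smul, smul_eq_mul, mul_comm]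

/-- The vector obtained from a covector by contraction with a bivector. -/
def sharp {n : ℕ} (M : BivMatrix n) (φ : Covector n) : Phase n :=
  fun b => ∑ a, M a b * φ (Pi.single a 1)

theorem form_eq_sharp {n : ℕ} (M : BivMatrix n) (φ ψ : Covector n) :
    form M φ ψ = ψ (sharp M φ) := by
  conv_rhs => rw [covector_eq_sum ψ]
  rw [form_apply, Finset.sum_comm]
  simp only [sum_apply, smul_apply,
    ContinuousLinearMap.proj_apply, smul_eq_mul, sharp, Finset.mul_sum]
  exact Finset.sum_congr rfl fun b _ => Finset.sum_congr rfl fun a _ => by ring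

theorem differentiable_fderiv {n : ℕ} {f : Phase n → ℂ} (hf : Differentiable ℂ f) :
    Differentiable ℂ (fderiv ℂ f) := by
  have : fderiv ℂ f = fun z => ∑ a, fderiv ℂ f z (Pi.single a 1) • dcoord a :=
    funext fun z => covector_eq_sum _
  rw [this]
  exact Differentiable.fun_sum fun a _ => (differentiable_fderiv_apply hf _).smul_const _

theorem differentiable_form {n : ℕ} {P : Phase n → BivMatrix n}
    (hP : ∀ a b, Differentiable ℂ fun z => P z a b) (β γ : Covector n) :
    Differentiable ℂ fun z => form (P z) β γ := by
  simp only [form_apply]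
  exact Differentiable.fun_sum fun a _ => Differentiable.fun_sum fun b _ =>
    ((hP a b).mul_const _).mul_const _

/-- The product rule: one term differentiates the bivector with frozen covectors, the other two
contain the second derivatives of the functions. -/
theorem hasFDerivAt_bracket {n : ℕ} {P : Phase n → BivMatrix n}
    (hP : ∀ a b, Differentiable ℂ fun z => P z a b) {g h : Phase n → ℂ}
    (hg : Differentiable ℂ g) (hh : Differentiable ℂ h) (z X : Phase n) :
    DifferentiableAt ℂ (bracket P g h) z ∧
    fderiv ℂ (bracket P g h) z X =
      fderiv ℂ (fun w => form (P w) (fderiv ℂ g z) (fderiv ℂ h z)) z X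
        + form (P z) (fderiv ℂ (fderiv ℂ g) z X) (fderiv ℂ h z)
        + form (P z) (fderiv ℂ g z) (fderiv ℂ (fderiv ℂ h) z X) := by
  have happ : ∀ {f : Phase n → ℂ}, Differentiable ℂ f → ∀ a : Fin n ⊕ Fin n,
      HasFDerivAt (fun w => fderiv ℂ f w (Pi.single a 1))
        ((fderiv ℂ (fderiv ℂ f) z).flip (Pi.single a 1)) z := fun hf a => by
    simpa using (differentiable_fderiv hf z).hasFDerivAt.clm_apply
      (hasFDerivAt_const (Pi.single a (1 : ℂ)) z)
  have h1 : HasFDerivAt (bracket P g h) _ z :=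
    HasFDerivAt.fun_sum (u := Finset.univ) fun a _ =>
      HasFDerivAt.fun_sum (u := Finset.univ) fun b _ =>
      (((hP a b) z).hasFDerivAt.fun_mul (happ hg a)).fun_mul (happ hh b)
  have h2 : HasFDerivAt (fun w => form (P w) (fderiv ℂ g z) (fderiv ℂ h z)) _ z :=
    HasFDerivAt.fun_sum (u := Finset.univ) fun a _ =>
      HasFDerivAt.fun_sum (u := Finset.univ) fun b _ =>
      ((((hP a b) z).hasFDerivAt.mul_const (fderiv ℂ g z (Pi.single a 1))).mul_const
        (fderiv ℂ h z (Pi.single b 1)))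
  refine ⟨h1.differentiableAt, ?_⟩
  rw [h1.fderiv, h2.fderiv]
  simp only [form_apply, sum_apply, add_apply,
    smul_apply, smul_eq_mul, ContinuousLinearMap.flip_apply,
    ← Finset.sum_add_distrib]
  exact Finset.sum_congr rfl fun a _ => Finset.sum_congr rfl fun b _ => by ring

/-- The jacobiator of a bivector field, as a trilinear function of covectors. -/
def jacobiator {n : ℕ} (P : Phase n → BivMatrix n) (z : Phase n) (α β γ : Covector n) : ℂ :=
  fderiv ℂ (fun w => form (P w) β γ) z (sharp (P z) α)
    + fderiv ℂ (fun w => form (P w) γ α) z (sharp (P z) β)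
    + fderiv ℂ (fun w => form (P w) α β) z (sharp (P z) γ)

theorem jacobiator_cycle {n : ℕ} (P : Phase n → BivMatrix n) (z : Phase n)
    (α β γ : Covector n) : jacobiator P z α β γ = jacobiator P z β γ α := by
  rw [jacobiator, jacobiator]; ring

theorem jacobiator_swap {n : ℕ} {P : Phase n → BivMatrix n} (hs : ∀ z, (P z).transpose = -P z)
    (z : Phase n) (α β γ : Covector n) : jacobiator P z α β γ = -jacobiator P z β α γ := by
  have h : ∀ β γ : Covector n, fderiv ℂ (fun w => form (P w) β γ) z =
      -fderiv ℂ (fun w => form (P w) γ β) z := fun β γ => by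
    rw [← fderiv_fun_neg]
    congr 1
    exact funext fun w => form_isSkew (hs w) β γ
  rw [jacobiator, jacobiator, h β γ, h γ α, h α β]
  simp only [neg_apply]
  ring

theorem isLinearMap_jacobiator {n : ℕ} {P : Phase n → BivMatrix n}
    (hP : ∀ a b, Differentiable ℂ fun z => P z a b) (z : Phase n) (α β : Covector n) :
    IsLinearMap ℂ (jacobiator P z α β) where
  map_add γ γ' := by
    have e1 : (fun w => form (P w) β (γ + γ')) =
        fun w => form (P w) β γ + form (P w) β γ' := funext fun w => map_add _ _ _
    have e2 : (fun w => form (P w) (γ + γ') α) =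
        fun w => form (P w) γ α + form (P w) γ' α := funext fun w => by simp
    have e3 : sharp (P z) (γ + γ') = sharp (P z) γ + sharp (P z) γ' := funext fun b => by
      simp [sharp, mul_add, Finset.sum_add_distrib]
    rw [jacobiator, jacobiator, jacobiator, e1, e2, e3, map_add,
      fderiv_fun_add (differentiable_form hP _ _ z) (differentiable_form hP _ _ z),
      fderiv_fun_add (differentiable_form hP _ _ z) (differentiable_form hP _ _ z)]
    simp only [add_apply]
    ring
  map_smul c γ := by
    have e1 : (fun w => form (P w) β (c • γ)) =
        fun w => c * form (P w) β γ := funext fun w => by simp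
    have e2 : (fun w => form (P w) (c • γ) α) =
        fun w => c * form (P w) γ α := funext fun w => by simp
    have e3 : sharp (P z) (c • γ) = c • sharp (P z) γ := funext fun b => by
      simp only [sharp, smul_apply, smul_eq_mul, Pi.smul_apply,
        Finset.mul_sum]
      exact Finset.sum_congr rfl fun a _ => by ring
    rw [jacobiator, jacobiator, e1, e2, e3, map_smul,
      fderiv_const_mul (differentiable_form hP _ _ z),
      fderiv_const_mul (differentiable_form hP _ _ z)]
    simp only [smul_apply, smul_eq_mul]
    ring

/-- The six terms with second derivatives cancel in pairs, by skew-symmetry of the bivector and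
symmetry of second derivatives. What remains depends on f, g, h only through their differentials at
z. -/
theorem jacobi_eq_jacobiator {n : ℕ} {P : Phase n → BivMatrix n}
    (hP : ∀ a b, Differentiable ℂ fun z => P z a b) (hs : ∀ z, (P z).transpose = -P z)
    {f g h : Phase n → ℂ} (hf : Differentiable ℂ f) (hg : Differentiable ℂ g)
    (hh : Differentiable ℂ h) (z : Phase n) :
    form (P z) (fderiv ℂ f z) (fderiv ℂ (bracket P g h) z)
      + form (P z) (fderiv ℂ g z) (fderiv ℂ (bracket P h f) z)
      + form (P z) (fderiv ℂ h z) (fderiv ℂ (bracket P f g) z) =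
    jacobiator P z (fderiv ℂ f z) (fderiv ℂ g z) (fderiv ℂ h z) := by
  have hsym : ∀ {f : Phase n → ℂ}, Differentiable ℂ f → ∀ v w,
      fderiv ℂ (fderiv ℂ f) z v w = fderiv ℂ (fderiv ℂ f) z w v := fun hf v w =>
    second_derivative_symmetric (fun y => (hf y).hasFDerivAt)
      (differentiable_fderiv hf z).hasFDerivAt v w
  have hl : ∀ φ ψ : Covector n, form (P z) φ ψ = -φ (sharp (P z) ψ) := fun φ ψ => by
    rw [form_isSkew (hs z), form_eq_sharp]
  rw [form_eq_sharp, form_eq_sharp, form_eq_sharp, (hasFDerivAt_bracket hP hg hh z _).2,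
    (hasFDerivAt_bracket hP hh hf z _).2, (hasFDerivAt_bracket hP hf hg z _).2, jacobiator]
  rw [hl _ (fderiv ℂ h z), hl _ (fderiv ℂ f z), hl _ (fderiv ℂ g z), form_eq_sharp, form_eq_sharp,
    form_eq_sharp, hsym hg, hsym hh, hsym hf]
  ring

theorem isPoisson_of_jacobiator {n : ℕ} {P : Phase n → BivMatrix n}
    (hP : ∀ a b, Differentiable ℂ fun z => P z a b) (hs : ∀ z, (P z).transpose = -P z)
    (hJ : ∀ z α β γ, jacobiator P z α β γ = 0) : IsPoisson P where
  holomorphic := hP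
  skew _ _ _ _ := funext fun z => form_isSkew (hs z) _ _
  jacobi _ _ _ hf hg hh := funext fun z =>
    (jacobi_eq_jacobiator hP hs hf hg hh z).trans (hJ z _ _ _)

end TodaReflection
end

open Polynomial

noncomputable section

namespace TodaReflection

theorem form_pencil {n : ℕ} (c₀ c₁ : ℂ) (M N : BivMatrix n) (φ ψ : Covector n) :
    form (c₀ • M + c₁ • N) φ ψ = c₀ * form M φ ψ + c₁ * form N φ ψ := by
  simp only [form_apply, Matrix.add_apply, Matrix.smul_apply, smul_eq_mul, add_mul,
    Finset.sum_add_distrib, Finset.mul_sum]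
  congr 1 <;>
  exact Finset.sum_congr rfl fun a _ => Finset.sum_congr rfl fun b _ => by ring

/-! ### Removing the first site -/

/-- The index of a coordinate after a site has been added on the left. -/
abbrev shift {n : ℕ} (a : Fin n ⊕ Fin n) : Fin (n + 1) ⊕ Fin (n + 1) := Sum.map Fin.succ Fin.succ a

/-- The coordinates of all sites but the first. -/
def tail {n : ℕ} : Phase (n + 1) →L[ℂ] Phase n :=
  ContinuousLinearMap.pi fun a => ContinuousLinearMap.proj (shift a)

theorem tail_apply {n : ℕ} (z : Phase (n + 1)) (a : Fin n ⊕ Fin n) : tail z a = z (shift a) := rfl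

/-- The pullback of covectors under `tail`. -/
def extend {n : ℕ} : Covector n →ₗ[ℂ] Covector (n + 1) where
  toFun φ := φ.comp tail
  map_add' _ _ := rfl
  map_smul' _ _ := rfl

theorem extend_apply {n : ℕ} (φ : Covector n) (v : Phase (n + 1)) : extend φ v = φ (tail v) := rfl

theorem extend_dcoord {n : ℕ} (a : Fin n ⊕ Fin n) :
    extend (dcoord a) = (dcoord (shift a) : Covector (n + 1)) := rfl

/-- The covector `dq₁`. -/
abbrev dq {n : ℕ} : Covector (n + 1) := dcoord (Sum.inl 0)

/-- The covector `dp₁`. -/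
abbrev dp {n : ℕ} : Covector (n + 1) := dcoord (Sum.inr 0)

theorem tail_single_zero {n : ℕ} :
    tail (Pi.single (Sum.inl 0) 1 : Phase (n + 1)) = 0 ∧
      tail (Pi.single (Sum.inr 0) 1 : Phase (n + 1)) = 0 := by
  constructor <;> ext a <;> rw [tail_apply] <;> rcases a with i | i <;>
    simp [Fin.succ_ne_zero]

theorem tail_single_shift {n : ℕ} (a : Fin n ⊕ Fin n) :
    tail (Pi.single (shift a) 1 : Phase (n + 1)) = Pi.single a 1 := by
  ext c
  rw [tail_apply]
  rcases a with i | i <;> rcases c with j | j <;> simp [Pi.single_apply]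

theorem form_canonical {n : ℕ} (z : Phase n) (φ ψ : Covector n) :
    form (canonical z) φ ψ =
      ∑ i, (φ (Pi.single (Sum.inl i) 1) * ψ (Pi.single (Sum.inr i) 1)
        - φ (Pi.single (Sum.inr i) 1) * ψ (Pi.single (Sum.inl i) 1)) := by
  rw [form_apply, Fintype.sum_sum_type, Finset.sum_sub_distrib, sub_eq_add_neg,
    ← Finset.sum_neg_distrib]
  congr 1 <;> refine Finset.sum_congr rfl fun i _ => ?_ <;>
    simp [canonical, Matrix.one_apply, Fintype.sum_sum_type]

theorem canonical_isSkew {n : ℕ} (z : Phase n) : (canonical z).transpose = -canonical z := by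
  simp [canonical, Matrix.fromBlocks_transpose, Matrix.fromBlocks_neg]

/-- The canonical bivector is the direct sum of the plane of the first site and the phase space of
the tail. -/
theorem canonical_succ {n : ℕ} (z : Phase (n + 1)) (φ ψ : Covector n) :
    form (canonical z) (extend φ) (extend ψ) = form (canonical (tail z)) φ ψ ∧
    form (canonical z) dq (extend φ) = 0 ∧ form (canonical z) dp (extend φ) = 0 ∧
    form (canonical z) dq dp = 1 := by
  refine ⟨?_, ?_, ?_, by simp [form_dcoord, canonical]⟩
  · have h1 := fun i : Fin n => tail_single_shift (Sum.inl i)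
    have h2 := fun i : Fin n => tail_single_shift (Sum.inr i)
    simp only [shift, Sum.map_inl, Sum.map_inr] at h1 h2
    simp only [form_canonical, Fin.sum_univ_succ, extend_apply, h1, h2, tail_single_zero.1,
      tail_single_zero.2, map_zero]
    ring
  · simp [form_canonical, extend_apply, tail_single_zero, Pi.single_apply]
  · simp [form_canonical, extend_apply, tail_single_zero, Pi.single_apply]

/-! ### Boundary data and the chain -/

/-- The data by which the two types of boundary differ. -/
structure Boundary where
  a₀ : ℂ
  ρ : ℂ → ℂ
  s : ℂ → ℂ
  V : ℂ → ℂ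
  W : ℂ → ℂ
  -- For one site det T = a₀² + (V s² - 2 a₀ ρ)λ² + (ρ² - s²)λ⁴ in the form used in `chain`. The
  -- derivative rules for ρ and s make ρ² - s² constant, and `hW` makes V s² - 2 a₀ ρ constant.
  hρ : ∀ q, HasDerivAt ρ (-s q) q
  hs : ∀ q, HasDerivAt s (-ρ q) q
  hV : ∀ q, HasDerivAt V (W q) q
  hW : ∀ q, s q * W q = 2 * ρ q * V q - 2 * a₀

variable (b : Boundary)

/-- The entries `A`, `B`, `C` of `L(λ) T(λ) L(-λ)⁻¹` from those of `T(λ)`. -/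
def dressPoly (q p : ℂ) (t : ℂ[X] × ℂ[X] × ℂ[X]) : ℂ[X] × ℂ[X] × ℂ[X] :=
  (t.1.comp (-X) - (X - C p) * (C (Complex.exp (-q)) * t.2.1),
    C (Complex.exp q) * ((X - C p) * t.1 + (X + C p) * t.1.comp (-X) - C (Complex.exp q) * t.2.2
      - (X ^ 2 - C p ^ 2) * (C (Complex.exp (-q)) * t.2.1)),
    C (Complex.exp (-q)) * -(C (Complex.exp (-q)) * t.2.1))

/-- The entries `A`, `B`, `C` of `T(λ)` for a chain of `n + 1` sites. -/
def chain : (n : ℕ) → Phase (n + 1) → ℂ[X] × ℂ[X] × ℂ[X]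
  | 0, z =>
    (C b.a₀ - C (b.ρ (z (Sum.inl 0))) * X ^ 2 + C (z (Sum.inr 0) * b.s (z (Sum.inl 0))) * X,
      -X ^ 3 + C (z (Sum.inr 0) ^ 2 + b.V (z (Sum.inl 0))) * X,
      -(C (b.s (z (Sum.inl 0)) ^ 2) * X))
  | n + 1, z => dressPoly (z (Sum.inl 0)) (z (Sum.inr 0)) (chain n (tail z))

/-- `A(λ)` as a function on phase space. -/
def cA (n : ℕ) (l : ℂ) (z : Phase (n + 1)) : ℂ := (chain b n z).1.eval l

/-- `B(λ)` as a function on phase space. -/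
def cB (n : ℕ) (l : ℂ) (z : Phase (n + 1)) : ℂ := (chain b n z).2.1.eval l

/-- `C(λ)` as a function on phase space. -/
def cC (n : ℕ) (l : ℂ) (z : Phase (n + 1)) : ℂ := (chain b n z).2.2.eval l

/-- The constant polynomial `ρ₁` as a function on phase space. -/
def cρ : (n : ℕ) → Phase (n + 1) → ℂ
  | 0, z => b.ρ (z (Sum.inl 0))
  | _ + 1, z => Complex.exp (-z (Sum.inl 0))

/-- Minus the derivative of `ρ₁` in `q₁`. -/
def cs : (n : ℕ) → Phase (n + 1) → ℂ
  | 0, z => b.s (z (Sum.inl 0))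
  | _ + 1, z => Complex.exp (-z (Sum.inl 0))

/-- The quadratic Hamiltonian. -/
def cH : (n : ℕ) → Phase (n + 1) → ℂ
  | 0, z => z (Sum.inr 0) ^ 2 + b.V (z (Sum.inl 0))
  | n + 1, z => z (Sum.inr 0) ^ 2 + 2 * (Complex.exp (z (Sum.inl 0)) * cρ b n (tail z))
      + cH n (tail z)

/-- The differential of `A(λ)`. -/
def dA (n : ℕ) (z : Phase (n + 1)) (l : ℂ) : Covector (n + 1) := fderiv ℂ (cA b n l) z

/-- The differential of `B(λ)`. -/
def dB (n : ℕ) (z : Phase (n + 1)) (l : ℂ) : Covector (n + 1) := fderiv ℂ (cB b n l) z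

/-- The differential of `C(λ)`. -/
def dC (n : ℕ) (z : Phase (n + 1)) (l : ℂ) : Covector (n + 1) := fderiv ℂ (cC b n l) z

theorem cA_succ (n : ℕ) (l : ℂ) (z : Phase (n + 2)) :
    cA b (n + 1) l z = cA b n (-l) (tail z)
      - (l - z (Sum.inr 0)) * (Complex.exp (-z (Sum.inl 0)) * cB b n l (tail z)) := by
  simp [cA, cB, chain, dressPoly]

theorem cB_succ (n : ℕ) (l : ℂ) (z : Phase (n + 2)) :
    cB b (n + 1) l z = Complex.exp (z (Sum.inl 0)) *
      ((l - z (Sum.inr 0)) * cA b n l (tail z) + (l + z (Sum.inr 0)) * cA b n (-l) (tail z)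
        - Complex.exp (z (Sum.inl 0)) * cC b n l (tail z)
        - (l ^ 2 - z (Sum.inr 0) ^ 2) *
          (Complex.exp (-z (Sum.inl 0)) * cB b n l (tail z))) := by
  simp [cA, cB, cC, chain, dressPoly]

theorem cC_succ (n : ℕ) (l : ℂ) (z : Phase (n + 2)) :
    cC b (n + 1) l z = Complex.exp (-z (Sum.inl 0)) *
      -(Complex.exp (-z (Sum.inl 0)) * cB b n l (tail z)) := by
  simp [cC, cB, chain, dressPoly]

theorem cA_zero (l : ℂ) (z : Phase 1) :
    cA b 0 l z = b.a₀ - b.ρ (z (Sum.inl 0)) * l ^ 2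
      + z (Sum.inr 0) * b.s (z (Sum.inl 0)) * l := by
  simp [cA, chain]

theorem cB_zero (l : ℂ) (z : Phase 1) :
    cB b 0 l z = -l ^ 3 + (z (Sum.inr 0) ^ 2 + b.V (z (Sum.inl 0))) * l := by
  simp [cB, chain]

theorem cC_zero (l : ℂ) (z : Phase 1) :
    cC b 0 l z = -(b.s (z (Sum.inl 0)) ^ 2 * l) := by
  simp [cC, chain]

section Differentials

variable {n : ℕ} (z : Phase (n + 1))

theorem hasFDerivAt_q : HasFDerivAt (fun w : Phase (n + 1) => w (Sum.inl 0)) dq z :=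
  (dq (n := n)).hasFDerivAt

theorem hasFDerivAt_p : HasFDerivAt (fun w : Phase (n + 1) => w (Sum.inr 0)) dp z :=
  (dp (n := n)).hasFDerivAt

theorem hasFDerivAt_comp_q {f : ℂ → ℂ} {f' : ℂ} (hf : HasDerivAt f f' (z (Sum.inl 0))) :
    HasFDerivAt (fun w : Phase (n + 1) => f (w (Sum.inl 0))) (f' • dq) z :=
  hf.comp_hasFDerivAt z (hasFDerivAt_q z)

theorem hasFDerivAt_exp_q : HasFDerivAt (fun w : Phase (n + 1) => Complex.exp (w (Sum.inl 0)))
    (Complex.exp (z (Sum.inl 0)) • dq) z :=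
  hasFDerivAt_comp_q z (Complex.hasDerivAt_exp _)

theorem hasFDerivAt_exp_neg_q :
    HasFDerivAt (fun w : Phase (n + 1) => Complex.exp (-w (Sum.inl 0)))
    (-Complex.exp (-z (Sum.inl 0)) • dq) z := by
  have h : HasDerivAt (fun q : ℂ => Complex.exp (-q)) (-Complex.exp (-z (Sum.inl 0)))
      (z (Sum.inl 0)) := by
    simpa using (hasDerivAt_neg (z (Sum.inl 0))).cexp
  exact hasFDerivAt_comp_q z h

theorem hasFDerivAt_tail {f : Phase n → ℂ} {φ : Covector n} (hf : HasFDerivAt f φ (tail z)) :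
    HasFDerivAt (fun w : Phase (n + 1) => f (tail w)) (extend φ) z :=
  hf.comp z tail.hasFDerivAt

end Differentials

theorem hasFDerivAt_zero (l : ℂ) (z : Phase 1) :
    HasFDerivAt (cA b 0 l) ((l ^ 2 * b.s (z (Sum.inl 0))
      - l * z (Sum.inr 0) * b.ρ (z (Sum.inl 0))) • dq + (l * b.s (z (Sum.inl 0))) • dp) z ∧
    HasFDerivAt (cB b 0 l) ((l * b.W (z (Sum.inl 0))) • dq + (2 * l * z (Sum.inr 0)) • dp) z ∧
    HasFDerivAt (cC b 0 l) ((2 * l * b.s (z (Sum.inl 0)) * b.ρ (z (Sum.inl 0))) • dq) z := by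
  have hr := hasFDerivAt_comp_q z (b.hρ (z (Sum.inl 0)))
  have hs := hasFDerivAt_comp_q z (b.hs (z (Sum.inl 0)))
  have hV := hasFDerivAt_comp_q z (b.hV (z (Sum.inl 0)))
  have hp := hasFDerivAt_p z
  refine ⟨?_, ?_, ?_⟩
  · rw [funext (cA_zero b l)]
    refine (((hr.mul_const (l ^ 2)).const_sub b.a₀).add
      ((hp.mul hs).mul_const l)).congr_fderiv ?_
    module
  · rw [funext (cB_zero b l)]
    refine ((((hp.pow 2).add hV).mul_const l).const_add (-l ^ 3)).congr_fderiv ?_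
    module
  · rw [funext (cC_zero b l)]
    refine (((hs.pow 2).mul_const l).neg).congr_fderiv ?_
    module

theorem differentiable_chain (n : ℕ) (l : ℂ) : Differentiable ℂ (cA b n l) ∧
    Differentiable ℂ (cB b n l) ∧ Differentiable ℂ (cC b n l) := by
  induction n generalizing l with
  | zero =>
    exact ⟨fun z => (hasFDerivAt_zero b l z).1.differentiableAt,
      fun z => (hasFDerivAt_zero b l z).2.1.differentiableAt,
      fun z => (hasFDerivAt_zero b l z).2.2.differentiableAt⟩
  | succ n ih =>
    have hA : ∀ l, Differentiable ℂ fun z : Phase (n + 2) => cA b n l (tail z) :=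
      fun l => (ih l).1.comp tail.differentiable
    have hB : Differentiable ℂ fun z : Phase (n + 2) => cB b n l (tail z) :=
      (ih l).2.1.comp tail.differentiable
    have hC : Differentiable ℂ fun z : Phase (n + 2) => cC b n l (tail z) :=
      (ih l).2.2.comp tail.differentiable
    rw [funext (cA_succ b n l), funext (cB_succ b n l), funext (cC_succ b n l)]
    refine ⟨?_, ?_, ?_⟩ <;> fun_prop

theorem dA_zero (l : ℂ) (z : Phase 1) : dA b 0 z l = (l ^ 2 * b.s (z (Sum.inl 0))
      - l * z (Sum.inr 0) * b.ρ (z (Sum.inl 0))) • dq + (l * b.s (z (Sum.inl 0))) • dp :=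
  (hasFDerivAt_zero b l z).1.fderiv

theorem dB_zero (l : ℂ) (z : Phase 1) :
    dB b 0 z l = (l * b.W (z (Sum.inl 0))) • dq + (2 * l * z (Sum.inr 0)) • dp :=
  (hasFDerivAt_zero b l z).2.1.fderiv

theorem dC_zero (l : ℂ) (z : Phase 1) :
    dC b 0 z l = (2 * l * b.s (z (Sum.inl 0)) * b.ρ (z (Sum.inl 0))) • dq :=
  (hasFDerivAt_zero b l z).2.2.fderiv

section Succ

variable (n : ℕ) (l : ℂ) (z : Phase (n + 2))

theorem hasFDerivAt_tail_chain :
    HasFDerivAt (fun w : Phase (n + 2) => cA b n l (tail w)) (extend (dA b n (tail z) l)) z ∧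
    HasFDerivAt (fun w : Phase (n + 2) => cB b n l (tail w)) (extend (dB b n (tail z) l)) z ∧
    HasFDerivAt (fun w : Phase (n + 2) => cC b n l (tail w)) (extend (dC b n (tail z) l)) z :=
  ⟨hasFDerivAt_tail z ((differentiable_chain b n l).1 _).hasFDerivAt,
    hasFDerivAt_tail z ((differentiable_chain b n l).2.1 _).hasFDerivAt,
    hasFDerivAt_tail z ((differentiable_chain b n l).2.2 _).hasFDerivAt⟩

theorem dA_succ : dA b (n + 1) z l =
    extend (dA b n (tail z) (-l))
      - (l - z (Sum.inr 0)) • Complex.exp (-z (Sum.inl 0)) • extend (dB b n (tail z) l)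
      + (Complex.exp (-z (Sum.inl 0)) * cB b n l (tail z)) • dp
      + ((l - z (Sum.inr 0)) * (Complex.exp (-z (Sum.inl 0)) * cB b n l (tail z))) • dq := by
  have h := ((hasFDerivAt_tail_chain b n (-l) z).1.sub (((hasFDerivAt_p z).const_sub l).mul
    ((hasFDerivAt_exp_neg_q z).mul (hasFDerivAt_tail_chain b n l z).2.1)))
  rw [dA, funext (cA_succ b n l)]
  refine h.fderiv.trans ?_
  simp only [Pi.mul_apply]
  module

theorem dC_succ : dC b (n + 1) z l =
    Complex.exp (-z (Sum.inl 0)) •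
      (-(Complex.exp (-z (Sum.inl 0)) • extend (dB b n (tail z) l))
        + (2 * (Complex.exp (-z (Sum.inl 0)) * cB b n l (tail z))) • dq) := by
  have h := (hasFDerivAt_exp_neg_q z).mul
    ((hasFDerivAt_exp_neg_q z).mul (hasFDerivAt_tail_chain b n l z).2.1).neg
  rw [dC, funext (cC_succ b n l)]
  refine h.fderiv.trans ?_
  simp only [Pi.mul_apply, Pi.neg_apply]
  module

theorem dB_succ : dB b (n + 1) z l =
    Complex.exp (z (Sum.inl 0)) •
      ((l - z (Sum.inr 0)) • extend (dA b n (tail z) l)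
        + (l + z (Sum.inr 0)) • extend (dA b n (tail z) (-l))
        - Complex.exp (z (Sum.inl 0)) • extend (dC b n (tail z) l)
        - (l ^ 2 - z (Sum.inr 0) ^ 2) •
          Complex.exp (-z (Sum.inl 0)) • extend (dB b n (tail z) l)
        + (-cA b n l (tail z) + cA b n (-l) (tail z)
          + 2 * z (Sum.inr 0) * (Complex.exp (-z (Sum.inl 0)) * cB b n l (tail z))) • dp
        + ((l - z (Sum.inr 0)) * cA b n l (tail z) + (l + z (Sum.inr 0)) * cA b n (-l) (tail z)
          - 2 * (Complex.exp (z (Sum.inl 0)) * cC b n l (tail z))) • dq) := by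
  have hp := hasFDerivAt_p z
  have hA := (hasFDerivAt_tail_chain b n l z).1
  have hA' := (hasFDerivAt_tail_chain b n (-l) z).1
  have hB := (hasFDerivAt_tail_chain b n l z).2.1
  have hC := (hasFDerivAt_tail_chain b n l z).2.2
  have h := (hasFDerivAt_exp_q z).mul (((((hp.const_sub l).mul hA).add
    ((hp.const_add l).mul hA')).sub ((hasFDerivAt_exp_q z).mul hC)).sub
      (((hp.pow 2).const_sub (l ^ 2)).mul ((hasFDerivAt_exp_neg_q z).mul hB)))
  rw [dB, funext (cB_succ b n l)]
  refine h.fderiv.trans ?_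
  simp only [Pi.add_apply, Pi.sub_apply, Pi.mul_apply]
  module

end Succ

/-! ### The functions ρ₁ and H and the vector field from which the second bracket is built. -/

/-- The differential of `ρ₁`. -/
def dρ (n : ℕ) (z : Phase (n + 1)) : Covector (n + 1) := -cs b n z • dq

/-- The differential of the Hamiltonian. -/
def dH (n : ℕ) (z : Phase (n + 1)) : Covector (n + 1) := fderiv ℂ (cH b n) z

theorem hasFDerivAt_cρ (n : ℕ) (z : Phase (n + 1)) : HasFDerivAt (cρ b n) (dρ b n z) z := by
  cases n with
  | zero => exact hasFDerivAt_comp_q z (b.hρ _)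
  | succ n => exact hasFDerivAt_exp_neg_q z

theorem hasFDerivAt_cH_zero (z : Phase 1) :
    HasFDerivAt (cH b 0) (b.W (z (Sum.inl 0)) • dq + (2 * z (Sum.inr 0)) • dp) z := by
  refine (((hasFDerivAt_p z).pow 2).add
    (hasFDerivAt_comp_q z (b.hV (z (Sum.inl 0))))).congr_fderiv ?_
  module

theorem hasFDerivAt_cH_succ (n : ℕ) (z : Phase (n + 2)) (hH : DifferentiableAt ℂ (cH b n) (tail z)) :
    HasFDerivAt (cH b (n + 1)) ((2 * z (Sum.inr 0)) • dp
      + (2 * (Complex.exp (z (Sum.inl 0)) * cρ b n (tail z))) • dq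
      + (2 * Complex.exp (z (Sum.inl 0))) • extend (dρ b n (tail z))
      + extend (dH b n (tail z))) z := by
  refine ((((hasFDerivAt_p z).pow 2).add (((hasFDerivAt_exp_q z).mul
    (hasFDerivAt_tail z (hasFDerivAt_cρ b n (tail z)))).const_mul 2)).add
      (hasFDerivAt_tail z hH.hasFDerivAt)).congr_fderiv ?_
  simp only [dH]
  module

theorem differentiable_cH (n : ℕ) : Differentiable ℂ (cH b n) := by
  induction n with
  | zero => exact fun z => (hasFDerivAt_cH_zero b z).differentiableAt
  | succ n ih => exact fun z => (hasFDerivAt_cH_succ b n z (ih _)).differentiableAt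

theorem dH_zero (z : Phase 1) :
    dH b 0 z = b.W (z (Sum.inl 0)) • dq + (2 * z (Sum.inr 0)) • dp :=
  (hasFDerivAt_cH_zero b z).fderiv

theorem dH_succ (n : ℕ) (z : Phase (n + 2)) :
    dH b (n + 1) z = (2 * z (Sum.inr 0)) • dp
      + (2 * (Complex.exp (z (Sum.inl 0)) * cρ b n (tail z))) • dq
      + (2 * Complex.exp (z (Sum.inl 0))) • extend (dρ b n (tail z))
      + extend (dH b n (tail z)) :=
  (hasFDerivAt_cH_succ b n z (differentiable_cH b n _)).fderiv

/-- The vector field `-ρ₁ p₁ ∂/∂p₁ + (∂ρ₁/∂q₁) ∂/∂q₁`. -/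
def fieldY (n : ℕ) (z : Phase (n + 1)) : Phase (n + 1) :=
  Pi.single (Sum.inr 0) (-(cρ b n z * z (Sum.inr 0))) + Pi.single (Sum.inl 0) (-cs b n z)

theorem dq_fieldY (n : ℕ) (z : Phase (n + 1)) : dq (fieldY b n z) = -cs b n z := by
  simp [fieldY]

theorem dp_fieldY (n : ℕ) (z : Phase (n + 1)) :
    dp (fieldY b n z) = -(cρ b n z * z (Sum.inr 0)) := by
  simp [fieldY]

/-- The field moves only the first site, so it does not see functions of the tail. -/
theorem extend_fieldY (n : ℕ) (z : Phase (n + 2)) (φ : Covector (n + 1)) :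
    extend φ (fieldY b (n + 1) z) = 0 := by
  have : tail (fieldY b (n + 1) z) = 0 := by
    ext a
    rw [tail_apply]
    rcases a with i | i <;> simp [fieldY, Fin.succ_ne_zero]
  rw [extend_apply, this, map_zero]

end TodaReflection
end

open Polynomial

noncomputable section

namespace TodaReflection

variable (b : Boundary)

/-! ### Canonical brackets of ρ₁ and H with the entries of T. -/

theorem exp_mul_exp_neg (q : ℂ) : Complex.exp q * Complex.exp (-q) = 1 := by
  rw [← Complex.exp_add, add_neg_cancel, Complex.exp_zero]

theorem form_swap {n : ℕ} (z : Phase n) (φ ψ : Covector n) :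
    form (canonical z) φ ψ = -form (canonical z) ψ φ := form_isSkew (canonical_isSkew z) φ ψ

theorem chain_neg (n : ℕ) (l : ℂ) :
    cB b n (-l) = -cB b n l ∧ cC b n (-l) = -cC b n l := by
  induction n generalizing l with
  | zero =>
    constructor <;> ext z
    · simp only [Pi.neg_apply, cB_zero]; ring
    · simp only [Pi.neg_apply, cC_zero]; ring
  | succ n ih =>
    constructor <;> ext z
    · simp only [Pi.neg_apply, cB_succ, (ih l).1, (ih l).2, neg_neg]; ring
    · simp only [Pi.neg_apply, cC_succ, (ih l).1]; ring

theorem cB_neg (n : ℕ) (l : ℂ) (z : Phase (n + 1)) : cB b n (-l) z = -cB b n l z :=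
  congrFun (chain_neg b n l).1 z

theorem cC_neg (n : ℕ) (l : ℂ) (z : Phase (n + 1)) : cC b n (-l) z = -cC b n l z :=
  congrFun (chain_neg b n l).2 z

theorem dB_neg (n : ℕ) (z : Phase (n + 1)) (l : ℂ) : dB b n z (-l) = -dB b n z l := by
  rw [dB, (chain_neg b n l).1, fderiv_neg, dB]

theorem dC_neg (n : ℕ) (z : Phase (n + 1)) (l : ℂ) : dC b n z (-l) = -dC b n z l := by
  rw [dC, (chain_neg b n l).2, fderiv_neg, dC]

/-- Canonical brackets with `ρ₁` and with the Hamiltonian, and the derivatives along `fieldY`. -/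
structure SiteRelations (n : ℕ) (z : Phase (n + 1)) : Prop where
  -- Up to sign, ρ₁ is the leading coefficient of A and H the second nonzero coefficient of B from
  -- the top. The six brackets are thus the top coefficients in μ of relations in (R_0); they are
  -- proved here directly, before (R_0) is available.
  HA : ∀ l, form (canonical z) (dH b n z) (dA b n z l) =
    -2 * l * cA b n l z + 2 * cρ b n z * cB b n l z
  HB : ∀ l, form (canonical z) (dH b n z) (dB b n z l) = 0
  HC : ∀ l, form (canonical z) (dH b n z) (dC b n z l) =
    2 * cρ b n z * (cA b n (-l) z - cA b n l z)
  ρA : ∀ l, form (canonical z) (dρ b n z) (dA b n z l) = cC b n l z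
  ρB : ∀ l, form (canonical z) (dρ b n z) (dB b n z l) = cA b n (-l) z - cA b n l z
  ρC : ∀ l, form (canonical z) (dρ b n z) (dC b n z l) = 0
  YA : ∀ l, dA b n z l (fieldY b n z) = l * cC b n l z
  YB : ∀ l, dB b n z l (fieldY b n z) =
    -2 * cρ b n z * cB b n l z + l * (cA b n l z + cA b n (-l) z)
  YC : ∀ l, dC b n z l (fieldY b n z) = 2 * cρ b n z * cC b n l z

theorem siteRelations_zero (z : Phase 1) : SiteRelations b 0 z := by
  have h1 : form (canonical z) dq dp = 1 := (canonical_succ z 0 0).2.2.2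
  have h2 : form (canonical z) dp dq = -1 := by rw [form_swap, h1]
  have hs := form_isSkew (canonical_isSkew z)
  have hW := b.hW (z (Sum.inl 0))
  constructor <;> intro l <;>
    simp only [dH_zero, dA_zero, dB_zero, dC_zero, dρ, cρ, cs, cA_zero, cB_zero, cC_zero, map_add,
      map_smul, LinearMap.add_apply, LinearMap.smul_apply, smul_eq_mul, h1, h2, hs.self, add_apply,
      smul_apply, dq_fieldY, dp_fieldY]
  -- Among the nine one-site relations only {H, A} and the derivative of B along the field use the
  -- link between V and W.
  · linear_combination l * hW
  · ring
  · ring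
  · ring
  · ring
  · ring
  · ring
  · linear_combination -l * hW
  · ring

theorem siteRelations_succ (n : ℕ) (z : Phase (n + 2)) (ih : SiteRelations b n (tail z)) :
    SiteRelations b (n + 1) z := by
  have h1 : form (canonical z) dq dp = 1 := (canonical_succ z 0 0).2.2.2
  have h2 : form (canonical z) dp dq = -1 := by rw [form_swap, h1]
  have hs := form_isSkew (canonical_isSkew z)
  have e1 := fun φ ψ => (canonical_succ z φ ψ).1
  have e2 := fun φ => (canonical_succ z φ φ).2.1
  have e3 := fun φ => (canonical_succ z φ φ).2.2.1
  have e4 := fun φ => hs.swap (e2 φ)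
  have e5 := fun φ => hs.swap (e3 φ)
  have hxy := exp_mul_exp_neg (z (Sum.inl 0))
  constructor <;> intro l <;>
    simp only [dH_succ, dA_succ, dB_succ, dC_succ, dρ.eq_1 b (n + 1), cρ.eq_2, cs.eq_2, cA_succ,
      cB_succ, cC_succ, map_add, map_sub, map_neg,
      map_smul, LinearMap.add_apply, LinearMap.smul_apply, smul_eq_mul, h1, h2, hs.self, add_apply,
      sub_apply, neg_apply, smul_apply, dq_fieldY, dp_fieldY, extend_fieldY, e1, e2, e3, e4, e5,
      ih.HA, ih.HB, ih.HC, ih.ρA, ih.ρB, ih.ρC, cB_neg, cC_neg, neg_neg]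
  -- With e^q = x and e^(-q) = x⁻¹ every remaining claim is a rational identity.
  all_goals generalize Complex.exp (-z (Sum.inl 0)) = y at hxy ⊢
  all_goals generalize Complex.exp (z (Sum.inl 0)) = x at hxy ⊢
  all_goals
    obtain rfl : y = x⁻¹ := eq_inv_of_mul_eq_one_right hxy
    have hx : x ≠ 0 := left_ne_zero_of_mul_eq_one hxy
    field_simp
    ring

theorem siteRelations (n : ℕ) (z : Phase (n + 1)) : SiteRelations b n z := by
  induction n with
  | zero => exact siteRelations_zero b z
  | succ n ih => exact siteRelations_succ b n z (ih _)

theorem covector_hom_ext {n : ℕ} {f g : Covector n →ₗ[ℂ] ℂ}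
    (h : ∀ a, f (dcoord a) = g (dcoord a)) : f = g := by
  ext φ
  rw [covector_eq_sum φ, map_sum, map_sum]
  exact Finset.sum_congr rfl fun a _ => by rw [map_smul, map_smul, h]

theorem form_extend {n : ℕ} {M : BivMatrix (n + 1)} {M' : BivMatrix n}
    (h : ∀ a b, M (shift a) (shift b) = M' a b) (φ ψ : Covector n) :
    form M (extend φ) (extend ψ) = form M' φ ψ := by
  have h1 : ∀ a, (form M (extend (dcoord a))).comp extend = form M' (dcoord a) := fun a =>
    covector_hom_ext fun c => by
      rw [LinearMap.comp_apply, extend_dcoord, extend_dcoord, form_dcoord, form_dcoord, h]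
  have h2 : ((form M).flip (extend ψ)).comp extend = (form M').flip ψ :=
    covector_hom_ext fun a => by
      rw [LinearMap.flip_apply, ← h1 a]
      rfl
  exact congrArg (fun f : Covector n →ₗ[ℂ] ℂ => f φ) h2

/-! ### Second brackets built site by site, and the relations of the whole pencil. -/

/-- Second brackets on chains of all lengths, related to each other by adding sites. -/
structure IsSecondFamily (P : ∀ n, Phase (n + 1) → BivMatrix (n + 1)) : Prop where
  skew : ∀ n z, (P n z).transpose = -P n z
  base : ∀ z, P 0 z (Sum.inl 0) (Sum.inr 0) = z (Sum.inr 0) ^ 2 + b.V (z (Sum.inl 0))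
  shift_shift : ∀ n z a c, P (n + 1) z (shift a) (shift c) = P n (tail z) a c
  q_p : ∀ n z, P (n + 1) z (Sum.inl 0) (Sum.inr 0) =
    z (Sum.inr 0) ^ 2 + 2 * (Complex.exp (z (Sum.inl 0)) * cρ b n (tail z))
  -- This field and the next one make both q₁ and p₁ act on the tail through ρ₁, H and `fieldY`
  -- alone, so `SiteRelations` supplies all the hypotheses of `dress`.
  q_shift : ∀ n z a, P (n + 1) z (Sum.inl 0) (shift a) =
    form (canonical (tail z)) (dH b n (tail z)) (dcoord a)
      + Complex.exp (z (Sum.inl 0)) * form (canonical (tail z)) (dρ b n (tail z)) (dcoord a)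
  p_shift : ∀ n z a, P (n + 1) z (Sum.inr 0) (shift a) = Complex.exp (z (Sum.inl 0)) *
    (z (Sum.inr 0) * form (canonical (tail z)) (dρ b n (tail z)) (dcoord a)
      + fieldY b n (tail z) a)

namespace IsSecondFamily

variable {b} {P : ∀ n, Phase (n + 1) → BivMatrix (n + 1)}

theorem form_q_p_zero (hP : IsSecondFamily b P) (z : Phase 1) :
    form (P 0 z) dq dp = z (Sum.inr 0) ^ 2 + b.V (z (Sum.inl 0)) :=
  (form_dcoord _ _ _).trans (hP.base z)

theorem form_q_p (hP : IsSecondFamily b P) (n : ℕ) (z : Phase (n + 2)) :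
    form (P (n + 1) z) dq dp =
      z (Sum.inr 0) ^ 2 + 2 * (Complex.exp (z (Sum.inl 0)) * cρ b n (tail z)) :=
  (form_dcoord _ _ _).trans (hP.q_p n z)

theorem q_extend (hP : IsSecondFamily b P) (n : ℕ) (z : Phase (n + 2)) (φ : Covector (n + 1)) :
    form (P (n + 1) z) dq (extend φ) = form (canonical (tail z)) (dH b n (tail z)) φ
      + Complex.exp (z (Sum.inl 0)) * form (canonical (tail z)) (dρ b n (tail z)) φ := by
  have h : (form (P (n + 1) z) dq).comp extend = form (canonical (tail z)) (dH b n (tail z))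
      + Complex.exp (z (Sum.inl 0)) • form (canonical (tail z)) (dρ b n (tail z)) :=
    covector_hom_ext fun a => by
      rw [LinearMap.comp_apply, extend_dcoord, form_dcoord, hP.q_shift]
      rfl
  exact congrArg (fun f : Covector (n + 1) →ₗ[ℂ] ℂ => f φ) h

theorem p_extend (hP : IsSecondFamily b P) (n : ℕ) (z : Phase (n + 2)) (φ : Covector (n + 1)) :
    form (P (n + 1) z) dp (extend φ) = Complex.exp (z (Sum.inl 0)) *
      (z (Sum.inr 0) * form (canonical (tail z)) (dρ b n (tail z)) φ
        + φ (fieldY b n (tail z))) := by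
  have h : (form (P (n + 1) z) dp).comp extend = Complex.exp (z (Sum.inl 0)) •
      (z (Sum.inr 0) • form (canonical (tail z)) (dρ b n (tail z))
        + (ContinuousLinearMap.apply ℂ ℂ (fieldY b n (tail z))).toLinearMap) :=
    covector_hom_ext fun a => by
      rw [LinearMap.comp_apply, extend_dcoord, form_dcoord, hP.p_shift]
      rfl
  exact congrArg (fun f : Covector (n + 1) →ₗ[ℂ] ℂ => f φ) h

end IsSecondFamily

/-- Used with the pullback of covectors from the tail to the longer chain, which preserves the
pairings. -/
theorem ReflectionAlgebra.map {V V' : Type*} [AddCommGroup V] [Module ℂ V] [AddCommGroup V']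
    [Module ℂ V'] {ω : V →ₗ[ℂ] V →ₗ[ℂ] ℂ} {c₀ c₁ r : ℂ} {A B C : ℂ → ℂ} {dA dB dC : ℂ → V}
    (H : ReflectionAlgebra ω c₀ c₁ r A B C dA dB dC) {ω' : V' →ₗ[ℂ] V' →ₗ[ℂ] ℂ}
    (f : V →ₗ[ℂ] V') (h : ∀ u v, ω' (f u) (f v) = ω u v) :
    ReflectionAlgebra ω' c₀ c₁ r A B C (fun l => f (dA l)) (fun l => f (dB l))
      (fun l => f (dC l)) := by
  refine ⟨H.B_neg, H.C_neg, fun l => ?_, fun l => ?_, ?_, ?_, ?_, ?_, ?_, ?_⟩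
  · rw [H.dB_neg, map_neg]
  · rw [H.dC_neg, map_neg]
  all_goals simp only [h]
  exacts [H.BB, H.AA, H.CC, H.AB, H.AC, H.BC]

variable {b} {P : ∀ n, Phase (n + 1) → BivMatrix (n + 1)}

/-- The pencil of the canonical and the second bracket. -/
def pencil (P : ∀ n, Phase (n + 1) → BivMatrix (n + 1)) (c₀ c₁ : ℂ) (n : ℕ) (z : Phase (n + 1)) :
    BivMatrix (n + 1) := c₀ • canonical z + c₁ • P n z

theorem pencil_skew (hP : IsSecondFamily b P) (c₀ c₁ : ℂ) (n : ℕ) (z : Phase (n + 1)) :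
    (pencil P c₀ c₁ n z).transpose = -pencil P c₀ c₁ n z := by
  rw [pencil, Matrix.transpose_add, Matrix.transpose_smul, Matrix.transpose_smul, hP.skew,
    canonical_isSkew]
  module

theorem reflectionAlgebra_zero (hP : IsSecondFamily b P) (c₀ c₁ : ℂ) (z : Phase 1) :
    ReflectionAlgebra (form (pencil P c₀ c₁ 0 z)) c₀ c₁ (cρ b 0 z) (fun l => cA b 0 l z)
      (fun l => cB b 0 l z) (fun l => cC b 0 l z) (dA b 0 z) (dB b 0 z) (dC b 0 z) := by
  have hs := form_isSkew (pencil_skew hP c₀ c₁ 0 z)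
  have h1 : form (pencil P c₀ c₁ 0 z) dq dp =
      c₀ + c₁ * (z (Sum.inr 0) ^ 2 + b.V (z (Sum.inl 0))) := by
    rw [pencil, form_pencil, (canonical_succ z 0 0).2.2.2, mul_one, hP.form_q_p_zero]
  have h2 := hs.swap h1
  have hW := b.hW (z (Sum.inl 0))
  refine ⟨fun l => cB_neg b 0 l z, fun l => cC_neg b 0 l z, dB_neg b 0 z, dC_neg b 0 z,
    fun l m => ?_, fun l m => ?_, fun l m => ?_, fun l m => ?_, fun l m => ?_, fun l m => ?_⟩ <;>
    simp only [dA_zero, dB_zero, dC_zero, cρ, cA_zero, cB_zero, cC_zero, map_add,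
      map_smul, LinearMap.add_apply, LinearMap.smul_apply, smul_eq_mul, h1, h2, hs.self] <;>
    generalize b.W (z (Sum.inl 0)) = W at hW ⊢ <;> generalize b.V (z (Sum.inl 0)) = V at hW ⊢ <;>
    generalize b.ρ (z (Sum.inl 0)) = ρ at hW ⊢ <;> generalize b.s (z (Sum.inl 0)) = s at hW ⊢ <;>
    generalize z (Sum.inr 0) = p
  · ring
  · ring
  · ring
  -- For a single site {A, B} alone needs the relation between V, W, ρ and s.
  · linear_combination (-(l - m) * (l + m) * l * m * (c₀ + c₁ * (p ^ 2 + V))) * hW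
  · ring
  · ring

/-- L with coordinate q is the conjugate by diag(e^q, 1) of L with q = 0. So T' is rescaled by
e^(-q), dressed by a site in which e^q no longer appears, and rescaled back by e^q. The derivatives
of e^q are accounted for by the dq terms in `dress`. -/
theorem reflectionAlgebra_succ (hP : IsSecondFamily b P) (c₀ c₁ : ℂ) (n : ℕ) (z : Phase (n + 2))
    (ih : ReflectionAlgebra (form (pencil P c₀ c₁ n (tail z))) c₀ c₁ (cρ b n (tail z))
      (fun l => cA b n l (tail z)) (fun l => cB b n l (tail z)) (fun l => cC b n l (tail z))
      (dA b n (tail z)) (dB b n (tail z)) (dC b n (tail z))) :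
    ReflectionAlgebra (form (pencil P c₀ c₁ (n + 1) z)) c₀ c₁ (cρ b (n + 1) z)
      (fun l => cA b (n + 1) l z) (fun l => cB b (n + 1) l z) (fun l => cC b (n + 1) l z)
      (dA b (n + 1) z) (dB b (n + 1) z) (dC b (n + 1) z) := by
  have hs := form_isSkew (pencil_skew hP c₀ c₁ (n + 1) z)
  have hR := siteRelations b n (tail z)
  have hxy := exp_mul_exp_neg (z (Sum.inl 0))
  have hqp : form (pencil P c₀ c₁ (n + 1) z) dq dp =
      c₀ + c₁ * (z (Sum.inr 0) ^ 2 + 2 * (Complex.exp (z (Sum.inl 0)) * cρ b n (tail z))) := by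
    rw [pencil, form_pencil, (canonical_succ z 0 0).2.2.2, mul_one, hP.form_q_p]
  have hq : ∀ φ, form (pencil P c₀ c₁ (n + 1) z) dq (extend φ) =
      c₁ * (form (canonical (tail z)) (dH b n (tail z)) φ
      + Complex.exp (z (Sum.inl 0)) * form (canonical (tail z)) (dρ b n (tail z)) φ) := fun φ => by
    rw [pencil, form_pencil, hP.q_extend, (canonical_succ z φ φ).2.1, mul_zero, zero_add]
  have hp : ∀ φ, form (pencil P c₀ c₁ (n + 1) z) dp (extend φ) =
      c₁ * (Complex.exp (z (Sum.inl 0)) *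
      (z (Sum.inr 0) * form (canonical (tail z)) (dρ b n (tail z)) φ
        + φ (fieldY b n (tail z)))) := fun φ => by
    rw [pencil, form_pencil, hP.p_extend, (canonical_succ z φ φ).2.2.1, mul_zero, zero_add]
  have h1 := ((ih.map extend (ω' := form (pencil P c₀ c₁ (n + 1) z)) fun u v => by
    rw [pencil, pencil, form_pencil, form_pencil, (canonical_succ z u v).1,
      form_extend (hP.shift_shift n z)]).rescale ((mul_comm _ _).trans hxy)).dress hs hqp
    (fun l => by
      rw [hq, hR.HA, hR.ρA]
      linear_combination (-c₁ * 2 * cρ b n (tail z) * cB b n l (tail z)) * hxy)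
    (fun l => by
      rw [map_smul, hq, hR.HB, hR.ρB, smul_eq_mul]
      linear_combination (c₁ * (cA b n (-l) (tail z) - cA b n l (tail z))) * hxy)
    (fun l => by
      rw [map_smul, hq, hR.HC, hR.ρC, smul_eq_mul]
      ring)
    (fun l => by
      rw [hp, hR.ρA, hR.YA]
      ring)
    (fun l => by
      rw [map_smul, hp, hR.ρB, hR.YB, smul_eq_mul]
      linear_combination (c₁ * (z (Sum.inr 0) * (cA b n (-l) (tail z) - cA b n l (tail z))
        + l * (cA b n l (tail z) + cA b n (-l) (tail z)))) * hxy)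
    (fun l => by
      rw [map_smul, hp, hR.ρC, hR.YC, smul_eq_mul]
      ring)
  have h2 := h1.rescale hxy
  rw [mul_one] at h2
  convert h2 using 1
  · rfl
  · funext l; exact cA_succ b n l z
  · funext l; exact cB_succ b n l z
  · funext l; exact cC_succ b n l z
  · funext l; exact dA_succ b n l z
  · funext l; exact dB_succ b n l z
  · funext l; exact dC_succ b n l z

/-- The functions `A(λ)`, `B(λ)`, `C(λ)` of a chain satisfy the relations of the pencil. -/
theorem reflectionAlgebra (hP : IsSecondFamily b P) (c₀ c₁ : ℂ) (n : ℕ) (z : Phase (n + 1)) :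
    ReflectionAlgebra (form (pencil P c₀ c₁ n z)) c₀ c₁ (cρ b n z) (fun l => cA b n l z)
      (fun l => cB b n l z) (fun l => cC b n l z) (dA b n z) (dB b n z) (dC b n z) := by
  induction n with
  | zero => exact reflectionAlgebra_zero hP c₀ c₁ z
  | succ n ih => exact reflectionAlgebra_succ hP c₀ c₁ n z (ih _)

/-- Since {A, B}₁ contains ρ₁, the Jacobi identity also needs the second brackets of ρ₁ with A and
B. -/
theorem form_dρ (hP : IsSecondFamily b P) (n : ℕ) (z : Phase (n + 1)) (l : ℂ) :
    form (P n z) (dρ b n z) (dA b n z l) = l ^ 2 * cC b n l z - cs b n z ^ 2 * cB b n l z ∧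
    form (P n z) (dρ b n z) (dB b n z l) =
      -2 * (z (Sum.inr 0) * cs b n z) * cB b n l z
        - l ^ 2 * (cA b n l z - cA b n (-l) z) := by
  have hs := form_isSkew (hP.skew n z)
  cases n with
  | zero =>
    have h1 := hP.form_q_p_zero z
    constructor <;>
      simp only [dA_zero, dB_zero, dρ, cs, cA_zero, cB_zero, cC_zero, map_add, map_smul,
        LinearMap.smul_apply, smul_eq_mul, h1, hs.self] <;> ring
  | succ n =>
    have h1 := hP.form_q_p n z
    have hR := siteRelations b n (tail z)
    have hxy := exp_mul_exp_neg (z (Sum.inl 0))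
    constructor <;>
      simp only [dA_succ, dB_succ, dρ.eq_1 b (n + 1), cs.eq_2, cA_succ, cB_succ, cC_succ, map_add,
        map_sub, map_smul, LinearMap.smul_apply, smul_eq_mul, h1, hs.self,
        hP.q_extend, hR.HA, hR.HB, hR.HC, hR.ρA, hR.ρB, hR.ρC, cB_neg, cC_neg, neg_neg] <;>
      generalize Complex.exp (-z (Sum.inl 0)) = y at hxy ⊢ <;>
      generalize Complex.exp (z (Sum.inl 0)) = x at hxy ⊢ <;>
      obtain rfl : y = x⁻¹ := eq_inv_of_mul_eq_one_right hxy <;>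
      have hx : x ≠ 0 := left_ne_zero_of_mul_eq_one hxy <;>
      field_simp <;> ring

/-- The brackets of `ρ₁` in the pencil. -/
theorem form_pencil_dρ (hP : IsSecondFamily b P) (c₀ c₁ : ℂ) (n : ℕ) (z : Phase (n + 1)) (l : ℂ) :
    form (pencil P c₀ c₁ n z) (dA b n z l) (dρ b n z) =
      -(c₀ * cC b n l z + c₁ * (l ^ 2 * cC b n l z - cs b n z ^ 2 * cB b n l z)) ∧
    form (pencil P c₀ c₁ n z) (dB b n z l) (dρ b n z) =
      -(c₀ * (cA b n (-l) z - cA b n l z) + c₁ * (-2 * (z (Sum.inr 0) * cs b n z) * cB b n l z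
        - l ^ 2 * (cA b n l z - cA b n (-l) z))) := by
  have hs := form_isSkew (pencil_skew hP c₀ c₁ n z)
  have hR := siteRelations b n z
  constructor
  · refine hs.swap ?_
    rw [pencil, form_pencil, hR.ρA, (form_dρ hP n z l).1]
  · refine hs.swap ?_
    rw [pencil, form_pencil, hR.ρB, (form_dρ hP n z l).2]

end TodaReflection
end

open Polynomial

noncomputable section

namespace TodaReflection

open Filter

/-! ### Coefficients of the polynomials of a chain -/

theorem coeff_comp_neg_X (p : ℂ[X]) (k : ℕ) : (p.comp (-X)).coeff k = (-1) ^ k * p.coeff k := by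
  have : (-X : ℂ[X]) = C (-1) * X := by simp
  rw [this, comp_C_mul_X_coeff, mul_comm]

theorem coeff_X_sub_C_mul (p : ℂ[X]) (r : ℂ) (k : ℕ) :
    ((X - C r) * p).coeff (k + 1) = p.coeff k - r * p.coeff (k + 1) := by
  rw [sub_mul, coeff_sub, coeff_X_mul, coeff_C_mul]

theorem coeff_X_add_C_mul (p : ℂ[X]) (r : ℂ) (k : ℕ) :
    ((X + C r) * p).coeff (k + 1) = p.coeff k + r * p.coeff (k + 1) := by
  rw [add_mul, coeff_add, coeff_X_mul, coeff_C_mul]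

theorem coeff_X_sq_sub_C_mul (p : ℂ[X]) (r : ℂ) (k : ℕ) :
    ((X ^ 2 - C r ^ 2) * p).coeff (k + 2) = p.coeff k - r ^ 2 * p.coeff (k + 2) := by
  rw [sub_mul, coeff_sub, coeff_X_pow_mul, ← C_pow, coeff_C_mul]

theorem coeff_dressPoly_A (q p : ℂ) (t : ℂ[X] × ℂ[X] × ℂ[X]) (k : ℕ) :
    (dressPoly q p t).1.coeff (k + 1) = (-1) ^ (k + 1) * t.1.coeff (k + 1)
      - Complex.exp (-q) * (t.2.1.coeff k - p * t.2.1.coeff (k + 1)) := by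
  rw [dressPoly, coeff_sub, coeff_comp_neg_X, coeff_X_sub_C_mul, coeff_C_mul, coeff_C_mul]
  ring

theorem coeff_dressPoly_B (q p : ℂ) (t : ℂ[X] × ℂ[X] × ℂ[X]) (k : ℕ) :
    (dressPoly q p t).2.1.coeff (k + 2) = Complex.exp q *
      (t.1.coeff (k + 1) - p * t.1.coeff (k + 2) + (-1) ^ (k + 1) * t.1.coeff (k + 1)
        + p * ((-1) ^ (k + 2) * t.1.coeff (k + 2)) - Complex.exp q * t.2.2.coeff (k + 2)
        - Complex.exp (-q) * (t.2.1.coeff k - p ^ 2 * t.2.1.coeff (k + 2))) := by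
  rw [dressPoly, coeff_C_mul, coeff_sub, coeff_sub, coeff_add, coeff_X_sub_C_mul,
    coeff_X_add_C_mul, coeff_X_sq_sub_C_mul, coeff_C_mul, coeff_C_mul, coeff_C_mul,
    coeff_comp_neg_X, coeff_comp_neg_X]
  ring

theorem coeff_dressPoly_C (q p : ℂ) (t : ℂ[X] × ℂ[X] × ℂ[X]) (k : ℕ) :
    (dressPoly q p t).2.2.coeff k =
      -(Complex.exp (-q) * (Complex.exp (-q) * t.2.1.coeff k)) := by
  rw [dressPoly, coeff_C_mul, coeff_neg, coeff_C_mul]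
  ring

/-- Degrees and leading coefficients of the polynomials of a chain. -/
structure ChainCoeffs (b : Boundary) (n : ℕ) (z : Phase (n + 1)) : Prop where
  A_high : ∀ k, 2 * n + 2 < k → (chain b n z).1.coeff k = 0
  A_lead : (chain b n z).1.coeff (2 * n + 2) = (-1) ^ (n + 1) * cρ b n z
  B_high : ∀ k, 2 * n + 3 < k → (chain b n z).2.1.coeff k = 0
  B_lead : (chain b n z).2.1.coeff (2 * n + 3) = (-1) ^ (n + 1)
  B_even : ∀ k, (chain b n z).2.1.coeff (2 * k) = 0
  B_next : (chain b n z).2.1.coeff (2 * n + 1) = -(-1) ^ (n + 1) * cH b n z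
  C_high : ∀ k, 2 * n + 1 < k → (chain b n z).2.2.coeff k = 0

variable (b : Boundary)

theorem chain_comp_neg_X (n : ℕ) (z : Phase (n + 1)) :
    (chain b n z).2.1.comp (-X) = -(chain b n z).2.1 :=
  Polynomial.funext fun l => by
    rw [eval_comp, eval_neg, eval_neg, eval_X]
    exact cB_neg b n l z

theorem chain_B_even (n : ℕ) (z : Phase (n + 1)) (k : ℕ) :
    (chain b n z).2.1.coeff (2 * k) = 0 := by
  have h := congrArg (fun p : ℂ[X] => p.coeff (2 * k)) (chain_comp_neg_X b n z)
  simp only [coeff_comp_neg_X, coeff_neg, pow_mul] at h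
  norm_num at h
  exact self_eq_neg.mp h

theorem chainCoeffs (n : ℕ) (z : Phase (n + 1)) : ChainCoeffs b n z := by
  induction n with
  | zero =>
    refine ⟨fun k hk => ?_, ?_, fun k hk => ?_, ?_, chain_B_even b 0 z, ?_, fun k hk => ?_⟩
    · have h1 : k ≠ 0 := by omega
      have h2 : k ≠ 1 := by omega
      have h3 : k ≠ 2 := by omega
      simp only [chain, coeff_add, coeff_sub, coeff_C_mul, coeff_C, coeff_X, coeff_X_pow, h1,
        h2.symm, h3, if_false, mul_zero, sub_zero, add_zero]
    · simp [chain, cρ]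
    · have h2 : k ≠ 1 := by omega
      have h3 : k ≠ 3 := by omega
      simp only [chain, coeff_add, coeff_neg, coeff_C_mul, coeff_X, coeff_X_pow, h2.symm, h3,
        if_false, neg_zero, mul_zero, add_zero]
    · simp only [chain, coeff_add, coeff_neg, coeff_C_mul, coeff_X, coeff_X_pow]
      norm_num
    · simp only [chain, coeff_add, coeff_neg, coeff_C_mul, coeff_X, coeff_X_pow, cH]
      norm_num
    · have h2 : k ≠ 1 := by omega
      simp only [chain, coeff_neg, coeff_C_mul, coeff_X, h2.symm, if_false, mul_zero, neg_zero]
  | succ n ih =>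
    have ih := ih (tail z)
    have hxy := exp_mul_exp_neg (z (Sum.inl 0))
    refine ⟨fun k hk => ?_, ?_, fun k hk => ?_, ?_, chain_B_even b (n + 1) z, ?_, fun k hk => ?_⟩
    · obtain ⟨k, rfl⟩ : ∃ j, k = j + 1 := ⟨k - 1, by omega⟩
      rw [chain, coeff_dressPoly_A, ih.A_high _ (by omega), ih.B_high _ (by omega),
        ih.B_high _ (by omega)]
      ring
    · rw [chain, show 2 * (n + 1) + 2 = (2 * n + 3) + 1 by ring, coeff_dressPoly_A,
        ih.A_high _ (by omega), ih.B_lead, ih.B_high _ (by omega), cρ]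
      ring
    · obtain ⟨k, rfl⟩ : ∃ j, k = j + 2 := ⟨k - 2, by omega⟩
      rw [chain, coeff_dressPoly_B, ih.A_high _ (by omega), ih.A_high _ (by omega),
        ih.B_high _ (by omega), ih.B_high _ (by omega), ih.C_high _ (by omega)]
      ring
    · rw [chain, show 2 * (n + 1) + 3 = (2 * n + 3) + 2 by ring, coeff_dressPoly_B,
        ih.A_high _ (by omega), ih.A_high _ (by omega), ih.B_lead,
        ih.B_high _ (by omega), ih.C_high _ (by omega)]
      linear_combination (-(-1) ^ (n + 1)) * hxy
    · rw [chain, show 2 * (n + 1) + 1 = (2 * n + 1) + 2 by ring, coeff_dressPoly_B,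
        show 2 * n + 1 + 2 = 2 * n + 3 by ring, show 2 * n + 1 + 1 = 2 * n + 2 by ring,
        ih.A_high (2 * n + 3) (by omega), ih.A_lead, ih.B_lead, ih.B_next, ih.C_high _ (by omega), cH]
      -- The leading coefficient of A has even index, so A(λ) and A(-λ) contribute equally. This
      -- doubling is the factor 2 of e^(q₁)ρ₁ in H.
      have h : ((-1 : ℂ)) ^ (2 * n + 2) = 1 := Even.neg_one_pow ⟨n + 1, by ring⟩
      rw [h]
      linear_combination
        ((-1) ^ (n + 1) * cH b n (tail z) + (-1) ^ (n + 1) * z (Sum.inr 0) ^ 2) * hxy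
    · rw [chain, coeff_dressPoly_C, ih.B_high _ (by omega)]
      ring

/-! ### Directional derivatives of polynomials with holomorphic coefficients. -/

/-- All coefficients of the polynomials `p z` are differentiable in `z`. -/
def CoeffDifferentiable {n : ℕ} (p : Phase n → ℂ[X]) : Prop :=
  ∀ k, Differentiable ℂ fun z => (p z).coeff k

namespace CoeffDifferentiable

variable {n : ℕ} {p q : Phase n → ℂ[X]}

theorem of_const (r : ℂ[X]) : CoeffDifferentiable fun _ : Phase n => r :=
  fun _ => differentiable_const _

theorem of_C {f : Phase n → ℂ} (hf : Differentiable ℂ f) :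
    CoeffDifferentiable fun z => C (f z) := fun k => by
  simp only [coeff_C]
  by_cases h : k = 0
  · simpa [h] using hf
  · simp [h]

theorem add (hp : CoeffDifferentiable p) (hq : CoeffDifferentiable q) :
    CoeffDifferentiable fun z => p z + q z := fun k => by
  simp only [coeff_add]
  exact (hp k).add (hq k)

theorem sub (hp : CoeffDifferentiable p) (hq : CoeffDifferentiable q) :
    CoeffDifferentiable fun z => p z - q z := fun k => by
  simp only [coeff_sub]
  exact (hp k).sub (hq k)

theorem neg (hp : CoeffDifferentiable p) : CoeffDifferentiable fun z => -p z := fun k => by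
  simp only [coeff_neg]
  exact (hp k).neg

theorem mul (hp : CoeffDifferentiable p) (hq : CoeffDifferentiable q) :
    CoeffDifferentiable fun z => p z * q z := fun k => by
  simp only [coeff_mul]
  exact Differentiable.fun_sum fun i _ => (hp _).mul (hq _)

theorem comp_neg_X (hp : CoeffDifferentiable p) :
    CoeffDifferentiable fun z => (p z).comp (-X) := fun k => by
  simp only [coeff_comp_neg_X]
  exact (hp k).const_mul _

/-- The derivative of a family of polynomials of degree at most `K` in the direction `v`. -/
def dirDeriv (p : Phase n → ℂ[X]) (K : ℕ) (z v : Phase n) : ℂ[X] :=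
  ∑ k ∈ Finset.range (K + 1), C (fderiv ℂ (fun w => (p w).coeff k) z v) * X ^ k

theorem coeff_dirDeriv (p : Phase n → ℂ[X]) (K : ℕ) (z v : Phase n) (j : ℕ) :
    (dirDeriv p K z v).coeff j =
      if j ≤ K then fderiv ℂ (fun w => (p w).coeff j) z v else 0 := by
  simp [dirDeriv, coeff_C_mul, coeff_X_pow, Order.lt_add_one_iff]

theorem fderiv_eval (hp : CoeffDifferentiable p) {K : ℕ} (hK : ∀ z k, K < k → (p z).coeff k = 0)
    (l : ℂ) (z v : Phase n) :
    fderiv ℂ (fun w => (p w).eval l) z v = (dirDeriv p K z v).eval l := by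
  have h : (fun w => (p w).eval l) =
      fun w => ∑ k ∈ Finset.range (K + 1), (p w).coeff k * l ^ k := funext fun w =>
    eval_eq_sum_range' (Nat.lt_succ_of_le (natDegree_le_iff_coeff_eq_zero.mpr (hK w))) l
  rw [h, fderiv_fun_sum fun k _ => ((hp k).mul_const _) z]
  simp only [dirDeriv, eval_finsetSum, eval_mul, eval_C, eval_pow, eval_X, sum_apply]
  refine Finset.sum_congr rfl fun k _ => ?_
  rw [fderiv_mul_const (hp k z), smul_apply, smul_eq_mul, mul_comm]

end CoeffDifferentiable

theorem eq_of_eventually_eval_eq {p q : ℂ[X]} (h : ∀ᶠ l in cofinite, p.eval l = q.eval l) :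
    p = q :=
  eq_of_infinite_eval_eq p q (frequently_cofinite_iff_infinite.mp h.frequently)

theorem eventually_eval_ne_zero {p : ℂ[X]} (h : p ≠ 0) : ∀ᶠ l in cofinite, p.eval l ≠ 0 := by
  rw [eventually_cofinite]
  simpa using finite_setOfPred_isRoot h

theorem coeffDifferentiable_chain (n : ℕ) :
    CoeffDifferentiable (fun z => (chain b n z).1) ∧
    CoeffDifferentiable (fun z => (chain b n z).2.1) ∧
    CoeffDifferentiable (fun z => (chain b n z).2.2) := by
  have hq : ∀ n, Differentiable ℂ fun w : Phase (n + 1) => w (Sum.inl 0) := fun n =>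
    fun z => (hasFDerivAt_q z).differentiableAt
  have hp : ∀ n, Differentiable ℂ fun w : Phase (n + 1) => w (Sum.inr 0) := fun n =>
    fun z => (hasFDerivAt_p z).differentiableAt
  induction n with
  | zero =>
    have hr : Differentiable ℂ fun w : Phase 1 => b.ρ (w (Sum.inl 0)) := fun z =>
      (hasFDerivAt_comp_q z (b.hρ _)).differentiableAt
    have hs : Differentiable ℂ fun w : Phase 1 => b.s (w (Sum.inl 0)) := fun z =>
      (hasFDerivAt_comp_q z (b.hs _)).differentiableAt
    have hV : Differentiable ℂ fun w : Phase 1 => b.V (w (Sum.inl 0)) := fun z =>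
      (hasFDerivAt_comp_q z (b.hV _)).differentiableAt
    exact ⟨((CoeffDifferentiable.of_const _).sub ((CoeffDifferentiable.of_C hr).mul
        (.of_const _))).add ((CoeffDifferentiable.of_C ((hp 0).mul hs)).mul (.of_const _)),
      (CoeffDifferentiable.of_const _).add ((CoeffDifferentiable.of_C
        (((hp 0).pow 2).add hV)).mul (.of_const _)),
      ((CoeffDifferentiable.of_C (hs.pow 2)).mul (.of_const _)).neg⟩
  | succ n ih =>
    have hA : CoeffDifferentiable fun z : Phase (n + 2) => (chain b n (tail z)).1 := fun k =>
      (ih.1 k).comp tail.differentiable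
    have hB : CoeffDifferentiable fun z : Phase (n + 2) => (chain b n (tail z)).2.1 := fun k =>
      (ih.2.1 k).comp tail.differentiable
    have hC : CoeffDifferentiable fun z : Phase (n + 2) => (chain b n (tail z)).2.2 := fun k =>
      (ih.2.2 k).comp tail.differentiable
    have hx : CoeffDifferentiable fun z : Phase (n + 2) => C (Complex.exp (z (Sum.inl 0))) :=
      .of_C (hq _).cexp
    have hy : CoeffDifferentiable fun z : Phase (n + 2) => C (Complex.exp (-z (Sum.inl 0))) :=
      .of_C (hq _).fun_neg.cexp
    have hX : CoeffDifferentiable fun _ : Phase (n + 2) => (X : ℂ[X]) := .of_const _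
    have hpC : CoeffDifferentiable fun z : Phase (n + 2) => C (z (Sum.inr 0)) := .of_C (hp _)
    refine ⟨?_, ?_, ?_⟩
    · exact hA.comp_neg_X.sub ((hX.sub hpC).mul (hy.mul hB))
    · have := hx.mul (((((hX.sub hpC).mul hA).add ((hX.add hpC).mul hA.comp_neg_X)).sub
        (hx.mul hC)).sub (((hX.mul hX).sub (hpC.mul hpC)).mul (hy.mul hB)))
      simp only [← sq] at this
      exact this
    · exact hy.mul (hy.mul hB).neg

theorem chain_B_ne_zero (n : ℕ) (z : Phase (n + 1)) : (chain b n z).2.1 ≠ 0 := fun h => by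
  have := (chainCoeffs b n z).B_lead
  rw [h, coeff_zero] at this
  exact pow_ne_zero (n + 1) (neg_ne_zero.mpr one_ne_zero) this.symm

/-- The derivatives of `A(λ)` and `B(λ)` in a direction are polynomials in `λ` of degree at most
`2 n + 2`. -/
theorem exists_dirDeriv (n : ℕ) (z v : Phase (n + 1)) :
    (∃ Q : ℂ[X], Q.coeff (2 * n + 3) = 0 ∧ ∀ l, dA b n z l v = Q.eval l) ∧
      ∃ Q : ℂ[X], Q.coeff (2 * n + 3) = 0 ∧ ∀ l, dB b n z l v = Q.eval l := by
  refine ⟨⟨_, ?_, fun l => (coeffDifferentiable_chain b n).1.fderiv_eval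
    (fun z => (chainCoeffs b n z).A_high) l z v⟩, ⟨_, ?_, fun l =>
    (coeffDifferentiable_chain b n).2.1.fderiv_eval (fun z => (chainCoeffs b n z).B_high) l z v⟩⟩
  · rw [CoeffDifferentiable.coeff_dirDeriv, if_neg (by omega)]
  -- The leading coefficient of B is ±1 everywhere, so it disappears under differentiation.
  · rw [CoeffDifferentiable.coeff_dirDeriv, if_pos le_rfl,
      funext fun w => (chainCoeffs b n w).B_lead, fderiv_fun_const]
    rfl

/-! ### The differentials span the cotangent space -/

/-- The determinant of `T(λ)` is constant. -/
theorem det_relation (n : ℕ) (z : Phase (n + 1)) (l : ℂ) :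
    cA b n l z • dA b n z (-l) + cA b n (-l) z • dA b n z l - cB b n l z • dC b n z l
      - cC b n l z • dB b n z l = 0 := by
  induction n generalizing l with
  | zero =>
    have hW := b.hW (z (Sum.inl 0))
    simp only [dA_zero, dB_zero, dC_zero, cA_zero, cB_zero, cC_zero]
    match_scalars
    · linear_combination (l ^ 2 * b.s (z (Sum.inl 0))) * hW
    · ring
  | succ n ih =>
    have h1 := congrArg extend (ih (tail z) l)
    have hxy := exp_mul_exp_neg (z (Sum.inl 0))
    simp only [map_add, map_sub, map_smul, map_zero] at h1
    simp only [dA_succ, dB_succ, dC_succ, cA_succ, cB_succ, cC_succ, neg_neg, cB_neg, dB_neg,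
      map_neg]
    generalize Complex.exp (-z (Sum.inl 0)) = y at hxy ⊢
    generalize Complex.exp (z (Sum.inl 0)) = x at hxy ⊢
    obtain rfl : y = x⁻¹ := eq_inv_of_mul_eq_one_right hxy
    have hx : x ≠ 0 := left_ne_zero_of_mul_eq_one hxy
    linear_combination (norm := skip) h1
    match_scalars <;> field_simp <;> ring

/-- A tangent vector annihilated by `dA(λ)` and `dB(λ)` for almost all `λ` vanishes. -/
theorem eq_zero_of_dA_dB (n : ℕ) (z : Phase (n + 1)) (hz : b.s (z (Sum.inl (Fin.last n))) ≠ 0)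
    (v : Phase (n + 1)) (hA : ∀ᶠ l in cofinite, dA b n z l v = 0)
    (hB : ∀ᶠ l in cofinite, dB b n z l v = 0) : v = 0 := by
  induction n with
  | zero =>
    have hz : b.s (z (Sum.inl 0)) ≠ 0 := hz
    have h : C (b.s (z (Sum.inl 0)) * v (Sum.inl 0)) * X ^ 2 + C (b.s (z (Sum.inl 0)) *
        v (Sum.inr 0) - z (Sum.inr 0) * b.ρ (z (Sum.inl 0)) * v (Sum.inl 0)) * X = (0 : ℂ[X]) := by
      refine eq_of_eventually_eval_eq (hA.mono fun l hl => ?_)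
      rw [dA_zero] at hl
      simp only [add_apply, smul_apply, ContinuousLinearMap.proj_apply, smul_eq_mul] at hl
      simp only [eval_add, eval_mul, eval_C, eval_pow, eval_X, eval_zero]
      linear_combination hl
    have h2 := congrArg (fun p : ℂ[X] => p.coeff 2) h
    have h1 := congrArg (fun p : ℂ[X] => p.coeff 1) h
    simp only [coeff_add, coeff_C_mul, coeff_X_pow, coeff_X, coeff_zero] at h1 h2
    norm_num [hz] at h2
    norm_num [hz, h2] at h1
    ext a
    rcases a with i | i <;> obtain rfl : i = 0 := Fin.fin_one_eq_zero i
    exacts [h2, h1]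
  | succ n ih =>
    have hBz := eventually_eval_ne_zero (chain_B_ne_zero b (n + 1) z)
    obtain ⟨⟨QA, -, hQA⟩, -⟩ := exists_dirDeriv b (n + 1) z v
    obtain ⟨⟨RA, hRA0, hRA⟩, ⟨RB, hRB0, hRB⟩⟩ := exists_dirDeriv b n (tail z) (tail v)
    have hlead := (chainCoeffs b n (tail z)).B_lead
    have hone : ((-1 : ℂ)) ^ (n + 1) ≠ 0 := pow_ne_zero _ (neg_ne_zero.mpr one_ne_zero)
    have hy : Complex.exp (-z (Sum.inl 0)) ≠ 0 := Complex.exp_ne_zero _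
    have hA0 : ∀ l, dA b (n + 1) z l v = 0 := by
      have : QA = 0 := eq_of_eventually_eval_eq (hA.mono fun l hl => by rw [← hQA, hl, eval_zero])
      intro l
      rw [hQA, this, eval_zero]
    -- With dA and dB annihilating v, the differential of det T leaves B(λ) dC(λ)(v) = 0, and B has
    -- finitely many zeros.
    have hC : ∀ᶠ l in cofinite, dC b (n + 1) z l v = 0 := by
      filter_upwards [hB, hBz] with l hl hne
      have h := congrArg (fun φ : Covector (n + 2) => φ v) (det_relation b (n + 1) z l)
      simp only [add_apply, sub_apply, smul_apply, hA0, hl, smul_eq_mul, mul_zero, add_zero,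
        sub_zero, zero_sub, zero_apply, neg_eq_zero] at h
      exact (mul_eq_zero.mp h).resolve_left hne
    -- C = -e^(-2q₁) B' with B' from the tail, so dC(λ)(v) = 0 says that the derivative of B' along
    -- v is 2 v_q B'. The coefficients at λ^(2n+3) are 0 and ±2 v_q, which forces v_q = 0.
    have h1 : RB = C (2 * v (Sum.inl 0)) * (chain b n (tail z)).2.1 := by
      refine eq_of_eventually_eval_eq (hC.mono fun l hl => ?_)
      rw [dC_succ, smul_apply, smul_eq_mul] at hl
      have hl := (mul_eq_zero.mp hl).resolve_left hy
      rw [add_apply, neg_apply, smul_apply, smul_apply, extend_apply, hRB, smul_eq_mul,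
        smul_eq_mul, ContinuousLinearMap.proj_apply, cB] at hl
      rw [eval_mul, eval_C]
      exact mul_left_cancel₀ hy (by linear_combination -hl)
    have hvq : v (Sum.inl 0) = 0 := by
      have := congrArg (fun p : ℂ[X] => p.coeff (2 * n + 3)) h1
      simp only [coeff_C_mul, hRB0, hlead] at this
      simpa [hone] using this.symm
    have hRB' : RB = 0 := by rw [h1, hvq, mul_zero, C_0, zero_mul]
    -- Now the derivative of B' vanishes, and dA(λ)(v) = 0 equates the derivative of A'(-λ) with a
    -- multiple of v_p B'. The left side has no term λ^(2n+3), so v_p = 0.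
    have h2 : RA.comp (-X) =
        C (-Complex.exp (-z (Sum.inl 0)) * v (Sum.inr 0)) * (chain b n (tail z)).2.1 := by
      refine Polynomial.funext fun l => ?_
      have hl := hA0 l
      rw [dA_succ] at hl
      simp only [add_apply, sub_apply, smul_apply, extend_apply, hRA, hRB, hRB', eval_zero,
        smul_eq_mul, ContinuousLinearMap.proj_apply, hvq, mul_zero, add_zero,
        sub_zero, cB] at hl
      rw [eval_comp, eval_neg, eval_X, eval_mul, eval_C]
      linear_combination hl
    have hvp : v (Sum.inr 0) = 0 := by
      have := congrArg (fun p : ℂ[X] => p.coeff (2 * n + 3)) h2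
      simp only [coeff_C_mul, coeff_comp_neg_X, hRA0, hlead] at this
      simpa [hone] using this.symm
    have hRA' : RA = 0 := by
      rw [hvp, mul_zero, C_0, zero_mul] at h2
      exact comp_neg_X_eq_zero_iff.mp h2
    have hv : tail v = 0 := by
      refine ih (tail z) ?_ (tail v) (Eventually.of_forall fun l => ?_)
        (Eventually.of_forall fun l => ?_)
      · simpa [tail_apply] using hz
      · rw [hRA, hRA', eval_zero]
      · rw [hRB, hRB', eval_zero]
    ext a
    rcases a with i | i <;> refine Fin.cases ?_ (fun j => ?_) i
    · exact hvq
    · exact congrFun hv (Sum.inl j)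
    · exact hvp
    · exact congrFun hv (Sum.inr j)

/-- The differentials `dA(λ)` and `dB(λ)` for almost all `λ` span the cotangent space. -/
theorem functional_eq_zero (n : ℕ) (z : Phase (n + 1))
    (hz : b.s (z (Sum.inl (Fin.last n))) ≠ 0) {f : Covector (n + 1) → ℂ} (hf : IsLinearMap ℂ f)
    (hA : ∀ᶠ l in cofinite, f (dA b n z l) = 0) (hB : ∀ᶠ l in cofinite, f (dB b n z l) = 0)
    (φ : Covector (n + 1)) : f φ = 0 := by
  obtain ⟨v, hv⟩ : ∃ v : Phase (n + 1), ∀ φ : Covector (n + 1), f φ = φ v := by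
    -- A functional on covectors is evaluation at the vector of its values on the coordinate
    -- covectors.
    refine ⟨fun a => f (dcoord a), fun φ => ?_⟩
    have : hf.mk' f = (ContinuousLinearMap.apply ℂ ℂ
        (fun a => f (dcoord a) : Phase (n + 1))).toLinearMap := covector_hom_ext fun a => rfl
    exact congrArg (fun g : Covector (n + 1) →ₗ[ℂ] ℂ => g φ) this
  simp only [hv] at hA hB
  rw [hv, eq_zero_of_dA_dB b n z hz v hA hB, map_zero]

theorem eventually_generic (l : ℂ) : ∀ᶠ m : ℂ in cofinite, (l - m) * (l + m) ≠ 0 := by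
  rw [eventually_cofinite]
  refine (Set.toFinite {l, -l}).subset fun m hm => ?_
  have hm : (l - m) * (l + m) = 0 := not_not.mp hm
  rcases mul_eq_zero.mp hm with h | h
  · exact Or.inl (sub_eq_zero.mp h).symm
  · exact Or.inr (eq_neg_of_add_eq_zero_right h)

/-- A bivector is determined by the brackets of `A(λ)` and `B(λ)`. -/
theorem bivector_ext (n : ℕ) (z : Phase (n + 1)) (hz : b.s (z (Sum.inl (Fin.last n))) ≠ 0)
    {M N : BivMatrix (n + 1)} (hM : M.transpose = -M) (hN : N.transpose = -N)
    (hAA : ∀ l m, (l - m) * (l + m) ≠ 0 →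
      form M (dA b n z l) (dA b n z m) = form N (dA b n z l) (dA b n z m))
    (hAB : ∀ l m, (l - m) * (l + m) ≠ 0 →
      form M (dA b n z l) (dB b n z m) = form N (dA b n z l) (dB b n z m))
    (hBB : ∀ l m, (l - m) * (l + m) ≠ 0 →
      form M (dB b n z l) (dB b n z m) = form N (dB b n z l) (dB b n z m)) : M = N := by
  have hBA : ∀ l m, (l - m) * (l + m) ≠ 0 →
      form M (dB b n z l) (dA b n z m) = form N (dB b n z l) (dA b n z m) := fun l m h => by
    rw [form_isSkew hM, form_isSkew hN, hAB m l fun h' => h (by linear_combination -h')]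
  -- The spanning property is used in the second argument first, with the first argument a fixed
  -- dA(λ) or dB(λ), and then in the first argument.
  have h1 : ∀ l φ, (form M - form N) (dA b n z l) φ = 0 := fun l =>
    functional_eq_zero b n z hz (LinearMap.isLinear _)
      ((eventually_generic l).mono fun m hm => sub_eq_zero.mpr (hAA l m hm))
      ((eventually_generic l).mono fun m hm => sub_eq_zero.mpr (hAB l m hm))
  have h2 : ∀ l φ, (form M - form N) (dB b n z l) φ = 0 := fun l =>
    functional_eq_zero b n z hz (LinearMap.isLinear _)
      ((eventually_generic l).mono fun m hm => sub_eq_zero.mpr (hBA l m hm))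
      ((eventually_generic l).mono fun m hm => sub_eq_zero.mpr (hBB l m hm))
  have h3 : ∀ ψ φ, (form M - form N).flip ψ φ = 0 := fun ψ =>
    functional_eq_zero b n z hz (LinearMap.isLinear _)
      (Eventually.of_forall fun l => h1 l ψ) (Eventually.of_forall fun l => h2 l ψ)
  ext a c
  have h := h3 (dcoord c) (dcoord a)
  rw [LinearMap.flip_apply, LinearMap.sub_apply, LinearMap.sub_apply, form_dcoord, form_dcoord]
    at h
  exact sub_eq_zero.mp h

/-! ### The Jacobi identity -/

variable {b} {P : ∀ n, Phase (n + 1) → BivMatrix (n + 1)}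

theorem differentiable_pencil (hd : ∀ n a c, Differentiable ℂ fun z => P n z a c) (c₀ c₁ : ℂ)
    (n : ℕ) (a c : Fin (n + 1) ⊕ Fin (n + 1)) :
    Differentiable ℂ fun z => pencil P c₀ c₁ n z a c :=
  (differentiable_const (c₀ * canonical (0 : Phase (n + 1)) a c)).add ((hd n a c).const_mul c₁)

/-- The relation for {A, A} holds at every point of phase space, so both sides may be
differentiated. -/
theorem smul_fderiv_bracket_AA (hP : IsSecondFamily b P)
    (hd : ∀ n a c, Differentiable ℂ fun z => P n z a c) (c₀ c₁ : ℂ) (n : ℕ) (z : Phase (n + 1))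
    (l m : ℂ) :
    (l + m) • fderiv ℂ (bracket (pencil P c₀ c₁ n) (cA b n l) (cA b n m)) z =
      ReflectionAlgebra.diffAA c₀ c₁ (fun l => cB b n l z) (fun l => cC b n l z) (dB b n z)
        (dC b n z) l m := by
  have hb := (hasFDerivAt_bracket (differentiable_pencil hd c₀ c₁ n) (differentiable_chain b n l).1
    (differentiable_chain b n m).1 z 0).1
  have hB := fun l => ((differentiable_chain b n l).2.1 z).hasFDerivAt
  have hC := fun l => ((differentiable_chain b n l).2.2 z).hasFDerivAt
  have h : (fun w => (l + m) * bracket (pencil P c₀ c₁ n) (cA b n l) (cA b n m) w) =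
      fun w => (c₀ + c₁ * m ^ 2) * (cB b n l w * cC b n m w)
        - (c₀ + c₁ * l ^ 2) * (cB b n m w * cC b n l w) := funext fun w => by
    have := (reflectionAlgebra hP c₀ c₁ n w).AA l m
    rw [← mul_assoc, ← mul_assoc, ← this]
    rfl
  have h2 := (((hB l).fun_mul (hC m)).const_mul (c₀ + c₁ * m ^ 2)).fun_sub
    (((hB m).fun_mul (hC l)).const_mul (c₀ + c₁ * l ^ 2))
  rw [← fderiv_const_mul hb, h, h2.fderiv]
  rfl

theorem smul_fderiv_bracket_AB (hP : IsSecondFamily b P)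
    (hd : ∀ n a c, Differentiable ℂ fun z => P n z a c) (c₀ c₁ : ℂ) (n : ℕ) (z : Phase (n + 1))
    (l m : ℂ) :
    ((l - m) * (l + m)) • fderiv ℂ (bracket (pencil P c₀ c₁ n) (cA b n l) (cB b n m)) z =
      ReflectionAlgebra.diffAB c₀ c₁ (cρ b n z) (fun l => cA b n l z) (fun l => cB b n l z)
        (dA b n z) (dB b n z) (dρ b n z) l m := by
  have hb := (hasFDerivAt_bracket (differentiable_pencil hd c₀ c₁ n) (differentiable_chain b n l).1
    (differentiable_chain b n m).2.1 z 0).1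
  have hA := fun l => ((differentiable_chain b n l).1 z).hasFDerivAt
  have hB := fun l => ((differentiable_chain b n l).2.1 z).hasFDerivAt
  have hr := hasFDerivAt_cρ b n z
  have h : (fun w => ((l - m) * (l + m)) *
      bracket (pencil P c₀ c₁ n) (cA b n l) (cB b n m) w) =
      fun w => (l + m) * ((c₀ + c₁ * l ^ 2) * (cA b n l w * cB b n m w)
          - (c₀ + c₁ * m ^ 2) * (cA b n m w * cB b n l w))
      + (l - m) * ((c₀ + c₁ * l ^ 2) * (cA b n l w * cB b n m w)
          + (c₀ + c₁ * m ^ 2) * (cA b n (-m) w * cB b n l w))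
      - (l - m) * (l + m) * (2 * c₁ * (cρ b n w * (cB b n l w * cB b n m w))) := funext fun w => by
    have := (reflectionAlgebra hP c₀ c₁ n w).AB l m
    refine Eq.trans ?_ (this.trans ?_)
    · rfl
    · ring
  have h2 := (((((hA l).fun_mul (hB m)).const_mul (c₀ + c₁ * l ^ 2)).fun_sub
    (((hA m).fun_mul (hB l)).const_mul (c₀ + c₁ * m ^ 2))).const_mul (l + m)).fun_add
    (((((hA l).fun_mul (hB m)).const_mul (c₀ + c₁ * l ^ 2)).fun_add
    (((hA (-m)).fun_mul (hB l)).const_mul (c₀ + c₁ * m ^ 2))).const_mul (l - m)) |>.fun_sub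
    ((((hr.fun_mul ((hB l).fun_mul (hB m))).const_mul (2 * c₁))).const_mul ((l - m) * (l + m)))
  rw [← fderiv_const_mul hb, h, h2.fderiv, ReflectionAlgebra.diffAB]
  simp only [dA, dB]
  module

theorem bracket_swap (hP : IsSecondFamily b P) (c₀ c₁ : ℂ) (n : ℕ) (f g : Phase (n + 1) → ℂ) :
    bracket (pencil P c₀ c₁ n) f g = -bracket (pencil P c₀ c₁ n) g f :=
  funext fun z => form_isSkew (pencil_skew hP c₀ c₁ n z) _ _

/-- On differentials of entries the jacobiator is the sum of nested brackets, which the quadratic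
relations evaluate. Triples containing C are not needed, since dA and dB will span. -/
theorem jacobiator_generic (hP : IsSecondFamily b P)
    (hd : ∀ n a c, Differentiable ℂ fun z => P n z a c) (c₀ c₁ : ℂ) (n : ℕ) (z : Phase (n + 1))
    {l m k : ℂ} (hlm : (l - m) * (l + m) ≠ 0) (hlk : (l - k) * (l + k) ≠ 0)
    (hmk : (m - k) * (m + k) ≠ 0) :
    jacobiator (pencil P c₀ c₁ n) z (dA b n z l) (dA b n z m) (dA b n z k) = 0 ∧
    jacobiator (pencil P c₀ c₁ n) z (dA b n z l) (dA b n z m) (dB b n z k) = 0 ∧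
    jacobiator (pencil P c₀ c₁ n) z (dA b n z l) (dB b n z m) (dB b n z k) = 0 ∧
    jacobiator (pencil P c₀ c₁ n) z (dB b n z l) (dB b n z m) (dB b n z k) = 0 := by
  have hp := differentiable_pencil hd c₀ c₁ n
  have hs := pencil_skew hP c₀ c₁ n
  have H := reflectionAlgebra hP c₀ c₁ n z
  have hA := fun l => (differentiable_chain b n l).1
  have hB := fun l => (differentiable_chain b n l).2.1
  have hr := fun l => form_pencil_dρ hP c₀ c₁ n z l
  have eBB : ∀ l m, bracket (pencil P c₀ c₁ n) (cB b n l) (cB b n m) = 0 := fun l m =>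
    funext fun w => (reflectionAlgebra hP c₀ c₁ n w).BB l m
  have eBA : ∀ l m, fderiv ℂ (bracket (pencil P c₀ c₁ n) (cB b n m) (cA b n l)) z =
      -fderiv ℂ (bracket (pencil P c₀ c₁ n) (cA b n l) (cB b n m)) z := fun l m => by
    rw [bracket_swap hP, fderiv_neg]
  have eAA := smul_fderiv_bracket_AA hP hd c₀ c₁ n z
  have eAB := smul_fderiv_bracket_AB hP hd c₀ c₁ n z
  refine ⟨?_, ?_, ?_, ?_⟩
  · refine (jacobi_eq_jacobiator hp hs (hA l) (hA m) (hA k) z).symm.trans ?_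
    exact H.jacobi_AAA hlm hmk hlk (eAA _ _) (eAA _ _) (eAA _ _)
  · refine (jacobi_eq_jacobiator hp hs (hA l) (hA m) (hB k) z).symm.trans ?_
    rw [eBA, map_neg, ← sub_eq_add_neg]
    exact H.jacobi_AAB (fun l => (hr l).1) hlm hmk hlk
      (eAB _ _) (eAB _ _) (eAA _ _)
  · refine (jacobi_eq_jacobiator hp hs (hA l) (hB m) (hB k) z).symm.trans ?_
    rw [eBA, eBB, fderiv_zero, map_neg, Pi.zero_apply, map_zero, zero_add]
    exact H.jacobi_ABB (form_isSkew (hs z)) (fun l => (hr l).2) hlm hmk hlk (eAB _ _) (eAB _ _)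
  · refine (jacobi_eq_jacobiator hp hs (hB l) (hB m) (hB k) z).symm.trans ?_
    simp only [eBB, fderiv_zero, Pi.zero_apply, map_zero, add_zero]

/-- The jacobiator is linear in each argument, and each is spanned separately. The generic
identities exclude equal or opposite parameters, hence the spanning statement for all but finitely
many λ. -/
theorem jacobiator_eq_zero (hP : IsSecondFamily b P)
    (hd : ∀ n a c, Differentiable ℂ fun z => P n z a c) (c₀ c₁ : ℂ) (n : ℕ) (z : Phase (n + 1))
    (hz : b.s (z (Sum.inl (Fin.last n))) ≠ 0) (α β γ : Covector (n + 1)) :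
    jacobiator (pencil P c₀ c₁ n) z α β γ = 0 := by
  have hp := differentiable_pencil hd c₀ c₁ n
  have lin := isLinearMap_jacobiator hp z
  have cyc := jacobiator_cycle (pencil P c₀ c₁ n) z
  have G := fun l m k => @jacobiator_generic b P hP hd c₀ c₁ n z l m k
  have g : ∀ l m : ℂ, (l - m) * (l + m) ≠ 0 → (m - l) * (m + l) ≠ 0 := fun l m h h' =>
    h (by linear_combination -h')
  have span := fun α β => functional_eq_zero b n z hz (lin α β)
  have evt : ∀ l m : ℂ, ∀ᶠ k in cofinite, (l - k) * (l + k) ≠ 0 ∧ (m - k) * (m + k) ≠ 0 :=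
    fun l m => (eventually_generic l).and (eventually_generic m)
  have hAA : ∀ l m γ, (l - m) * (l + m) ≠ 0 →
      jacobiator (pencil P c₀ c₁ n) z (dA b n z l) (dA b n z m) γ = 0 := fun l m γ h =>
    span _ _ ((evt l m).mono fun k hk => (G l m k h hk.1 hk.2).1)
      ((evt l m).mono fun k hk => (G l m k h hk.1 hk.2).2.1) γ
  have hAB : ∀ l m γ, (l - m) * (l + m) ≠ 0 →
      jacobiator (pencil P c₀ c₁ n) z (dA b n z l) (dB b n z m) γ = 0 := fun l m γ h =>
    span _ _ ((evt l m).mono fun k hk => by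
        rw [← cyc]; exact (G k l m (g _ _ hk.1) (g _ _ hk.2) h).2.1)
      ((evt l m).mono fun k hk => (G l m k h hk.1 hk.2).2.2.1) γ
  have hBA : ∀ l m γ, (l - m) * (l + m) ≠ 0 →
      jacobiator (pencil P c₀ c₁ n) z (dB b n z l) (dA b n z m) γ = 0 := fun l m γ h => by
    rw [jacobiator_swap (pencil_skew hP c₀ c₁ n), hAB m l γ (g _ _ h), neg_zero]
  have hBB : ∀ l m γ, (l - m) * (l + m) ≠ 0 →
      jacobiator (pencil P c₀ c₁ n) z (dB b n z l) (dB b n z m) γ = 0 := fun l m γ h =>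
    span _ _ ((evt l m).mono fun k hk => by
        rw [← cyc]; exact (G k l m (g _ _ hk.1) (g _ _ hk.2) h).2.2.1)
      ((evt l m).mono fun k hk => (G l m k h hk.1 hk.2).2.2.2) γ
  have hA : ∀ l β γ, jacobiator (pencil P c₀ c₁ n) z (dA b n z l) β γ = 0 := fun l β γ => by
    rw [← cyc]
    exact span _ _ ((eventually_generic l).mono fun m hm => by rw [cyc]; exact hAA l m γ hm)
      ((eventually_generic l).mono fun m hm => by rw [cyc]; exact hAB l m γ hm) β
  have hB : ∀ l β γ, jacobiator (pencil P c₀ c₁ n) z (dB b n z l) β γ = 0 := fun l β γ => by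
    rw [← cyc]
    exact span _ _ ((eventually_generic l).mono fun m hm => by rw [cyc]; exact hBA l m γ hm)
      ((eventually_generic l).mono fun m hm => by rw [cyc]; exact hBB l m γ hm) β
  rw [cyc]
  exact span _ _ (Eventually.of_forall fun l => by rw [← cyc]; exact hA l β γ)
    (Eventually.of_forall fun l => by rw [← cyc]; exact hB l β γ) α

theorem continuous_jacobiator {n : ℕ} {P : Phase n → BivMatrix n}
    (hP : ∀ a c, Differentiable ℂ fun z => P z a c) (α β γ : Covector n) :
    Continuous fun z => jacobiator P z α β γ := by
  have h1 : ∀ β γ : Covector n, Continuous fun z => fderiv ℂ (fun w => form (P w) β γ) z :=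
    fun β γ => (differentiable_fderiv (differentiable_form hP β γ)).continuous
  have h2 : ∀ α : Covector n, Continuous fun z => sharp (P z) α := fun α =>
    continuous_pi fun c => continuous_finsetSum _ fun a _ => (hP a c).continuous.mul_const _
  exact (((h1 β γ).clm_apply (h2 α)).add ((h1 γ α).clm_apply (h2 β))).add
    ((h1 α β).clm_apply (h2 γ))

/-- The pencil consists of Poisson brackets if the cotangent spaces are spanned almost
everywhere. -/
theorem isPoisson_pencil (hP : IsSecondFamily b P)
    (hd : ∀ n a c, Differentiable ℂ fun z => P n z a c) (hb : Dense {q : ℂ | b.s q ≠ 0})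
    (c₀ c₁ : ℂ) (n : ℕ) : IsPoisson (pencil P c₀ c₁ n) := by
  have hp := differentiable_pencil hd c₀ c₁ n
  refine isPoisson_of_jacobiator hp (pencil_skew hP c₀ c₁ n) fun z α β γ => ?_
  -- The jacobiator is continuous, so it also vanishes at the points where dA and dB need not span.
  have hden : Dense {z : Phase (n + 1) | b.s (z (Sum.inl (Fin.last n))) ≠ 0} :=
    hb.preimage (isOpenMap_eval (Sum.inl (Fin.last n)))
  have := Continuous.ext_on hden (continuous_jacobiator hp α β γ) continuous_const
    fun z hz => jacobiator_eq_zero hP hd c₀ c₁ n z hz α β γ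
  exact congrFun this z

end TodaReflection
end

open Polynomial

noncomputable section

namespace TodaReflection

open Filter Topology

/-! ### The quotients ρ₀ = 0 and ρ₁, from degrees and leading coefficients. -/

theorem rho_zero {A B : ℂ[X]} {d : ℕ} (hA : ∀ k, d < k → A.coeff k = 0) (hB : B.coeff d ≠ 0) :
    rho 0 A B = 0 := by
  have hne : X * B ≠ 0 := mul_ne_zero X_ne_zero fun h => hB (by rw [h, coeff_zero])
  rw [rho, mul_zero, pow_zero, one_mul, Polynomial.div_eq_zero_iff hne]
  have h1 : A.degree ≤ d := (degree_le_iff_coeff_zero _ _).mpr fun k hk =>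
    hA k (by exact_mod_cast hk)
  have h2 : ((d + 1 : ℕ) : WithBot ℕ) ≤ (X * B).degree :=
    le_degree_of_ne_zero (by rwa [coeff_X_mul])
  exact h1.trans_lt (lt_of_lt_of_le (by exact_mod_cast Nat.lt_succ_self d) h2)

theorem rho_one {A B : ℂ[X]} {d : ℕ} {r : ℂ} (hA : ∀ k, d < k → A.coeff k = 0)
    (hB : ∀ k, d + 1 < k → B.coeff k = 0) (hB0 : B.coeff (d + 1) ≠ 0)
    (h : A.coeff d = r * B.coeff (d + 1)) : rho 1 A B = C r := by
  have hne : X * B ≠ 0 := mul_ne_zero X_ne_zero fun h => hB0 (by rw [h, coeff_zero])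
  have hdeg : ((d + 2 : ℕ) : WithBot ℕ) ≤ (X * B).degree :=
    le_degree_of_ne_zero (by rwa [coeff_X_mul])
  -- The constant r cancels the top coefficient of X²A, so it is the quotient by uniqueness of
  -- division with remainder.
  have hR : (X ^ 2 * A - X * B * C r).degree < (X * B).degree := by
    refine lt_of_lt_of_le ((degree_lt_iff_coeff_zero _ _).mpr fun k hk => ?_) hdeg
    obtain ⟨k, rfl⟩ : ∃ j, k = j + 2 := ⟨k - 2, by omega⟩
    rw [coeff_sub, coeff_X_pow_mul, coeff_mul_C, coeff_X_mul]
    rcases eq_or_ne k d with rfl | hk'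
    · rw [h]; ring
    · rw [hA k (by omega), hB (k + 1) (by omega)]; ring
  have hdm := EuclideanDomain.div_add_mod (X ^ 2 * A) (X * B)
  have hm : (X ^ 2 * A % (X * B)).degree < (X * B).degree := EuclideanDomain.mod_lt _ hne
  by_contra hq
  have hq' : X ^ 2 * A / (X * B) - C r ≠ 0 := sub_ne_zero.mpr hq
  have h1 : X * B * (X ^ 2 * A / (X * B) - C r) =
      (X ^ 2 * A - X * B * C r) - X ^ 2 * A % (X * B) := by
    linear_combination hdm
  have h2 := degree_le_mul_left (X * B) hq'
  rw [h1] at h2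
  exact absurd (lt_of_le_of_lt (degree_sub_le _ _) (max_lt hR hm)) (not_lt.mpr h2)

/-- The matrix `T(λ)` with given entries `A`, `B`, `C`. -/
def reflectionMatrix (t : ℂ[X] × ℂ[X] × ℂ[X]) : Matrix (Fin 2) (Fin 2) ℂ[X] :=
  !![t.1, t.2.1; t.2.2, t.1.comp (-X)]

/-! ### Matrices T(λ) that agree with a chain near a point. -/

section Germ

variable {b : Boundary} {P : ∀ n, Phase (n + 1) → BivMatrix (n + 1)} {n : ℕ}
  {T : Phase (n + 1) → Matrix (Fin 2) (Fin 2) ℂ[X]} {z : Phase (n + 1)}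

theorem fderiv_entries (hT : ∀ᶠ w in 𝓝 z, T w = reflectionMatrix (chain b n w)) (l : ℂ) :
    fderiv ℂ (fA T l) z = dA b n z l ∧ fderiv ℂ (fB T l) z = dB b n z l ∧
      fderiv ℂ (fC T l) z = dC b n z l := by
  refine ⟨?_, ?_, ?_⟩ <;> refine EventuallyEq.fderiv_eq (hT.mono fun w hw => ?_)
  · simp [fA, hw, reflectionMatrix, cA]
  · simp [fB, hw, reflectionMatrix, cB]
  · simp [fC, hw, reflectionMatrix, cC]

theorem entries_eq (hT : T z = reflectionMatrix (chain b n z)) (l : ℂ) :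
    fA T l z = cA b n l z ∧ fB T l z = cB b n l z ∧ fC T l z = cC b n l z := by
  refine ⟨?_, ?_, ?_⟩
  · simp [fA, hT, reflectionMatrix, cA]
  · simp [fB, hT, reflectionMatrix, cB]
  · simp [fC, hT, reflectionMatrix, cC]

theorem isReflectionFormAt_of_chain (hT : ∀ᶠ w in 𝓝 z, T w = reflectionMatrix (chain b n w)) :
    IsReflectionFormAt T z := by
  refine ⟨fun l r s => ?_, by rw [hT.self_of_nhds]; rfl⟩
  have h := differentiable_chain b n
  have hev : (fun w => (T w r s).eval l) =ᶠ[𝓝 z]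
      fun w => (reflectionMatrix (chain b n w) r s).eval l := hT.mono fun w hw => by
    simp only [hw]
  refine DifferentiableAt.congr_of_eventuallyEq ?_ hev
  fin_cases r <;> fin_cases s
  · exact (h l).1 z
  · exact (h l).2.1 z
  · exact (h l).2.2 z
  · have : (fun w => (reflectionMatrix (chain b n w) 1 1).eval l) = cA b n (-l) :=
      funext fun w => by simp [reflectionMatrix, cA]
    exact this ▸ (h (-l)).1 z

theorem fρ_eq (hT : T z = reflectionMatrix (chain b n z)) (l : ℂ) :
    fρ 0 T l z = 0 ∧ fρ 1 T l z = cρ b n z := by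
  have h := chainCoeffs b n z
  have hone : ((-1 : ℂ)) ^ (n + 1) ≠ 0 := pow_ne_zero _ (neg_ne_zero.mpr one_ne_zero)
  have e1 : T z 0 0 = (chain b n z).1 := by rw [hT]; rfl
  have e2 : T z 0 1 = (chain b n z).2.1 := by rw [hT]; rfl
  constructor
  · rw [fρ, e1, e2, rho_zero (d := 2 * n + 3) (fun k hk => h.A_high k (by omega))
      (by rwa [h.B_lead]), eval_zero]
  · rw [fρ, e1, e2, rho_one (d := 2 * n + 2) (r := cρ b n z) h.A_high h.B_high
      (by rwa [h.B_lead]) (by rw [h.A_lead, h.B_lead, mul_comm]), eval_C]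

/-- `hk`, `hc` and `hρ` pick the member of the pencil that corresponds to k, so k = 0 and k = 1
share one proof. -/
theorem satisfiesBracket_pencil (hP : IsSecondFamily b P)
    (hT : ∀ᶠ w in 𝓝 z, T w = reflectionMatrix (chain b n w)) {k : ℕ} {c₀ c₁ : ℂ}
    (hk : ∀ l : ℂ, l ^ (2 * k) = c₀ + c₁ * l ^ 2) (hc : (k : ℂ) = c₁)
    (hρ : ∀ l, fρ k T l z = c₁ * cρ b n z) :
    SatisfiesBracket 1 k T (pencil P c₀ c₁ n z) z := by
  have H := reflectionAlgebra hP c₀ c₁ n z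
  have e := fun l => entries_eq hT.self_of_nhds l
  have d := fun l => fderiv_entries hT l
  have hne : ∀ {l m : ℂ}, l ≠ m → l ≠ -m → l - m ≠ 0 ∧ l + m ≠ 0 := fun h h' =>
    ⟨sub_ne_zero.mpr h, fun h0 => h' (eq_neg_of_add_eq_zero_left h0)⟩
  constructor
  · intro l m
    rw [bracketAt_eq_form, (d l).2.1, (d m).2.1, H.BB]
  · intro l m h h'
    obtain ⟨h1, h2⟩ := hne h h'
    refine mul_left_cancel₀ h2 ?_
    simp only [bracketAt_eq_form, (d _).1, (e _).2.1, (e _).2.2, hk]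
    rw [H.AA]
    field_simp
  · intro l m
    simp only [bracketAt_eq_form, (d _).2.2, (e _).1, (e _).2.2, hρ]
    rw [H.CC]
    ring
  · intro l m h h'
    obtain ⟨h1, h2⟩ := hne h h'
    refine mul_left_cancel₀ (mul_ne_zero h1 h2) ?_
    simp only [bracketAt_eq_form, (d _).1, (d _).2.1, (e _).1, (e _).2.1, hk, hρ]
    rw [H.AB]
    field_simp
  · intro l m h h'
    obtain ⟨h1, h2⟩ := hne h h'
    refine mul_left_cancel₀ (mul_ne_zero h1 h2) ?_
    simp only [bracketAt_eq_form, (d _).1, (d _).2.2, (e _).1, (e _).2.1, (e _).2.2, hk, hρ, hc]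
    rw [H.AC]
    field_simp
  · intro l m h h'
    obtain ⟨h1, h2⟩ := hne h h'
    refine mul_left_cancel₀ (mul_ne_zero h1 h2) ?_
    simp only [bracketAt_eq_form, (d _).2.1, (d _).2.2, (e _).1, (e _).2.1, hk, hρ]
    rw [H.BC]
    field_simp

/-- The right-hand sides do not involve the bivector, so two solutions give the same brackets {A,
A}, {A, B}, {B, B}, and these already determine it. -/
theorem satisfiesBracket_unique (hz : b.s (z (Sum.inl (Fin.last n))) ≠ 0)
    (hT : ∀ᶠ w in 𝓝 z, T w = reflectionMatrix (chain b n w)) {k : ℕ} {M N : BivMatrix (n + 1)}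
    (hM : M.transpose = -M) (hN : N.transpose = -N) (h : SatisfiesBracket 1 k T M z)
    (h' : SatisfiesBracket 1 k T N z) : M = N := by
  have d := fun l => fderiv_entries hT l
  have hne : ∀ {l m : ℂ}, (l - m) * (l + m) ≠ 0 → l ≠ m ∧ l ≠ -m := fun h =>
    ⟨fun e => h (by rw [e]; ring), fun e => h (by rw [e]; ring)⟩
  refine bivector_ext b n z hz hM hN (fun l m hlm => ?_) (fun l m hlm => ?_) (fun l m hlm => ?_)
  · have := (h.AA l m (hne hlm).1 (hne hlm).2).trans (h'.AA l m (hne hlm).1 (hne hlm).2).symm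
    rwa [bracketAt_eq_form, bracketAt_eq_form, (d l).1, (d m).1] at this
  · have := (h.AB l m (hne hlm).1 (hne hlm).2).trans (h'.AB l m (hne hlm).1 (hne hlm).2).symm
    rwa [bracketAt_eq_form, bracketAt_eq_form, (d l).1, (d m).2.1] at this
  · have := (h.BB l m).trans (h'.BB l m).symm
    rwa [bracketAt_eq_form, bracketAt_eq_form, (d l).2.1, (d m).2.1] at this

theorem satisfiesBracket_iff (hP : IsSecondFamily b P)
    (hz : b.s (z (Sum.inl (Fin.last n))) ≠ 0)
    (hT : ∀ᶠ w in 𝓝 z, T w = reflectionMatrix (chain b n w)) {M : BivMatrix (n + 1)}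
    (hM : M.transpose = -M) :
    (SatisfiesBracket 1 0 T M z ↔ M = canonical z) ∧
      (SatisfiesBracket 1 1 T M z ↔ M = P n z) := by
  have h0 : SatisfiesBracket 1 0 T (canonical z) z := by
    have := satisfiesBracket_pencil hP hT (k := 0) (c₀ := 1) (c₁ := 0) (by simp) (by simp)
      fun l => by rw [(fρ_eq hT.self_of_nhds l).1, zero_mul]
    rwa [pencil, one_smul, zero_smul, add_zero] at this
  have h1 : SatisfiesBracket 1 1 T (P n z) z := by
    have := satisfiesBracket_pencil hP hT (k := 1) (c₀ := 0) (c₁ := 1) (by simp) (by simp)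
      fun l => by rw [(fρ_eq hT.self_of_nhds l).2, one_mul]
    rwa [pencil, one_smul, zero_smul, zero_add] at this
  exact ⟨⟨fun h => satisfiesBracket_unique hz hT hM (canonical_isSkew z) h h0, fun h => h ▸ h0⟩,
    ⟨fun h => satisfiesBracket_unique hz hT hM (hP.skew n z) h h1, fun h => h ▸ h1⟩⟩

end Germ

/-! ### The integrals -/

/-- The integrals of a chain of `n + 1` sites as entire functions. -/
def chainIntegral (b : Boundary) (n i : ℕ) (z : Phase (n + 1)) : ℂ :=
  (-1) ^ (n + 1) * (chain b n z).2.1.coeff (2 * (n + 1 - i) + 1)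

theorem differentiable_chainIntegral (b : Boundary) (n i : ℕ) :
    Differentiable ℂ (chainIntegral b n i) :=
  ((coeffDifferentiable_chain b n).2.1 _).const_mul _

theorem trace_Kplus_mul (t : ℂ[X] × ℂ[X] × ℂ[X]) :
    Matrix.trace (Kplus * reflectionMatrix t) = t.2.1 := by
  simp [Kplus, reflectionMatrix, Matrix.trace_fin_two]

theorem integralOf_eq {b : Boundary} {n : ℕ} {T : Phase (n + 1) → Matrix (Fin 2) (Fin 2) ℂ[X]}
    {z : Phase (n + 1)} (hT : T z = reflectionMatrix (chain b n z)) (i : ℕ) :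
    integralOf T i z = chainIntegral b n i z := by
  rw [integralOf, hT, trace_Kplus_mul, chainIntegral]

theorem chainIntegral_one (b : Boundary) (n : ℕ) (z : Phase (n + 1)) :
    chainIntegral b n 1 z = -cH b n z := by
  have h : ((-1 : ℂ)) ^ (n + 1) * (-1) ^ (n + 1) = 1 := by
    rw [← mul_pow]; norm_num
  rw [chainIntegral, Nat.add_sub_cancel, (chainCoeffs b n z).B_next]
  linear_combination (-cH b n z) * h

theorem sum_range_two_mul {M : Type*} [AddCommMonoid M] (f : ℕ → M) (n : ℕ) :
    ∑ k ∈ Finset.range (2 * n), f k = ∑ k ∈ Finset.range n, (f (2 * k) + f (2 * k + 1)) := by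
  induction n with
  | zero => simp
  | succ n ih =>
    rw [Finset.sum_range_succ, ← ih, Nat.mul_succ, Finset.sum_range_succ, Finset.sum_range_succ,
      add_assoc]

theorem generatesIntegralsAt_of_chain {b : Boundary} {n : ℕ}
    {T : Phase (n + 1) → Matrix (Fin 2) (Fin 2) ℂ[X]} {z : Phase (n + 1)}
    (hT : T z = reflectionMatrix (chain b n z)) : GeneratesIntegralsAt T z := by
  have hc := chainCoeffs b n z
  have h : ((-1 : ℂ[X])) ^ (n + 1) * (-1) ^ (n + 1) = 1 := by
    rw [← mul_pow]; norm_num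
  -- An even bound lets the coefficients be summed in pairs, in which the even ones vanish because B
  -- is odd.
  have hd : (chain b n z).2.1.natDegree < 2 * (n + 2) :=
    lt_of_le_of_lt (natDegree_le_iff_coeff_eq_zero.mpr hc.B_high) (by omega)
  have hsum : ∑ i ∈ Finset.Icc 1 (n + 1), C (integralOf T i z) * X ^ (2 * (n + 1 - i) + 1) =
      ∑ k ∈ Finset.range (n + 1),
        (-1) ^ (n + 1) * (C ((chain b n z).2.1.coeff (2 * k + 1)) * X ^ (2 * k + 1)) := by
    refine Finset.sum_nbij' (fun i => n + 1 - i) (fun k => n + 1 - k) ?_ ?_ ?_ ?_ ?_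
    · intro i hi
      simp only [Finset.mem_Icc, Finset.mem_range] at *
      omega
    · intro i hi
      simp only [Finset.mem_Icc, Finset.mem_range] at *
      omega
    · intro i hi
      simp only [Finset.mem_Icc] at *
      omega
    · intro i hi
      simp only [Finset.mem_range] at *
      omega
    · intro i _
      rw [integralOf_eq hT, chainIntegral, C_mul, C_pow, C_neg, C_1, mul_assoc]
  rw [GeneratesIntegralsAt, hT, trace_Kplus_mul, hsum, ← Finset.mul_sum, mul_add, ← mul_assoc, h,
    one_mul]
  conv_lhs => rw [(chain b n z).2.1.as_sum_range_C_mul_X_pow' hd, sum_range_two_mul]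
  rw [Finset.sum_range_succ, add_comm]
  congr 1
  · rw [show 2 * (n + 1) + 1 = 2 * n + 3 by ring, hc.B_lead, hc.B_even, C_0, zero_mul, zero_add,
      C_pow, C_neg, C_1]
  · refine Finset.sum_congr rfl fun k _ => ?_
    rw [hc.B_even, C_0, zero_mul, zero_add]

theorem eq_zero_of_sum_pow {K : ℕ} {c : ℕ → ℂ}
    (h : ∀ l : ℂ, ∑ k ∈ Finset.range K, l ^ k * c k = 0) {k : ℕ} (hk : k < K) : c k = 0 := by
  have : ∑ k ∈ Finset.range K, C (c k) * X ^ k = (0 : ℂ[X]) := Polynomial.funext fun l => by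
    rw [eval_finsetSum, eval_zero, ← h l]
    exact Finset.sum_congr rfl fun k _ => by
      rw [eval_mul, eval_C, eval_pow, eval_X, mul_comm]
  have h2 := congrArg (fun p : ℂ[X] => p.coeff k) this
  simpa [coeff_C_mul, coeff_X_pow, hk] using h2

/-- {B(λ), B(μ)} is a polynomial in λ and μ whose coefficients are the brackets of the coefficients
of B. It vanishes identically; coefficients are compared in μ and then in λ. -/
theorem bracket_coeff_B {b : Boundary} {n : ℕ} {M : BivMatrix (n + 1)} {z : Phase (n + 1)}
    (h : ∀ l m, form M (dB b n z l) (dB b n z m) = 0) {i j : ℕ} (hi : i ≤ 2 * n + 3)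
    (hj : j ≤ 2 * n + 3) :
    form M (fderiv ℂ (fun w => (chain b n w).2.1.coeff i) z)
      (fderiv ℂ (fun w => (chain b n w).2.1.coeff j) z) = 0 := by
  set D : ℕ → Covector (n + 1) := fun k => fderiv ℂ (fun w => (chain b n w).2.1.coeff k) z with hD
  have hdB : ∀ l, dB b n z l = ∑ k ∈ Finset.range (2 * n + 3 + 1), l ^ k • D k := fun l => by
    ext v
    have := (coeffDifferentiable_chain b n).2.1.fderiv_eval
      (fun z => (chainCoeffs b n z).B_high) l z v
    refine this.trans ?_
    rw [CoeffDifferentiable.dirDeriv, eval_finsetSum, sum_apply]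
    exact Finset.sum_congr rfl fun k _ => by
      rw [eval_mul, eval_C, eval_pow, eval_X, smul_apply, smul_eq_mul, mul_comm]
  simp only [hdB, map_sum, map_smul, LinearMap.sum_apply, LinearMap.smul_apply, smul_eq_mul] at h
  refine eq_zero_of_sum_pow (K := 2 * n + 3 + 1) (c := fun k => form M (D k) (D j)) (fun l => ?_)
    (by omega)
  refine eq_zero_of_sum_pow (K := 2 * n + 3 + 1)
    (c := fun k' => ∑ k ∈ Finset.range (2 * n + 3 + 1), l ^ k * form M (D k) (D k'))
    (fun m => ?_) (by omega)
  exact h l m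

theorem bracket_chainIntegral {b : Boundary} {P : ∀ n, Phase (n + 1) → BivMatrix (n + 1)}
    (hP : IsSecondFamily b P) (n i j : ℕ) (z : Phase (n + 1)) :
    bracket canonical (chainIntegral b n i) (chainIntegral b n j) z = 0 ∧
      bracket (P n) (chainIntegral b n i) (chainIntegral b n j) z = 0 := by
  have hd : ∀ i, fderiv ℂ (chainIntegral b n i) z = (-1 : ℂ) ^ (n + 1) •
      fderiv ℂ (fun w => (chain b n w).2.1.coeff (2 * (n + 1 - i) + 1)) z := fun i =>
    fderiv_const_mul ((coeffDifferentiable_chain b n).2.1 _ z) _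
  have key : ∀ M : BivMatrix (n + 1), (∀ l m, form M (dB b n z l) (dB b n z m) = 0) →
      bracketAt M (chainIntegral b n i) (chainIntegral b n j) z = 0 := fun M hM => by
    rw [bracketAt_eq_form, hd, hd, map_smul, map_smul, LinearMap.smul_apply,
      bracket_coeff_B hM (by omega) (by omega), smul_zero, smul_zero]
  refine ⟨key _ fun l m => ?_, key _ fun l m => ?_⟩
  · have := (reflectionAlgebra hP 1 0 n z).BB l m
    rwa [pencil, one_smul, zero_smul, add_zero] at this
  · have := (reflectionAlgebra hP 0 1 n z).BB l m
    rwa [pencil, one_smul, zero_smul, zero_add] at this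

end TodaReflection
end

open Polynomial

noncomputable section

namespace TodaReflection

open Filter Topology

/-! ### The two boundaries -/

theorem hasDerivAt_exp_neg (q : ℂ) :
    HasDerivAt (fun q : ℂ => Complex.exp (-q)) (-Complex.exp (-q)) q := by
  simpa using (hasDerivAt_neg q).cexp

/-- The boundary of the `BCₙ` lattice. -/
def boundaryBC (a₀ a₁ : ℂ) : Boundary where
  a₀ := a₀
  ρ q := Complex.exp (-q)
  s q := Complex.exp (-q)
  V q := 2 * a₀ * Complex.exp q + a₁ ^ 2 * Complex.exp (2 * q)
  W q := 2 * a₀ * Complex.exp q + 2 * a₁ ^ 2 * Complex.exp (2 * q)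
  hρ := hasDerivAt_exp_neg
  hs := hasDerivAt_exp_neg
  hV q := by
    have h := (((hasDerivAt_id q).const_mul 2).cexp.const_mul (a₁ ^ 2))
    refine (((Complex.hasDerivAt_exp q).const_mul (2 * a₀)).add h).congr_deriv ?_
    simp only [id_eq]
    ring
  hW q := by
    have h := exp_mul_exp_neg q
    linear_combination (-2 * a₀) * h

/-- The boundary of the `Dₙ` lattice. -/
def boundaryD (a₂ : ℂ) : Boundary where
  a₀ := 0
  -- For a₂ ≠ 0 and q = qₙ these are ρ = -2 a₂ cosh u and s = 2 a₂ sinh u, so s vanishes exactly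
  -- where the change of variables is singular.
  ρ q := Complex.exp (-q) + a₂ ^ 2 * Complex.exp q
  s q := Complex.exp (-q) - a₂ ^ 2 * Complex.exp q
  V _ := 0
  W _ := 0
  hρ q := ((hasDerivAt_exp_neg q).add ((Complex.hasDerivAt_exp q).const_mul _)).congr_deriv
    (by ring)
  hs q := ((hasDerivAt_exp_neg q).sub ((Complex.hasDerivAt_exp q).const_mul _)).congr_deriv
    (by ring)
  hV q := hasDerivAt_const q 0
  hW q := by simp

theorem dense_boundaryBC (a₀ a₁ : ℂ) : Dense {q | (boundaryBC a₀ a₁).s q ≠ 0} := by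
  simp [boundaryBC, Complex.exp_ne_zero]

/-- At a zero of s its derivative -ρ equals -2 e^(-q) ≠ 0, so zeros are isolated. -/
theorem dense_boundaryD (a₂ : ℂ) : Dense {q | (boundaryD a₂).s q ≠ 0} := by
  intro q
  by_cases hq : (boundaryD a₂).s q = 0
  · have hρ : -(boundaryD a₂).ρ q ≠ 0 := by
      have h : Complex.exp (-q) - a₂ ^ 2 * Complex.exp q = 0 := hq
      have h2 : -(Complex.exp (-q) + a₂ ^ 2 * Complex.exp q) = -2 * Complex.exp (-q) := by
        linear_combination h
      exact h2 ▸ mul_ne_zero (by norm_num) (Complex.exp_ne_zero _)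
    rw [mem_closure_iff_frequently]
    exact (((boundaryD a₂).hs q).eventually_ne hρ).frequently.filter_mono nhdsWithin_le_nhds
  · exact subset_closure hq

/-! ### Recursion for `T(λ)` -/

/-- det L(λ) = 1, so the inverse is again polynomial. -/
theorem siteL_neg_inv (q p : ℂ) :
    ((siteL q p).map fun f => f.comp (-X))⁻¹ =
      !![0, C (Complex.exp q); -C (Complex.exp (-q)), -X - C p] := by
  have h : C (Complex.exp q) * C (Complex.exp (-q)) = 1 := by
    rw [← C_mul, exp_mul_exp_neg, C_1]
  refine Matrix.inv_eq_right_inv ?_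
  ext i j : 2
  fin_cases i <;> fin_cases j <;> simp [siteL, Matrix.mul_apply, h, mul_comm (C (Complex.exp (-q)))]
  ring

theorem qc_tail {n i : ℕ} (hi : 1 ≤ i) (z : Phase (n + 1)) : qc (tail z) i = qc z (i + 1) := by
  obtain ⟨i, rfl⟩ : ∃ k, i = k + 1 := ⟨i - 1, by omega⟩
  simp only [qc, Nat.add_sub_cancel]
  by_cases h : i < n
  · rw [dif_pos h, dif_pos (by omega)]; rfl
  · rw [dif_neg h, dif_neg (by omega)]

theorem pc_tail {n i : ℕ} (hi : 1 ≤ i) (z : Phase (n + 1)) : pc (tail z) i = pc z (i + 1) := by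
  obtain ⟨i, rfl⟩ : ∃ k, i = k + 1 := ⟨i - 1, by omega⟩
  simp only [pc, Nat.add_sub_cancel]
  by_cases h : i < n
  · rw [dif_pos h, dif_pos (by omega)]; rfl
  · rw [dif_neg h, dif_neg (by omega)]

theorem E_tail {n i : ℕ} (hi : 1 ≤ i) (z : Phase (n + 1)) : E (tail z) i = E z (i + 1) := by
  rw [E, E, qc_tail hi, qc_tail (by omega)]

theorem todaT_succ {n : ℕ} (a₀ a₁ a₂ : ℂ) (z : Phase (n + 2)) :
    todaT a₀ a₁ a₂ z = siteL (z (Sum.inl 0)) (z (Sum.inr 0)) * todaT a₀ a₁ a₂ (tail z) *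
      !![0, C (Complex.exp (z (Sum.inl 0))); -C (Complex.exp (-z (Sum.inl 0))),
        -X - C (z (Sum.inr 0))] := by
  rw [todaT, todaT, List.ofFn_succ (n := n + 1), List.ofFn_succ (n := n + 1), List.prod_cons,
    List.prod_cons, Matrix.mul_inv_rev, siteL_neg_inv, qc_tail (by omega)]
  simp only [Matrix.mul_assoc]
  rfl

theorem todaT_one (a₀ a₁ a₂ : ℂ) (z : Phase 1) :
    todaT a₀ a₁ a₂ z = siteL (z (Sum.inl 0)) (z (Sum.inr 0)) *
      boundaryK a₀ a₁ a₂ (z (Sum.inl 0)) *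
      !![0, C (Complex.exp (z (Sum.inl 0))); -C (Complex.exp (-z (Sum.inl 0))),
        -X - C (z (Sum.inr 0))] := by
  rw [todaT, List.ofFn_succ, List.ofFn_succ, List.prod_cons, List.prod_cons,
    List.ofFn_zero, List.ofFn_zero, List.prod_nil, mul_one, mul_one, siteL_neg_inv]
  rfl

/-- Because B is odd, the form with lower right entry A(-λ) reproduces itself when a site is added.
-/
theorem siteL_mul_reflectionMatrix (q p : ℂ) (t : ℂ[X] × ℂ[X] × ℂ[X])
    (ht : t.2.1.comp (-X) = -t.2.1) :
    siteL q p * reflectionMatrix t *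
      !![0, C (Complex.exp q); -C (Complex.exp (-q)), -X - C p] =
      reflectionMatrix (dressPoly q p t) := by
  have h := exp_mul_exp_neg q
  have ht' := fun l : ℂ => congrArg (fun f : ℂ[X] => f.eval l) ht
  simp only [eval_comp, eval_neg, eval_X] at ht'
  refine Matrix.ext fun i j => Polynomial.funext fun l => ?_
  fin_cases i <;> fin_cases j <;>
    simp [siteL, reflectionMatrix, dressPoly, Matrix.mul_apply, ht']
  · linear_combination (t.1.eval (-l)) * h
  · linear_combination ((l ^ 2 - p ^ 2) * t.2.1.eval l) * h
  · ring
  · linear_combination (t.1.eval l) * h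

theorem todaT_eq_of_tail {b : Boundary} {n : ℕ} {a₀ a₁ a₂ : ℂ} {z w : Phase (n + 2)}
    (hq : w (Sum.inl 0) = z (Sum.inl 0)) (hp : w (Sum.inr 0) = z (Sum.inr 0))
    (h : todaT a₀ a₁ a₂ (tail w) = reflectionMatrix (chain b n (tail z))) :
    todaT a₀ a₁ a₂ w = reflectionMatrix (chain b (n + 1) z) := by
  rw [todaT_succ, h, hq, hp, siteL_mul_reflectionMatrix _ _ _ (chain_comp_neg_X b n _)]
  rfl

/-- The hypotheses compare coefficients of powers of λ in the one-site matrix. The factor k is that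
of the upper right entry of K₋; w holds the substituted coordinates and z the new ones. -/
theorem todaT_one_eq {b : Boundary} {a₀ a₁ a₂ : ℂ} {z w : Phase 1} {x y k : ℂ}
    (hx : Complex.exp (w (Sum.inl 0)) = x) (hy : Complex.exp (-w (Sum.inl 0)) = y)
    (hk : 4 * a₂ * x + 1 = k) (h₀ : b.a₀ = a₀)
    (h₁ : y * (k * w (Sum.inr 0)) = -(Complex.I * a₁) +
      z (Sum.inr 0) * b.s (z (Sum.inl 0)))
    (hρ : b.ρ (z (Sum.inl 0)) = y * k - 2 * a₂)
    (hV : z (Sum.inr 0) ^ 2 + b.V (z (Sum.inl 0)) =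
      k * w (Sum.inr 0) ^ 2 + 2 * x * (Complex.I * a₁ * w (Sum.inr 0) + a₀))
    (hs : b.s (z (Sum.inl 0)) ^ 2 = y ^ 2 * k) :
    todaT a₀ a₁ a₂ w = reflectionMatrix (chain b 0 z) := by
  have hxy : x * y = 1 := by rw [← hx, ← hy, exp_mul_exp_neg]
  rw [todaT_one]
  refine Matrix.ext fun i j => Polynomial.funext fun l => ?_
  generalize w (Sum.inr 0) = p at *
  generalize w (Sum.inl 0) = q at *
  fin_cases i <;> fin_cases j <;>
    simp [siteL, boundaryK, reflectionMatrix, chain, Matrix.mul_apply, hx, hy, hk, h₀, hρ, hV,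
      hs]
  · linear_combination (2 * a₂ * l ^ 2 + Complex.I * a₁ * l + a₀) * hxy + l * h₁
  · linear_combination l ^ 3 * hk
  · ring
  · linear_combination (2 * a₂ * l ^ 2 - Complex.I * a₁ * l + a₀) * hxy - l * h₁

theorem changeBC_tail {n : ℕ} (a₁ : ℂ) (z : Phase (n + 1)) :
    tail (changeBC a₁ z) = changeBC a₁ (tail z) := by
  ext a
  rcases a with i | i
  · rfl
  · simp [tail_apply, changeBC]

theorem laxBC_eq (a₀ a₁ : ℂ) {n : ℕ} (z : Phase (n + 1)) :
    laxBC a₀ a₁ z = reflectionMatrix (chain (boundaryBC a₀ a₁) n z) := by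
  induction n with
  | zero =>
    have hxy := exp_mul_exp_neg (z (Sum.inl 0))
    have hI := Complex.I_sq
    -- The shift of pₙ removes the linear term in a₁ and completes a square, which leaves a₁²
    -- e^(2qₙ) in the potential.
    refine todaT_one_eq (k := 1) rfl rfl (by ring) rfl ?_ ?_ ?_ ?_ <;>
      simp only [boundaryBC, changeBC, Fin.val_zero, zero_add, if_true, two_mul (z _),
        Complex.exp_add]
    · linear_combination (-Complex.I * a₁) * hxy
    · ring
    · linear_combination (a₁ ^ 2 * Complex.exp (z (Sum.inl 0)) ^ 2) * hI
    · ring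
  | succ n ih =>
    exact todaT_eq_of_tail rfl (by simp [changeBC]) (by rw [changeBC_tail]; exact ih (tail z))

theorem exp_shifted {n : ℕ} {a₂ : ℂ} (ha : a₂ ≠ 0) (z : Phase n) :
    Complex.exp (shifted a₂ z) = -a₂ * Complex.exp (qc z n) := by
  rw [shifted, Complex.exp_add, Complex.exp_log (neg_ne_zero.mpr ha), mul_comm]

theorem two_mul_sinh_shifted {n : ℕ} {a₂ : ℂ} (ha : a₂ ≠ 0) (z : Phase n) :
    2 * a₂ * Complex.sinh (shifted a₂ z) = (boundaryD a₂).s (qc z n) := by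
  have h : Complex.exp (-shifted a₂ z) = -(Complex.exp (-qc z n) / a₂) := by
    rw [Complex.exp_neg, exp_shifted ha, Complex.exp_neg]
    have := Complex.exp_ne_zero (qc z n)
    field_simp
  rw [Complex.sinh, h, exp_shifted ha, boundaryD]
  field_simp
  ring

theorem two_mul_cosh_shifted {n : ℕ} {a₂ : ℂ} (ha : a₂ ≠ 0) (z : Phase n) :
    -2 * a₂ * Complex.cosh (shifted a₂ z) = (boundaryD a₂).ρ (qc z n) := by
  have h : Complex.exp (-shifted a₂ z) = -(Complex.exp (-qc z n) / a₂) := by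
    rw [Complex.exp_neg, exp_shifted ha, Complex.exp_neg]
    have := Complex.exp_ne_zero (qc z n)
    field_simp
  rw [Complex.cosh, h, exp_shifted ha, boundaryD]
  field_simp
  ring

theorem cosh_add_one_ne_zero {u : ℂ} (hu : Complex.sinh u ≠ 0) : Complex.cosh u + 1 ≠ 0 := by
  intro h
  have h2 := Complex.cosh_sq u
  exact hu (pow_eq_zero_iff two_ne_zero |>.mp (by linear_combination (Complex.cosh u - 1) * h - h2))

theorem shifted_tail {n : ℕ} (a₂ : ℂ) (z : Phase (n + 2)) : shifted a₂ (tail z) = shifted a₂ z := by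
  rw [shifted, shifted, qc_tail (by omega)]

theorem changeD_tail {n : ℕ} (a₂ : ℂ) (z : Phase (n + 2)) :
    tail (changeD a₂ z) = changeD a₂ (tail z) := by
  ext a
  rcases a with i | i <;> simp [tail_apply, changeD, shifted_tail]

theorem laxD_eq {a₂ : ℂ} (ha : a₂ ≠ 0) {n : ℕ} (z : Phase (n + 1))
    (hz : Complex.sinh (shifted a₂ z) ≠ 0) :
    laxD a₂ z = reflectionMatrix (chain (boundaryD a₂) n z) := by
  induction n with
  | zero =>
    have hs := two_mul_sinh_shifted ha z
    have hc := two_mul_cosh_shifted ha z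
    have hsq := Complex.cosh_sq (shifted a₂ z)
    have h1 := cosh_add_one_ne_zero hz
    have e : z (Sum.inl 0) = qc z 1 := rfl
    have hy : -2 * a₂ * (Complex.cosh (shifted a₂ z) + 1) ≠ 0 :=
      mul_ne_zero (mul_ne_zero (by norm_num) ha) h1
    simp only [zero_add] at hs hc
    -- The substitution makes e^(-qₙ) equal to y = -2 a₂(cosh u + 1), so k = 4 a₂/y + 1 = (cosh u -
    -- 1)/(cosh u + 1). The rest is cosh² u - sinh² u = 1. Only exp of log occurs, so the branch of
    -- the logarithm plays no role.
    refine todaT_one_eq (z := z) (x := (-2 * a₂ * (Complex.cosh (shifted a₂ z) + 1))⁻¹)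
      (y := -2 * a₂ * (Complex.cosh (shifted a₂ z) + 1))
      (k := (Complex.cosh (shifted a₂ z) - 1) / (Complex.cosh (shifted a₂ z) + 1))
      ?_ ?_ ?_ rfl ?_ ?_ ?_ ?_
    · simp only [changeD, Fin.val_zero, zero_add, if_true, Complex.exp_neg, Complex.exp_log hy]
    · simp only [changeD, Fin.val_zero, zero_add, if_true, neg_neg, Complex.exp_log hy]
    · field_simp
      ring
    · rw [e, ← hs]
      simp only [changeD, Fin.val_zero, zero_add, if_true]
      field_simp
      linear_combination (2 * a₂ * z (Sum.inr 0)) * hsq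
    · rw [e, ← hc]
      field_simp
      ring
    · simp only [changeD, Fin.val_zero, zero_add, if_true, boundaryD, mul_zero, zero_mul, add_zero]
      field_simp
      linear_combination (-z (Sum.inr 0) ^ 2) * hsq
    · rw [e, ← hs]
      field_simp
      linear_combination (-1) * hsq
  | succ n ih =>
    refine todaT_eq_of_tail (by simp [changeD]) (by simp [changeD]) ?_
    rw [changeD_tail]
    exact ih (tail z) (by rwa [shifted_tail])

end TodaReflection
end

open Polynomial

noncomputable section

namespace TodaReflection

open Filter Topology

/-! ### Components of the differentials -/

theorem form_canonical_dcoord {n : ℕ} (z : Phase n) (φ : Covector n) (j : Fin n) :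
    form (canonical z) φ (dcoord (Sum.inl j)) = -φ (Pi.single (Sum.inr j) 1) ∧
      form (canonical z) φ (dcoord (Sum.inr j)) = φ (Pi.single (Sum.inl j) 1) := by
  constructor <;> rw [form_canonical] <;> simp [Pi.single_apply]

theorem tail_single_inl_succ {n : ℕ} (j : Fin n) :
    tail (Pi.single (Sum.inl j.succ) 1 : Phase (n + 1)) = Pi.single (Sum.inl j) 1 :=
  tail_single_shift (Sum.inl j)

theorem tail_single_inr_succ {n : ℕ} (j : Fin n) :
    tail (Pi.single (Sum.inr j.succ) 1 : Phase (n + 1)) = Pi.single (Sum.inr j) 1 :=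
  tail_single_shift (Sum.inr j)

variable (b : Boundary)

theorem dH_single_inr (n : ℕ) (z : Phase (n + 1)) (j : Fin (n + 1)) :
    dH b n z (Pi.single (Sum.inr j) 1) = 2 * z (Sum.inr j) := by
  induction n with
  | zero =>
    obtain rfl : j = 0 := Fin.ext (by omega)
    simp [dH_zero]
  | succ n ih =>
    refine Fin.cases ?_ (fun j => ?_) j
    · simp [dH_succ, extend_apply, tail_single_zero]
    · have h := ih (tail z) j
      simp [dH_succ, extend_apply, tail_single_inr_succ, h, dρ, tail_apply, Fin.succ_ne_zero]

theorem dH_succ_single_inl_zero (n : ℕ) (z : Phase (n + 2)) :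
    dH b (n + 1) z (Pi.single (Sum.inl 0) 1) =
      2 * (Complex.exp (z (Sum.inl 0)) * cρ b n (tail z)) := by
  simp [dH_succ, extend_apply, tail_single_zero]

theorem dH_succ_single_inl_succ (n : ℕ) (z : Phase (n + 2)) (j : Fin (n + 1)) :
    dH b (n + 1) z (Pi.single (Sum.inl j.succ) 1) =
      (if j = 0 then -2 * (Complex.exp (z (Sum.inl 0)) * cs b n (tail z)) else 0)
        + dH b n (tail z) (Pi.single (Sum.inl j) 1) := by
  rcases eq_or_ne j 0 with rfl | hj
  · rw [dH_succ]
    simp only [add_apply, smul_apply, extend_apply, tail_single_inl_succ]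
    simp [dρ]
    ring
  · simp [dH_succ, extend_apply, tail_single_inl_succ, dρ, Fin.succ_ne_zero, hj, hj.symm]

theorem dρ_single {n : ℕ} (z : Phase (n + 1)) (j : Fin (n + 1)) :
    dρ b n z (Pi.single (Sum.inl j) 1) = (if j = 0 then -cs b n z else 0) ∧
      dρ b n z (Pi.single (Sum.inr j) 1) = 0 := by
  constructor
  · rcases eq_or_ne j 0 with rfl | hj
    · simp [dρ]
    · simp [dρ, hj, hj.symm]
  · simp [dρ]

theorem fieldY_apply {n : ℕ} (z : Phase (n + 1)) (j : Fin (n + 1)) :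
    fieldY b n z (Sum.inl j) = (if j = 0 then -cs b n z else 0) ∧
      fieldY b n z (Sum.inr j) = (if j = 0 then -(cρ b n z * z (Sum.inr 0)) else 0) := by
  constructor <;> simp [fieldY, Pi.single_apply]

/-- The conditions on the entries of a recursive family of matrices given by `assemble`. -/
theorem isSecondFamily_assemble {qp pp : ∀ n, Phase (n + 1) → ℕ → ℕ → ℂ}
    (base : ∀ z, qp 0 z 1 1 = z (Sum.inr 0) ^ 2 + b.V (z (Sum.inl 0)))
    (qp_tail : ∀ n z i j, 1 ≤ i → 1 ≤ j → i ≤ n + 1 → j ≤ n + 1 →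
      qp (n + 1) z (i + 1) (j + 1) = qp n (tail z) i j)
    (pp_tail : ∀ n z i j, 1 ≤ i → 1 ≤ j → i ≤ n + 1 → j ≤ n + 1 →
      pp (n + 1) z (i + 1) (j + 1) = pp n (tail z) i j)
    (qp_one : ∀ n z, qp (n + 1) z 1 1 =
      z (Sum.inr 0) ^ 2 + 2 * (Complex.exp (z (Sum.inl 0)) * cρ b n (tail z)))
    (q_p : ∀ n z (j : Fin (n + 1)), qp (n + 1) z 1 (j + 2) =
      dH b n (tail z) (Pi.single (Sum.inl j) 1)
        - if j = 0 then Complex.exp (z (Sum.inl 0)) * cs b n (tail z) else 0)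
    (p_q : ∀ n z (j : Fin (n + 1)), qp (n + 1) z (j + 2) 1 =
      if j = 0 then Complex.exp (z (Sum.inl 0)) * cs b n (tail z) else 0)
    (p_p : ∀ n z (j : Fin (n + 1)), pp (n + 1) z 1 (j + 2) =
      if j = 0 then -(Complex.exp (z (Sum.inl 0)) *
        (z (Sum.inr 0) * cs b n (tail z) + cρ b n (tail z) * tail z (Sum.inr 0))) else 0)
    (pp_lower : ∀ n z i j, j ≤ i → pp n z i j = 0) :
    IsSecondFamily b fun n z => assemble (qqUpper z) (qp n z) (pp n z) where
  skew n z := by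
    ext a c
    rcases a with i | i <;> rcases c with j | j <;> simp [assemble]
  base z := base z
  shift_shift n z a c := by
    have hqq : ∀ i j : Fin (n + 1), qqUpper z (i + 1 + 1) (j + 1 + 1) =
        qqUpper (tail z) (i + 1) (j + 1) := fun i j => by
      simp only [qqUpper, Nat.add_lt_add_iff_right, pc_tail (Nat.le_add_left 1 j)]
    rcases a with i | i <;> rcases c with j | j <;> simp only [assemble, shift, Sum.map_inl,
      Sum.map_inr, Matrix.fromBlocks_apply₁₁, Matrix.fromBlocks_apply₁₂,
      Matrix.fromBlocks_apply₂₁, Matrix.fromBlocks_apply₂₂, Matrix.of_apply, Fin.val_succ, hqq]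
    · rw [qp_tail] <;> omega
    · rw [qp_tail] <;> omega
    · rw [pp_tail, pp_tail] <;> omega
  q_p n z := qp_one n z
  q_shift n z a := by
    rcases a with j | j
    · rw [(form_canonical_dcoord _ _ j).1, (form_canonical_dcoord _ _ j).1, dH_single_inr,
        (dρ_single b _ j).2]
      -- {q₁, qⱼ}₁ = -2pⱼ arises as {H, qⱼ}₀ = -∂H/∂pⱼ, and ρ₁ does not depend on the momenta.
      have h : pc z (j + 1 + 1) = tail z (Sum.inr j) := dif_pos (by omega)
      simp [assemble, qqUpper, h]
    · rw [(form_canonical_dcoord _ _ j).2, (form_canonical_dcoord _ _ j).2, (dρ_single b _ j).1]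
      refine (q_p n z j).trans ?_
      split_ifs <;> ring
  p_shift n z a := by
    rcases a with j | j
    · rw [(form_canonical_dcoord _ _ j).1, (dρ_single b _ j).2, (fieldY_apply b _ j).1]
      refine (congrArg Neg.neg (p_q n z j)).trans ?_
      split_ifs <;> ring
    · rw [(form_canonical_dcoord _ _ j).2, (dρ_single b _ j).1, (fieldY_apply b _ j).2]
      have h : pp (n + 1) z (j + 2) 1 = 0 := pp_lower _ _ _ _ (by omega)
      refine (congrArg₂ (· - ·) (p_p n z j) h).trans ?_
      split_ifs <;> ring

theorem exp_mul_exp_neg_eq_E {n : ℕ} (z : Phase (n + 2)) :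
    Complex.exp (z (Sum.inl 0)) * Complex.exp (-tail z (Sum.inl 0)) = E z 1 := by
  rw [← Complex.exp_add, ← sub_eq_add_neg]; rfl

/-! ### The second bracket of type `BC` -/

/-- In type BC a tail of any length has ρ₁ = e^(-q) in its first coordinate, so ρ and s both produce
E₁. -/
theorem exp_mul_cρ_BC (a₀ a₁ : ℂ) (n : ℕ) (z : Phase (n + 2)) :
    Complex.exp (z (Sum.inl 0)) * cρ (boundaryBC a₀ a₁) n (tail z) = E z 1 ∧
      Complex.exp (z (Sum.inl 0)) * cs (boundaryBC a₀ a₁) n (tail z) = E z 1 := by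
  cases n <;> exact ⟨exp_mul_exp_neg_eq_E z, exp_mul_exp_neg_eq_E z⟩

/-- The index j starts at 0: the coordinate is q_(j+1), which enters E_(j+1) with a plus and E_j
with a minus sign. -/
theorem dH_BC_single_inl (a₀ a₁ : ℂ) (n : ℕ) (z : Phase (n + 1)) (j : Fin (n + 1)) :
    dH (boundaryBC a₀ a₁) n z (Pi.single (Sum.inl j) 1) =
      (if (j : ℕ) = n then
        2 * a₀ * Complex.exp (qc z (n + 1)) + 2 * a₁ ^ 2 * Complex.exp (2 * qc z (n + 1))
      else 2 * E z (j + 1)) - if (j : ℕ) = 0 then 0 else 2 * E z j := by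
  induction n with
  | zero =>
    obtain rfl : j = 0 := Fin.ext (by omega)
    simp [dH_zero, boundaryBC, qc]
  | succ n ih =>
    refine Fin.cases ?_ (fun j => ?_) j
    · rw [dH_succ_single_inl_zero, (exp_mul_cρ_BC a₀ a₁ n z).1]
      simp
    · rw [dH_succ_single_inl_succ, (exp_mul_cρ_BC a₀ a₁ n z).2, ih, qc_tail (by omega),
        E_tail (by omega)]
      rcases eq_or_ne j 0 with rfl | hj
      · rcases eq_or_ne n 0 with rfl | hn
        · norm_num
          ring
        · norm_num [hn, hn.symm]
          ring
      · have hj' : (j : ℕ) ≠ 0 := fun h => hj (Fin.ext h)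
        rw [E_tail (by omega)]
        simp [hj, hj']

theorem qpBC_tail (a₀ a₁ : ℂ) {n i j : ℕ} (z : Phase (n + 2)) (hi : 1 ≤ i) (hj : 1 ≤ j) :
    qpBC a₀ a₁ z (i + 1) (j + 1) = qpBC a₀ a₁ (tail z) i j := by
  simp only [qpBC, Nat.add_right_cancel_iff, qc_tail (Nat.le_add_left 1 n),
    pc_tail (Nat.le_add_left 1 n), pc_tail hi, E_tail hi, E_tail hj, E_tail (Nat.le_add_left 1 i)]
  have hE : ∀ k, 2 ≤ k → E (tail z) (k - 1) = E z (k + 1 - 1) := fun k hk => by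
    rw [E_tail (by omega)]
    congr 1
    omega
  split_ifs <;> first | rfl | omega | skip
  · rw [hE (n + 1) (by omega)]
  · rw [hE (n + 1) (by omega)]
  · rw [hE j (by omega)]

theorem isSecondFamily_BC (a₀ a₁ : ℂ) :
    IsSecondFamily (boundaryBC a₀ a₁) fun n (z : Phase (n + 1)) => secondBC a₀ a₁ z := by
  refine isSecondFamily_assemble (boundaryBC a₀ a₁) (qp := fun n z => qpBC a₀ a₁ z)
    (pp := fun n z => ppUpperBC z) (fun z => ?_)
    (fun n z i j hi hj _ _ => qpBC_tail a₀ a₁ z hi hj) (fun n z i j hi hj _ _ => ?_)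
    (fun n z => ?_) (fun n z j => ?_) (fun n z j => ?_) (fun n z j => ?_) (fun n z i j h => ?_)
  · simp [qpBC, pc, qc, boundaryBC, add_assoc]
  · simp only [ppUpperBC, Nat.add_right_cancel_iff, pc_tail hi, pc_tail (Nat.le_add_left 1 i),
      E_tail hi]
  · rw [(exp_mul_cρ_BC a₀ a₁ n z).1]
    simp [qpBC, pc]
  · rw [(exp_mul_cρ_BC a₀ a₁ n z).2, dH_BC_single_inl, qc_tail (by omega), E_tail (by omega)]
    rcases eq_or_ne j 0 with rfl | hj
    · rcases eq_or_ne n 0 with rfl | hn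
      · simp [qpBC]
      · simp [qpBC, hn, hn.symm]
    · have hj' : (j : ℕ) ≠ 0 := fun h => hj (Fin.ext h)
      rw [E_tail (by omega)]
      have hj1 : 1 ≤ (j : ℕ) := by omega
      rcases eq_or_ne (j : ℕ) n with hn | hn
      · simp [qpBC, hj, hn, hn ▸ hj', hn ▸ hj1]
        ring
      · simp [qpBC, hj, hj', hn, hj1]
  · rw [(exp_mul_cρ_BC a₀ a₁ n z).2]
    rcases eq_or_ne j 0 with rfl | hj
    · simp [qpBC]
    · have hj' : (j : ℕ) ≠ 0 := fun h => hj (Fin.ext h)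
      simp [qpBC, hj, hj']
  · have h := exp_mul_cρ_BC a₀ a₁ n z
    rcases eq_or_ne j 0 with rfl | hj
    · simp [ppUpperBC, pc, tail_apply]
      linear_combination z (Sum.inr 0) * h.2 + z (Sum.inr 1) * h.1
    · have hj' : (j : ℕ) ≠ 0 := fun h => hj (Fin.ext h)
      simp [ppUpperBC, hj, hj']
  · simp only [ppUpperBC]
    rw [if_neg (by omega)]

/-! ### The second bracket of type `D` -/

/-- Only a one-site tail feels the second exponential in ρ and s. This is where Z comes from, and
why the last two sites are exceptional in type D. -/
theorem exp_mul_cρ_D_zero (a₂ : ℂ) (z : Phase 2) :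
    Complex.exp (z (Sum.inl 0)) * cρ (boundaryD a₂) 0 (tail z) = E z 1 + Z a₂ z ∧
      Complex.exp (z (Sum.inl 0)) * cs (boundaryD a₂) 0 (tail z) = E z 1 - Z a₂ z := by
  have h1 := exp_mul_exp_neg_eq_E z
  have h2 : Z a₂ z = a₂ ^ 2 * (Complex.exp (z (Sum.inl 0)) * Complex.exp (tail z (Sum.inl 0))) := by
    rw [← Complex.exp_add]; rfl
  constructor <;> simp only [cρ, cs, boundaryD]
  · linear_combination h1 - h2
  · linear_combination h1 + h2

theorem exp_mul_cρ_D (a₂ : ℂ) (n : ℕ) (z : Phase (n + 3)) :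
    Complex.exp (z (Sum.inl 0)) * cρ (boundaryD a₂) (n + 1) (tail z) = E z 1 ∧
      Complex.exp (z (Sum.inl 0)) * cs (boundaryD a₂) (n + 1) (tail z) = E z 1 :=
  ⟨exp_mul_exp_neg_eq_E z, exp_mul_exp_neg_eq_E z⟩

/-- The tail must have two sites. For one site the truncated index n - 1 = 0 falls back to q₁ and Z
would be meaningless, so that step is treated separately below. -/
theorem Z_tail (a₂ : ℂ) {n : ℕ} (z : Phase (n + 3)) : Z a₂ (tail z) = Z a₂ z := by
  rw [Z, Z, qc_tail (by omega), qc_tail (by omega)]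
  rfl

theorem dH_D_zero (a₂ : ℂ) (z : Phase 1) : dH (boundaryD a₂) 0 z (Pi.single (Sum.inl 0) 1) = 0 := by
  simp [dH_zero, boundaryD]

theorem dH_D_single_inl (a₂ : ℂ) (n : ℕ) (z : Phase (n + 2)) (j : Fin (n + 2)) :
    dH (boundaryD a₂) (n + 1) z (Pi.single (Sum.inl j) 1) =
      (if (j : ℕ) = n + 1 then 2 * Z a₂ z
      else if (j : ℕ) = n then 2 * E z (j + 1) + 2 * Z a₂ z else 2 * E z (j + 1))
        - if (j : ℕ) = 0 then 0 else 2 * E z j := by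
  induction n with
  | zero =>
    refine Fin.cases ?_ (fun j => ?_) j
    · rw [dH_succ_single_inl_zero, (exp_mul_cρ_D_zero a₂ z).1]
      simp
      ring
    · obtain rfl : j = 0 := Fin.ext (by omega)
      rw [dH_succ_single_inl_succ, (exp_mul_cρ_D_zero a₂ z).2, dH_D_zero]
      simp
      ring
  | succ n ih =>
    refine Fin.cases ?_ (fun j => ?_) j
    · rw [dH_succ_single_inl_zero, (exp_mul_cρ_D a₂ n z).1]
      simp
    · rw [dH_succ_single_inl_succ, (exp_mul_cρ_D a₂ n z).2, ih, Z_tail, E_tail (by omega)]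
      rcases eq_or_ne j 0 with rfl | hj
      · rcases eq_or_ne n 0 with rfl | hn
        · norm_num
          ring
        · norm_num [hn, hn.symm]
          ring
      · have hj' : (j : ℕ) ≠ 0 := fun h => hj (Fin.ext h)
        rw [E_tail (by omega)]
        simp [hj, hj']

theorem qpD_tail (a₂ : ℂ) {n i j : ℕ} (z : Phase (n + 2)) (hi : 1 ≤ i) (hj : 1 ≤ j)
    (hi' : i ≤ n + 1) (hj' : j ≤ n + 1) :
    qpD a₂ z (i + 1) (j + 1) = qpD a₂ (tail z) i j := by
  cases n with
  | zero =>
    obtain rfl : i = 1 := by omega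
    obtain rfl : j = 1 := by omega
    simp [qpD, pc_tail]
  | succ n =>
    have hE : ∀ k, 2 ≤ k → E (tail z) (k - 1) = E z (k + 1 - 1) := fun k hk => by
      rw [E_tail (by omega)]
      congr 1
      omega
    simp only [qpD, Nat.add_right_cancel_iff, pc_tail hi, E_tail hi, E_tail hj,
      E_tail (Nat.le_add_left 1 i), Z_tail, Nat.add_sub_cancel, pc_tail (Nat.le_add_left 1 _),
      show n + 1 + 2 - 1 = n + 1 + 1 from rfl, show n + 1 + 1 - 1 = n + 1 from rfl,
      E_tail (Nat.le_add_left 1 n)]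
    split_ifs <;> first | rfl | omega | skip
    · rw [show E (tail z) (n + 1 + 1 - 2) = E z (n + 1) from hE (n + 1) (by omega)]
    · rw [show E (tail z) (n + 1 + 1 - 2) = E z (n + 1) from hE (n + 1) (by omega)]
    · rw [hE j (by omega), Nat.add_sub_cancel]

theorem isSecondFamily_D (a₂ : ℂ) :
    IsSecondFamily (boundaryD a₂) fun n (z : Phase (n + 1)) => secondD a₂ z := by
  refine isSecondFamily_assemble (boundaryD a₂) (qp := fun n z => qpD a₂ z)
    (pp := fun n z => ppUpperD a₂ z) (fun z => ?_)
    (fun n z i j hi hj hi' hj' => qpD_tail a₂ z hi hj hi' hj')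
    (fun n z i j hi hj hi' hj' => ?_)
    (fun n z => ?_) (fun n z j => ?_) (fun n z j => ?_) (fun n z j => ?_) (fun n z i j h => ?_)
  · simp [qpD, pc, boundaryD]
  · cases n with
    | zero =>
      obtain rfl : i = 1 := by omega
      obtain rfl : j = 1 := by omega
      simp [ppUpperD]
    | succ n =>
      simp only [ppUpperD, Nat.add_right_cancel_iff, pc_tail hi, pc_tail (Nat.le_add_left 1 _),
        E_tail hi, Z_tail, show n + 1 + 2 - 1 = n + 1 + 1 from rfl,
        show n + 1 + 1 - 1 = n + 1 from rfl, E_tail (Nat.le_add_left 1 _)]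
  · cases n with
    | zero =>
      rw [(exp_mul_cρ_D_zero a₂ z).1]
      simp [qpD, pc]
      ring
    | succ n =>
      rw [(exp_mul_cρ_D a₂ n z).1]
      simp [qpD, pc]
  · cases n with
    | zero =>
      obtain rfl : j = 0 := Fin.ext (by omega)
      rw [(exp_mul_cρ_D_zero a₂ z).2, dH_D_zero]
      simp [qpD]
    | succ n =>
      rw [(exp_mul_cρ_D a₂ n z).2, dH_D_single_inl, Z_tail, E_tail (by omega)]
      rcases eq_or_ne j 0 with rfl | hj
      · rcases eq_or_ne n 0 with rfl | hn
        · simp [qpD]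
          ring
        · simp [qpD, hn, hn.symm]
      · have hj' : (j : ℕ) ≠ 0 := fun h => hj (Fin.ext h)
        rw [E_tail (by omega)]
        have hj1 : 1 ≤ (j : ℕ) := by omega
        simp only [qpD, show n + 1 + 1 + 1 - 1 = n + 2 from rfl,
          show n + 1 + 1 + 1 - 2 = n + 1 from rfl]
        simp [hj, hj', hj1]
        split_ifs with h1 h2
        · rw [h1]
        · rw [h2]
          ring
        · rfl
  · rcases eq_or_ne j 0 with rfl | hj
    · cases n with
      | zero =>
        rw [(exp_mul_cρ_D_zero a₂ z).2]
        simp [qpD]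
      | succ n =>
        rw [(exp_mul_cρ_D a₂ n z).2]
        simp [qpD]
    · have hj' : (j : ℕ) ≠ 0 := fun h => hj (Fin.ext h)
      simp [qpD, hj, hj']
  · rcases eq_or_ne j 0 with rfl | hj
    · cases n with
      | zero =>
        have h := exp_mul_cρ_D_zero a₂ z
        simp [ppUpperD, pc, tail_apply]
        linear_combination z (Sum.inr 0) * h.2 + z (Sum.inr 1) * h.1
      | succ n =>
        have h := exp_mul_cρ_D a₂ n z
        simp [ppUpperD, pc, tail_apply]
        linear_combination z (Sum.inr 0) * h.2 + z (Sum.inr 1) * h.1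
    · have hj' : (j : ℕ) ≠ 0 := fun h => hj (Fin.ext h)
      simp [ppUpperD, hj, hj']
  · simp only [ppUpperD]
    rw [if_neg (by omega)]

end TodaReflection
end

open Polynomial

noncomputable section

namespace TodaReflection

open Filter Topology

/-! ### Differentiability of the second brackets -/

theorem differentiable_qc {n : ℕ} (i : ℕ) : Differentiable ℂ fun z : Phase n => qc z i := by
  unfold qc
  split_ifs <;> fun_prop

theorem differentiable_pc {n : ℕ} (i : ℕ) : Differentiable ℂ fun z : Phase n => pc z i := by
  unfold pc
  split_ifs <;> fun_prop

theorem differentiable_E {n : ℕ} (i : ℕ) : Differentiable ℂ fun z : Phase n => E z i :=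
  ((differentiable_qc i).sub (differentiable_qc (i + 1))).cexp

theorem differentiable_Z {n : ℕ} (a₂ : ℂ) : Differentiable ℂ fun z : Phase n => Z a₂ z :=
  ((differentiable_qc (n - 1)).add (differentiable_qc n)).cexp.const_mul _

theorem differentiable_assemble {n : ℕ} {qq qp pp : Phase n → ℕ → ℕ → ℂ}
    (hqq : ∀ i j, Differentiable ℂ fun z => qq z i j)
    (hqp : ∀ i j, Differentiable ℂ fun z => qp z i j)
    (hpp : ∀ i j, Differentiable ℂ fun z => pp z i j) (a c : Fin n ⊕ Fin n) :
    Differentiable ℂ fun z => assemble (qq z) (qp z) (pp z) a c := by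
  rcases a with i | i <;> rcases c with j | j
  · exact (hqq _ _).sub (hqq _ _)
  · exact hqp _ _
  · exact (hqp _ _).neg
  · exact (hpp _ _).sub (hpp _ _)

theorem differentiable_qqUpper {n : ℕ} (i j : ℕ) :
    Differentiable ℂ fun z : Phase n => qqUpper z i j := by
  have hp := fun i => differentiable_pc (n := n) i
  unfold qqUpper
  split_ifs <;> fun_prop

theorem differentiable_secondBC (a₀ a₁ : ℂ) {n : ℕ} (a c : Fin n ⊕ Fin n) :
    Differentiable ℂ fun z : Phase n => secondBC a₀ a₁ z a c := by
  have hq := fun i => differentiable_qc (n := n) i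
  have hp := fun i => differentiable_pc (n := n) i
  have hE := fun i => differentiable_E (n := n) i
  refine differentiable_assemble differentiable_qqUpper (fun i j => ?_) (fun i j => ?_) a c
  · unfold qpBC
    split_ifs <;> fun_prop
  · unfold ppUpperBC
    split_ifs <;> fun_prop

theorem differentiable_secondD (a₂ : ℂ) {n : ℕ} (a c : Fin n ⊕ Fin n) :
    Differentiable ℂ fun z : Phase n => secondD a₂ z a c := by
  have hZ := differentiable_Z (n := n) a₂
  have hp := fun i => differentiable_pc (n := n) i
  have hE := fun i => differentiable_E (n := n) i
  refine differentiable_assemble differentiable_qqUpper (fun i j => ?_) (fun i j => ?_) a c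
  · unfold qpD
    split_ifs <;> fun_prop
  · unfold ppUpperD
    split_ifs <;> fun_prop

/-! ### The Hamiltonians -/

theorem sum_Icc_one_eq_sum_range (f : ℕ → ℂ) (n : ℕ) :
    ∑ i ∈ Finset.Icc 1 n, f i = ∑ i ∈ Finset.range n, f (i + 1) := by
  induction n with
  | zero => simp
  | succ n ih => rw [Finset.sum_Icc_succ_top (by omega), ih, Finset.sum_range_succ]

/-- The potential of the tail may be chosen freely, since it is added and subtracted. This covers
the D chain with one site, which has none. -/
theorem hamiltonian_succ {n : ℕ} {V : Phase (n + 2) → ℂ} {V' : Phase (n + 1) → ℂ}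
    (z : Phase (n + 2)) :
    hamiltonian V z =
      z (Sum.inr 0) ^ 2 + 2 * E z 1 + (V z - V' (tail z)) + hamiltonian V' (tail z) := by
  simp only [hamiltonian, sum_Icc_one_eq_sum_range, Nat.add_sub_cancel,
    show n + 2 - 1 = n + 1 from rfl, Finset.sum_range_succ' _ n,
    Finset.sum_range_succ' (fun i => pc z (i + 1) ^ 2) (n + 1),
    qc_tail (Nat.le_add_left 1 _), pc_tail (Nat.le_add_left 1 _)]
  rw [show pc z (0 + 1) = z (Sum.inr 0) from rfl, E]
  simp only [zero_add]
  ring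

theorem cH_BC (a₀ a₁ : ℂ) {n : ℕ} (z : Phase (n + 1)) :
    cH (boundaryBC a₀ a₁) n z = hamiltonian (potentialBC a₀ a₁) z := by
  induction n with
  | zero => simp [cH, hamiltonian, potentialBC, boundaryBC, pc, qc]
  | succ n ih =>
    rw [cH, ih, (exp_mul_cρ_BC a₀ a₁ n z).1,
      hamiltonian_succ (V' := potentialBC a₀ a₁), potentialBC, potentialBC, qc_tail (by omega)]
    ring

theorem cH_D (a₂ : ℂ) {n : ℕ} (z : Phase (n + 2)) :
    cH (boundaryD a₂) (n + 1) z = hamiltonian (potentialD a₂) z := by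
  have hV : ∀ {n} (z : Phase (n + 2)), potentialD a₂ z = 2 * Z a₂ z := fun z => by
    rw [potentialD, Z]; ring
  induction n with
  | zero =>
    rw [cH, cH, (exp_mul_cρ_D_zero a₂ z).1, hamiltonian_succ (V' := fun _ => 0), hV]
    simp [hamiltonian, boundaryD, pc]
    ring
  | succ n ih =>
    rw [cH, ih, (exp_mul_cρ_D a₂ n z).1, hamiltonian_succ (V' := potentialD a₂) z, hV, hV, Z_tail]
    ring

/-! ### The changes of variables are canonical -/

/-- Each pair (qᵢ, pᵢ) is changed separately, with a triangular Jacobian of determinant αᵢβᵢ = 1;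
the off-diagonal γᵢ drops out of the brackets. -/
theorem isCanonicalAt_of_hasFDerivAt {n : ℕ} {Φ : Phase n → Phase n} {z : Phase n}
    {α β γ : Fin n → ℂ} (hαβ : ∀ i, α i * β i = 1)
    (hq : ∀ i, HasFDerivAt (fun w => Φ w (Sum.inl i)) (α i • dcoord (Sum.inl i) : Covector n) z)
    (hp : ∀ i, HasFDerivAt (fun w => Φ w (Sum.inr i))
      (β i • dcoord (Sum.inr i) + γ i • dcoord (Sum.inl i) : Covector n) z) :
    IsCanonicalAt Φ z := by
  refine ⟨differentiableAt_pi.mpr fun a => ?_, fun a c => ?_⟩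
  · rcases a with i | i
    · exact (hq i).differentiableAt
    · exact (hp i).differentiableAt
  rcases a with i | i <;> rcases c with j | j
  · refine (bracketAt_of_hasFDerivAt _ (hq i) (hq j)).trans ?_
    simp only [map_smul, LinearMap.smul_apply, form_dcoord]
    simp [canonical]
  · refine (bracketAt_of_hasFDerivAt _ (hq i) (hp j)).trans ?_
    simp only [map_smul, map_add, LinearMap.smul_apply, form_dcoord]
    rcases eq_or_ne i j with rfl | h
    · simp [canonical, hαβ, mul_comm (β i)]
    · simp [canonical, h]
  · refine (bracketAt_of_hasFDerivAt _ (hp i) (hq j)).trans ?_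
    simp only [map_smul, map_add, LinearMap.smul_apply, LinearMap.add_apply, form_dcoord]
    rcases eq_or_ne i j with rfl | h
    · simp [canonical, hαβ, mul_comm (β i)]
    · simp [canonical, h]
  · refine (bracketAt_of_hasFDerivAt _ (hp i) (hp j)).trans ?_
    simp only [map_smul, map_add, LinearMap.smul_apply, LinearMap.add_apply, form_dcoord]
    rcases eq_or_ne i j with rfl | h
    · simp [canonical]
      ring
    · simp [canonical, h]

theorem hasFDerivAt_coord {n : ℕ} (a : Fin n ⊕ Fin n) (z : Phase n) :
    HasFDerivAt (fun w : Phase n => w a) (dcoord a : Covector n) z :=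
  (dcoord a : Covector n).hasFDerivAt

theorem isCanonicalAt_changeBC {n : ℕ} (a₁ : ℂ) (z : Phase n) :
    IsCanonicalAt (changeBC a₁) z := by
  refine isCanonicalAt_of_hasFDerivAt (α := fun _ => 1) (β := fun _ => 1)
    (γ := fun i => if (i : ℕ) + 1 = n then
      -(Complex.I * a₁ * Complex.exp (z (Sum.inl i))) else 0) (fun i => mul_one 1)
    (fun i => ?_) (fun i => ?_)
  · rw [one_smul]
    exact hasFDerivAt_coord _ z
  · simp only [changeBC]
    split_ifs
    · refine ((hasFDerivAt_coord (Sum.inr i) z).fun_sub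
        ((hasFDerivAt_coord (Sum.inl i) z).cexp.const_mul (Complex.I * a₁))).congr_fderiv ?_
      module
    · refine (hasFDerivAt_coord (Sum.inr i) z).congr_fderiv ?_
      module

theorem isCanonicalAt_changeD {n : ℕ} {a₂ : ℂ} (ha : a₂ ≠ 0) {z : Phase n}
    (hz : Complex.sinh (shifted a₂ z) ≠ 0)
    (hs : -2 * a₂ * (Complex.cosh (shifted a₂ z) + 1) ∈ Complex.slitPlane) :
    IsCanonicalAt (changeD a₂) z := by
  have hc := cosh_add_one_ne_zero hz
  have hsh : ∀ i : Fin n, (i : ℕ) + 1 = n →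
      HasFDerivAt (fun w : Phase n => shifted a₂ w) (dcoord (Sum.inl i) : Covector n) z :=
    fun i hi => by
      have : (fun w : Phase n => shifted a₂ w) =
          fun w => w (Sum.inl i) + Complex.log (-a₂) := funext fun w => by
        rw [shifted, qc, dif_pos (by omega)]
        congr 4
        omega
      rw [this]
      exact (hasFDerivAt_coord _ z).add_const _
  set u := shifted a₂ z with hu
  refine isCanonicalAt_of_hasFDerivAt
    (α := fun i => if (i : ℕ) + 1 = n then -(Complex.sinh u / (Complex.cosh u + 1)) else 1)
    (β := fun i => if (i : ℕ) + 1 = n then -((Complex.cosh u + 1) / Complex.sinh u) else 1)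
    (γ := fun i => if (i : ℕ) + 1 = n then -z (Sum.inr i) *
      ((Complex.sinh u * Complex.sinh u - (Complex.cosh u + 1) * Complex.cosh u) /
        Complex.sinh u ^ 2) else 0)
    (fun i => ?_) (fun i => ?_) (fun i => ?_)
  · split_ifs
    · field_simp
    · exact mul_one 1
  · simp only [changeD]
    split_ifs with hi
    · have h1 : HasDerivAt (fun u => -Complex.log (-2 * a₂ * (Complex.cosh u + 1)))
          -- The condition `hs` is used only here, to differentiate the principal logarithm.
          (-(-2 * a₂ * Complex.sinh u / (-2 * a₂ * (Complex.cosh u + 1)))) u :=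
        ((((Complex.hasDerivAt_cosh u).add_const 1).const_mul (-2 * a₂)).clog hs).fun_neg
      refine (h1.comp_hasFDerivAt z (hsh i hi)).congr_fderiv ?_
      congr 1
      field_simp
    · refine (hasFDerivAt_coord _ z).congr_fderiv ?_
      module
  · simp only [changeD]
    split_ifs with hi
    · have h1 : HasDerivAt (fun u => (Complex.cosh u + 1) / Complex.sinh u)
          ((Complex.sinh u * Complex.sinh u - (Complex.cosh u + 1) * Complex.cosh u) /
            Complex.sinh u ^ 2) u :=
        ((Complex.hasDerivAt_cosh u).add_const 1).fun_div (Complex.hasDerivAt_sinh u) hz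
      refine ((hasFDerivAt_coord (Sum.inr i) z).fun_neg.fun_mul
        (h1.comp_hasFDerivAt z (hsh i hi))).congr_fderiv ?_
      simp only [Function.comp, ← hu]
      module
    · refine (hasFDerivAt_coord _ z).congr_fderiv ?_
      module

theorem bracket_integralOf {b : Boundary}
    {P : ∀ n, Phase (n + 1) → BivMatrix (n + 1)} (hP : IsSecondFamily b P) {n : ℕ}
    {T : Phase (n + 1) → Matrix (Fin 2) (Fin 2) ℂ[X]} {z : Phase (n + 1)}
    (hT : ∀ᶠ w in 𝓝 z, T w = reflectionMatrix (chain b n w)) (i j : ℕ) :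
    bracket canonical (integralOf T i) (integralOf T j) z = 0 ∧
      bracket (P n) (integralOf T i) (integralOf T j) z = 0 := by
  have h : ∀ i, fderiv ℂ (integralOf T i) z = fderiv ℂ (chainIntegral b n i) z := fun i =>
    EventuallyEq.fderiv_eq (hT.mono fun w hw => integralOf_eq hw i)
  have := bracket_chainIntegral hP n i j z
  simp only [bracket, bracketAt_eq_form] at this ⊢
  rwa [h, h]

/-- The condition sinh u ≠ 0 is open, so the matrices agree near z and have the same differentials
there. -/
theorem eventually_laxD_eq {a₂ : ℂ} (ha : a₂ ≠ 0) {n : ℕ} {z : Phase (n + 1)}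
    (hz : Complex.sinh (shifted a₂ z) ≠ 0) :
    ∀ᶠ w in 𝓝 z, laxD a₂ w = reflectionMatrix (chain (boundaryD a₂) n w) := by
  have hc : Continuous fun w : Phase (n + 1) => Complex.sinh (shifted a₂ w) :=
    Complex.continuous_sinh.comp ((differentiable_qc (n + 1)).continuous.add continuous_const)
  exact (hc.continuousAt.eventually_ne hz).mono fun w hw => laxD_eq ha w hw

end TodaReflection
end

theorem mainTheorem6 (n : ℕ) :
    -- the `BCₙ` lattice, on the whole phase space
    (1 ≤ n → ∀ a₀ a₁ : ℂ,
      (∀ z : TodaReflection.Phase n,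
        TodaReflection.IsCanonicalAt (TodaReflection.changeBC a₁) z ∧
        TodaReflection.IsReflectionFormAt (TodaReflection.laxBC a₀ a₁) z ∧
        (∀ M : TodaReflection.BivMatrix n, M.transpose = -M →
          ((TodaReflection.SatisfiesBracket 1 0 (TodaReflection.laxBC a₀ a₁) M z ↔
              M = TodaReflection.canonical z) ∧
            (TodaReflection.SatisfiesBracket 1 1 (TodaReflection.laxBC a₀ a₁) M z ↔
              M = TodaReflection.secondBC a₀ a₁ z))) ∧
        TodaReflection.GeneratesIntegralsAt (TodaReflection.laxBC a₀ a₁) z ∧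
        TodaReflection.integralOf (TodaReflection.laxBC a₀ a₁) 1 z =
          -TodaReflection.hamiltonian (TodaReflection.potentialBC a₀ a₁) z ∧
        (∀ i ∈ Finset.Icc 1 n, ∀ j ∈ Finset.Icc 1 n,
          TodaReflection.bracket TodaReflection.canonical
            (TodaReflection.integralOf (TodaReflection.laxBC a₀ a₁) i)
            (TodaReflection.integralOf (TodaReflection.laxBC a₀ a₁) j) z = 0 ∧
          TodaReflection.bracket (TodaReflection.secondBC a₀ a₁)
            (TodaReflection.integralOf (TodaReflection.laxBC a₀ a₁) i)
            (TodaReflection.integralOf (TodaReflection.laxBC a₀ a₁) j) z = 0)) ∧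
      TodaReflection.Compatible (n := n) TodaReflection.canonical
        (TodaReflection.secondBC a₀ a₁)) ∧
    -- the `Dₙ` lattice, away from the singular set of the change of variables
    (2 ≤ n → ∀ a₂ : ℂ, a₂ ≠ 0 →
      (∀ z : TodaReflection.Phase n,
        Complex.sinh (TodaReflection.shifted a₂ z) ≠ 0 →
        (-2 * a₂ * (Complex.cosh (TodaReflection.shifted a₂ z) + 1) ∈ Complex.slitPlane →
          TodaReflection.IsCanonicalAt (TodaReflection.changeD a₂) z) ∧
        TodaReflection.IsReflectionFormAt (TodaReflection.laxD a₂) z ∧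
        (∀ M : TodaReflection.BivMatrix n, M.transpose = -M →
          ((TodaReflection.SatisfiesBracket 1 0 (TodaReflection.laxD a₂) M z ↔
              M = TodaReflection.canonical z) ∧
            (TodaReflection.SatisfiesBracket 1 1 (TodaReflection.laxD a₂) M z ↔
              M = TodaReflection.secondD a₂ z))) ∧
        TodaReflection.GeneratesIntegralsAt (TodaReflection.laxD a₂) z ∧
        TodaReflection.integralOf (TodaReflection.laxD a₂) 1 z =
          -TodaReflection.hamiltonian (TodaReflection.potentialD a₂) z ∧
        (∀ i ∈ Finset.Icc 1 n, ∀ j ∈ Finset.Icc 1 n,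
          TodaReflection.bracket TodaReflection.canonical
            (TodaReflection.integralOf (TodaReflection.laxD a₂) i)
            (TodaReflection.integralOf (TodaReflection.laxD a₂) j) z = 0 ∧
          TodaReflection.bracket (TodaReflection.secondD a₂)
            (TodaReflection.integralOf (TodaReflection.laxD a₂) i)
            (TodaReflection.integralOf (TodaReflection.laxD a₂) j) z = 0)) ∧
      TodaReflection.Compatible (n := n) TodaReflection.canonical
        (TodaReflection.secondD a₂) ∧
      -- the integrals extend to the whole phase space and are in bi-involution there
      (∃ H : ℕ → TodaReflection.Phase n → ℂ,
        (∀ i ∈ Finset.Icc 1 n, Differentiable ℂ (H i) ∧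
          ∀ z : TodaReflection.Phase n, Complex.sinh (TodaReflection.shifted a₂ z) ≠ 0 →
            H i z = TodaReflection.integralOf (TodaReflection.laxD a₂) i z) ∧
        (∀ i ∈ Finset.Icc 1 n, ∀ j ∈ Finset.Icc 1 n, ∀ z : TodaReflection.Phase n,
          TodaReflection.bracket TodaReflection.canonical (H i) (H j) z = 0 ∧
          TodaReflection.bracket (TodaReflection.secondD a₂) (H i) (H j) z = 0))) := by
  constructor
  · intro hn a₀ a₁
    obtain ⟨n, rfl⟩ : ∃ m, n = m + 1 := ⟨n - 1, by omega⟩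
    have hP := TodaReflection.isSecondFamily_BC a₀ a₁
    refine ⟨fun z => ?_, fun c₀ c₁ => TodaReflection.isPoisson_pencil hP
      (fun _ => TodaReflection.differentiable_secondBC a₀ a₁)
      (TodaReflection.dense_boundaryBC a₀ a₁) c₀ c₁ n⟩
    have hT := Filter.Eventually.of_forall (f := nhds z) fun w => TodaReflection.laxBC_eq a₀ a₁ w
    refine ⟨TodaReflection.isCanonicalAt_changeBC a₁ z,
      TodaReflection.isReflectionFormAt_of_chain hT,
      fun M hM => TodaReflection.satisfiesBracket_iff hP (Complex.exp_ne_zero _) hT hM,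
      TodaReflection.generatesIntegralsAt_of_chain hT.self_of_nhds, ?_,
      fun i _ j _ => TodaReflection.bracket_integralOf hP hT i j⟩
    rw [TodaReflection.integralOf_eq hT.self_of_nhds, TodaReflection.chainIntegral_one,
      TodaReflection.cH_BC]
  · intro hn a₂ ha
    obtain ⟨n, rfl⟩ : ∃ m, n = m + 2 := ⟨n - 2, by omega⟩
    have hP := TodaReflection.isSecondFamily_D a₂
    refine ⟨fun z hz => ?_, fun c₀ c₁ => TodaReflection.isPoisson_pencil hP
      (fun _ => TodaReflection.differentiable_secondD a₂)
      (TodaReflection.dense_boundaryD a₂) c₀ c₁ (n + 1),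
      -- The coefficients of B of the chain are entire and involve no change of variables, so they
      -- extend the integrals.
      TodaReflection.chainIntegral (TodaReflection.boundaryD a₂) (n + 1),
      fun i _ => ⟨TodaReflection.differentiable_chainIntegral _ _ i, fun z hz =>
        (TodaReflection.integralOf_eq (TodaReflection.laxD_eq ha z hz) i).symm⟩,
      fun i _ j _ z => TodaReflection.bracket_chainIntegral hP (n + 1) i j z⟩
    have hT := TodaReflection.eventually_laxD_eq ha hz
    -- s(qₙ) = 2 a₂ sinh u, so off the singular set dA and dB span at z itself.
    have hs : (TodaReflection.boundaryD a₂).s (TodaReflection.qc z (n + 2)) ≠ 0 := by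
      rw [← TodaReflection.two_mul_sinh_shifted ha]
      exact mul_ne_zero (mul_ne_zero two_ne_zero ha) hz
    have hq : TodaReflection.qc z (n + 2) = z (Sum.inl (Fin.last (n + 1))) := dif_pos (by omega)
    rw [hq] at hs
    refine ⟨TodaReflection.isCanonicalAt_changeD ha hz,
      TodaReflection.isReflectionFormAt_of_chain hT,
      fun M hM => TodaReflection.satisfiesBracket_iff hP hs hT hM,
      TodaReflection.generatesIntegralsAt_of_chain hT.self_of_nhds, ?_,
      fun i _ j _ => TodaReflection.bracket_integralOf hP hT i j⟩
    rw [TodaReflection.integralOf_eq hT.self_of_nhds, TodaReflection.chainIntegral_one,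
      TodaReflection.cH_D]
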